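/- For every positive even integer $\alpha$ there are a real-RAM program and a constant $C$, both depending only on $\alpha$, such that the following holds. Let $n\ge 3$ and $m\ge 0$ be integers, let $\beta>1$ and $N>0$ be reals, let $s_1,\dots,s_n\in\mathbb{R}$ be the distinct positions of $n$ transmitters, all of power $1$, and let $q_1,\dots,q_m\in\mathbb{R}$ be the positions of $m$ receivers. Given $n,m,\beta,N,(s_i),(q_j)$ as input, the program halts after at most $$C\,(n+m)\,\log^2 n\,\log\log n$$ steps and outputs, for every $j$, the index $i$ of the unique transmitter that is received by $q_j$, or the answer that $q_j$ receives none of the transmitters. Here a receiver at $q\notin\{s_1,\dots,s_n\}$ receives the transmitter $s_i$ if $$\frac{\dfrac{1}{|q-s_i|^\alpha}}{\sum_{k\neq i}\dfrac{1}{|q-s_k|^\alpha}+N}\ \ge\ \beta ,$$ and a receiver at $q=s_i$ receives $s_i$ and no other transmitter. A real RAM is a random access machine that performs exact additions, subtractions, multiplications, divisions and comparisons of real numbers, and additions, subtractions, halvings and comparisons of natural numbers (used as counters and addresses), each at unit cost; the only constants in its finite program are integers. -/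

import Mathlib

/-! ### The real RAM

A uniform random access machine over the reals.  It has natural-number scalars and arrays
(counters, indices, addresses) and real scalars and arrays.  On natural numbers it can add,
subtract, halve and compare; on real numbers it can do exact `+`, `-`, `*`, `/` and compare.  There
are no roots, no rounding and no passage from reals to natural numbers, and the only real constants
of a program are integers.  Programs are finite pieces of syntax with conditionals, loops and
parameterless (possibly recursive) procedures acting on the global memory; every operation, every
memory access, every test and every call costs one unit of time. -/

namespace RealRAM

/-- Memory: scalars are addressed by a name, array cells by the name of the array and an index. A
program mentions only finitely many names. -/
@[ext]
structure Mem where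
  ivar : ℕ → ℕ
  iarr : ℕ → ℕ → ℕ
  rvar : ℕ → ℝ
  rarr : ℕ → ℕ → ℝ

/-- Expressions with values in the natural numbers. -/
inductive IExp where
  | const (c : ℕ)
  | var (x : ℕ)
  | get (a : ℕ) (i : IExp)
  | add (e f : IExp)
  | sub (e f : IExp)
  | half (e : IExp)

/-- Value of an index expression (subtraction is truncated at `0`, `half` rounds down). -/
def IExp.eval (σ : Mem) : IExp → ℕ
  | const c => c
  | var x => σ.ivar x
  | get a i => σ.iarr a (i.eval σ)
  | add e f => e.eval σ + f.eval σ
  | sub e f => e.eval σ - f.eval σ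
  | half e => e.eval σ / 2

/-- Time to evaluate an index expression: one unit for each node. -/
def IExp.cost : IExp → ℕ
  | const _ => 1
  | var _ => 1
  | get _ i => i.cost + 1
  | add e f => e.cost + f.cost + 1
  | sub e f => e.cost + f.cost + 1
  | half e => e.cost + 1

/-- Expressions with values in the real numbers. -/
inductive RExp where
  | const (c : ℤ)
  | var (x : ℕ)
  | get (a : ℕ) (i : IExp)
  | add (e f : RExp)
  | sub (e f : RExp)
  | mul (e f : RExp)
  | div (e f : RExp)

/-- Value of a real expression (a division by `0`, which a program can avoid by a test, has
value `0`). -/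
noncomputable def RExp.eval (σ : Mem) : RExp → ℝ
  | const c => (c : ℝ)
  | var x => σ.rvar x
  | get a i => σ.rarr a (i.eval σ)
  | add e f => e.eval σ + f.eval σ
  | sub e f => e.eval σ - f.eval σ
  | mul e f => e.eval σ * f.eval σ
  | div e f => e.eval σ / f.eval σ

/-- Time to evaluate a real expression: one unit for each node. -/
def RExp.cost : RExp → ℕ
  | const _ => 1
  | var _ => 1
  | get _ i => i.cost + 1
  | add e f => e.cost + f.cost + 1
  | sub e f => e.cost + f.cost + 1
  | mul e f => e.cost + f.cost + 1
  | div e f => e.cost + f.cost + 1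

/-- Comparisons of two natural numbers or of two real numbers. -/
inductive Test where
  | ile (e f : IExp)
  | ilt (e f : IExp)
  | rle (e f : RExp)
  | rlt (e f : RExp)

/-- The test succeeds. -/
def Test.Holds (σ : Mem) : Test → Prop
  | ile e f => e.eval σ ≤ f.eval σ
  | ilt e f => e.eval σ < f.eval σ
  | rle e f => e.eval σ ≤ f.eval σ
  | rlt e f => e.eval σ < f.eval σ

/-- Time to perform a test. -/
def Test.cost : Test → ℕ
  | ile e f => e.cost + f.cost + 1
  | ilt e f => e.cost + f.cost + 1
  | rle e f => e.cost + f.cost + 1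
  | rlt e f => e.cost + f.cost + 1

/-- Commands: assignments to scalars (`iset`, `rset`) and to array cells (`iput`, `rput`),
sequencing, conditional, `while`-loop, call of a procedure. -/
inductive Cmd where
  | skip
  | iset (x : ℕ) (e : IExp)
  | iput (a : ℕ) (i e : IExp)
  | rset (x : ℕ) (e : RExp)
  | rput (a : ℕ) (i : IExp) (e : RExp)
  | seq (c d : Cmd)
  | ite (b : Test) (c d : Cmd)
  | loop (b : Test) (c : Cmd)
  | call (k : ℕ)

/-- A program: finitely many procedures and a main command. -/
structure Program where
  procs : List Cmd
  main : Cmd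

/-- `σ` with the natural-number scalar `x` set to `v`. -/
def Mem.setI (σ : Mem) (x v : ℕ) : Mem :=
  { σ with ivar := Function.update σ.ivar x v }

/-- `σ` with cell `i` of the natural-number array `a` set to `v`. -/
def Mem.putI (σ : Mem) (a i v : ℕ) : Mem :=
  { σ with iarr := Function.update σ.iarr a (Function.update (σ.iarr a) i v) }

/-- `σ` with the real scalar `x` set to `v`. -/
def Mem.setR (σ : Mem) (x : ℕ) (v : ℝ) : Mem :=
  { σ with rvar := Function.update σ.rvar x v }

/-- `σ` with cell `i` of the real array `a` set to `v`. -/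
def Mem.putR (σ : Mem) (a i : ℕ) (v : ℝ) : Mem :=
  { σ with rarr := Function.update σ.rarr a (Function.update (σ.rarr a) i v) }

/-- `Exec ps c σ t τ`: with the procedures `ps`, the command `c` started in the memory `σ`
terminates after exactly `t` units of time in the memory `τ`. -/
inductive Exec (ps : List Cmd) : Cmd → Mem → ℕ → Mem → Prop where
  | skip (σ : Mem) : Exec ps .skip σ 1 σ
  | iset (x : ℕ) (e : IExp) (σ : Mem) :
      Exec ps (.iset x e) σ (e.cost + 1) (σ.setI x (e.eval σ))
  | iput (a : ℕ) (i e : IExp) (σ : Mem) :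
      Exec ps (.iput a i e) σ (i.cost + e.cost + 1) (σ.putI a (i.eval σ) (e.eval σ))
  | rset (x : ℕ) (e : RExp) (σ : Mem) :
      Exec ps (.rset x e) σ (e.cost + 1) (σ.setR x (e.eval σ))
  | rput (a : ℕ) (i : IExp) (e : RExp) (σ : Mem) :
      Exec ps (.rput a i e) σ (i.cost + e.cost + 1) (σ.putR a (i.eval σ) (e.eval σ))
  | seq {c d : Cmd} {σ τ υ : Mem} {t u : ℕ} :
      Exec ps c σ t τ → Exec ps d τ u υ → Exec ps (.seq c d) σ (t + u) υ
  | ite_true {b : Test} {c d : Cmd} {σ τ : Mem} {t : ℕ} :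
      b.Holds σ → Exec ps c σ t τ → Exec ps (.ite b c d) σ (b.cost + t) τ
  | ite_false {b : Test} {c d : Cmd} {σ τ : Mem} {t : ℕ} :
      ¬ b.Holds σ → Exec ps d σ t τ → Exec ps (.ite b c d) σ (b.cost + t) τ
  | loop_true {b : Test} {c : Cmd} {σ τ υ : Mem} {t u : ℕ} :
      b.Holds σ → Exec ps c σ t τ → Exec ps (.loop b c) τ u υ →
      Exec ps (.loop b c) σ (b.cost + t + u) υ
  | loop_false {b : Test} {c : Cmd} {σ : Mem} :
      ¬ b.Holds σ → Exec ps (.loop b c) σ b.cost σ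
  | call {k : ℕ} {c : Cmd} {σ τ : Mem} {t : ℕ} :
      ps[k]? = some c → Exec ps c σ t τ → Exec ps (.call k) σ (t + 1) τ

/-- The program `P` started in the memory `σ` halts after exactly `t` units of time in the
memory `τ`. -/
def Program.Halts (P : Program) (σ : Mem) (t : ℕ) (τ : Mem) : Prop :=
  Exec P.procs P.main σ t τ

end RealRAM

/-! ### Reception in the SINR model on the line -/

namespace SINR

/-- The signal-to-interference-plus-noise ratio at the point `q` with respect to transmitter `i`,
for transmitters at `s j` with powers `p j`, path-loss exponent `α` and background noise `N`. -/
noncomputable def ratio {n : ℕ} (α : ℕ) (N : ℝ) (p s : Fin n → ℝ) (i : Fin n) (q : ℝ) : ℝ :=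
  (p i / |q - s i| ^ α) / ((∑ j ∈ Finset.univ.erase i, p j / |q - s j| ^ α) + N)

/-- A receiver at `q` receives transmitter `i`: the SINR inequality with threshold `β` holds. At the
location of a transmitter, where the signal of that transmitter is infinite, this transmitter and
no other one is received. -/
def Receives {n : ℕ} (α : ℕ) (β N : ℝ) (p s : Fin n → ℝ) (q : ℝ) (i : Fin n) : Prop :=
  q = s i ∨ (∀ j, q ≠ s j) ∧ β ≤ ratio α N p s i q

/-- The input memory: the scalars hold `n`, `m` and `β`, `N`; the real arrays `0` and `1` hold the
positions of the transmitters and of the receivers, in the given order; all else is `0`. -/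
noncomputable def input {n m : ℕ} (β N : ℝ) (s : Fin n → ℝ) (q : Fin m → ℝ) : RealRAM.Mem where
  ivar x := if x = 0 then n else if x = 1 then m else 0
  iarr _ _ := 0
  rvar x := if x = 0 then β else if x = 1 then N else 0
  rarr a k :=
    if a = 0 then (if h : k < n then s ⟨k, h⟩ else 0)
    else if a = 1 then (if h : k < m then q ⟨k, h⟩ else 0)
    else 0

/-- The number by which the machine reports an answer: `0` for no transmitter, `i + 1` for the
transmitter with index `i`. -/
def code {n : ℕ} : Option (Fin n) → ℕ
  | none => 0
  | some i => (i : ℕ) + 1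

/-- The memory `τ` reports, in cell `j` of the natural-number array `0`, which transmitter, if any,
is received by receiver `j`. -/
def Reports {n m : ℕ} (α : ℕ) (β N : ℝ) (p s : Fin n → ℝ) (q : Fin m → ℝ)
    (τ : RealRAM.Mem) : Prop :=
  ∀ j : Fin m, ∃ r : Option (Fin n),
    τ.iarr 0 j = code r ∧ ∀ i : Fin n, r = some i ↔ Receives α β N p s (q j) i

end SINR

/-! Since `β > 1`, a transmitter that is heard has a stronger signal than all the others together.
It is therefore the strictly nearest one, hence one of the two neighbours of the receiver in sorted
order (`Heard.near`). Whether a candidate is heard depends only on its own signal and on the total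
signal `F(q) = ∑ 1 / (q - s_k) ^ α`; absolute values disappear because `α` is even. So it suffices
to know `F` at all receivers, to sort the transmitters, and to make one binary search and at most
two SINR tests per receiver.

`F` is a rational function. Its numerator and denominator, with O(n) coefficients, arise from adding
the fractions pairwise along a binary tree (`treeCmd_runs`). Both are evaluated at the receivers in
batches of as many points as there are coefficients. The value of a polynomial at `u` is a
coefficient of the power series "reversed polynomial divided by `1 - u X`" (`coeff_quot_linear`). A
product tree of these linear factors is built, the reversed polynomial is divided by the root with
Newton's iteration, and on the way down the quotient is multiplied by the sibling of each node
(`quot_mul`). Only a short window of coefficients matters at each node, so a middle product suffices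
(`NegProd.middle`).

All this rests on multiplying real polynomials of length `2 ^ k` in time O(k log k) per coefficient
(`mul_spec`, `mulRate_le`). Complex roots of unity are not available, so Nussbaumer's method is
used. With `r * m = 2 ^ k` and `y = t ^ m`, a polynomial modulo `t ^ (r * m) + 1` is a polynomial in
`t` of degree less than `m` over the ring of polynomials in `y` modulo `y ^ r + 1`. Powers of `y`
are roots of unity of that ring, and multiplying by them is a signed rotation of `r` cells. A fast
Fourier transform of length `2 * m` thus needs no real multiplications and leaves products modulo `y
^ r + 1`, with `r` about the square root of the original length. These are handled by recursion. All
blocks of one level form a single batch, so each level is one call and the control overhead is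
amortised.

With `l = α + ⌈log₂ n⌉`, both trees and the Newton iteration have O(l) levels, each of cost O(2 ^ l
* l * log l), and there are about `m / 2 ^ l` batches. Sorting and searching take O((n + m) log² n).
-/

namespace RealRAM

/-! ### Running a command within a time bound -/

/-- With the procedures `ps`, the command `c` started in `σ` terminates within `T` units of time in a
memory that satisfies `Q`. -/
def Runs (ps : List Cmd) (c : Cmd) (σ : Mem) (T : ℕ) (Q : Mem → Prop) : Prop :=
  ∃ t τ, Exec ps c σ t τ ∧ t ≤ T ∧ Q τ

/-- Sequential composition of a list of commands. -/
def block : List Cmd → Cmd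
  | [] => .skip
  | c :: l => .seq c (block l)

namespace Runs

variable {ps : List Cmd} {c d : Cmd} {σ : Mem} {T U : ℕ} {Q Q' : Mem → Prop}

theorem mono (h : Runs ps c σ T Q) (hT : T ≤ U) (hQ : ∀ τ, Q τ → Q' τ) : Runs ps c σ U Q' := by
  obtain ⟨t, τ, h1, h2, h3⟩ := h
  exact ⟨t, τ, h1, h2.trans hT, hQ τ h3⟩

theorem le (h : Runs ps c σ T Q) (hT : T ≤ U) : Runs ps c σ U Q :=
  h.mono hT fun _ h => h

theorem post (h : Runs ps c σ T Q) (hQ : ∀ τ, Q τ → Q' τ) : Runs ps c σ T Q' :=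
  h.mono le_rfl hQ

theorem seq (h : Runs ps c σ T (fun τ => Runs ps d τ U Q)) : Runs ps (.seq c d) σ (T + U) Q := by
  obtain ⟨t, τ, h1, h2, u, υ, h3, h4, h5⟩ := h
  exact ⟨t + u, υ, .seq h1 h3, by omega, h5⟩

theorem cons {l : List Cmd} (h : Runs ps c σ T (fun τ => Runs ps (block l) τ U Q)) :
    Runs ps (block (c :: l)) σ (T + U) Q := seq h

theorem nil (h : Q σ) : Runs ps (block []) σ 1 Q := ⟨1, σ, .skip σ, le_rfl, h⟩

theorem set {x v : ℕ} {e : IExp} {l : List Cmd} (hv : e.eval σ = v)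
    (h : Runs ps (block l) (σ.setI x v) U Q) :
    Runs ps (block (.iset x e :: l)) σ (e.cost + 1 + U) Q := by
  subst hv
  exact cons ⟨_, _, .iset x e σ, le_rfl, h⟩

theorem skip (h : Q σ) : Runs ps .skip σ 1 Q := ⟨1, σ, .skip σ, le_rfl, h⟩

theorem iset {x : ℕ} {e : IExp} (h : Q (σ.setI x (e.eval σ))) :
    Runs ps (.iset x e) σ (e.cost + 1) Q := ⟨_, _, .iset x e σ, le_rfl, h⟩

theorem iput {a : ℕ} {i e : IExp} (h : Q (σ.putI a (i.eval σ) (e.eval σ))) :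
    Runs ps (.iput a i e) σ (i.cost + e.cost + 1) Q := ⟨_, _, .iput a i e σ, le_rfl, h⟩

theorem rset {x : ℕ} {e : RExp} (h : Q (σ.setR x (e.eval σ))) :
    Runs ps (.rset x e) σ (e.cost + 1) Q := ⟨_, _, .rset x e σ, le_rfl, h⟩

theorem rput {a : ℕ} {i : IExp} {e : RExp} (h : Q (σ.putR a (i.eval σ) (e.eval σ))) :
    Runs ps (.rput a i e) σ (i.cost + e.cost + 1) Q := ⟨_, _, .rput a i e σ, le_rfl, h⟩

theorem ite {b : Test} (h : b.Holds σ → Runs ps c σ T Q) (h' : ¬ b.Holds σ → Runs ps d σ U Q) :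
    Runs ps (.ite b c d) σ (b.cost + max T U) Q := by
  by_cases hb : b.Holds σ
  · obtain ⟨t, τ, h1, h2, h3⟩ := h hb
    exact ⟨_, τ, .ite_true hb h1, by omega, h3⟩
  · obtain ⟨t, τ, h1, h2, h3⟩ := h' hb
    exact ⟨_, τ, .ite_false hb h1, by omega, h3⟩

theorem ite_pos {b : Test} (hb : b.Holds σ) (h : Runs ps c σ T Q) :
    Runs ps (.ite b c d) σ (b.cost + T) Q := by
  obtain ⟨t, τ, h1, h2, h3⟩ := h
  exact ⟨_, τ, .ite_true hb h1, by omega, h3⟩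

theorem ite_neg {b : Test} (hb : ¬ b.Holds σ) (h : Runs ps d σ T Q) :
    Runs ps (.ite b c d) σ (b.cost + T) Q := by
  obtain ⟨t, τ, h1, h2, h3⟩ := h
  exact ⟨_, τ, .ite_false hb h1, by omega, h3⟩

theorem call {k : ℕ} (hk : ps[k]? = some c) (h : Runs ps c σ T Q) :
    Runs ps (.call k) σ (T + 1) Q := by
  obtain ⟨t, τ, h1, h2, h3⟩ := h
  exact ⟨_, τ, .call hk h1, by omega, h3⟩

/-- A loop that makes exactly `n` rounds. -/
theorem loop {b : Test} (Inv : ℕ → Mem → Prop) (n : ℕ)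
    (hstep : ∀ i < n, ∀ σ, Inv i σ → b.Holds σ ∧ Runs ps c σ T (Inv (i + 1)))
    (hend : ∀ σ, Inv n σ → ¬ b.Holds σ) (h0 : Inv 0 σ) :
    Runs ps (.loop b c) σ (n * (b.cost + T) + b.cost) (Inv n) := by
  have key : ∀ j i σ, i + j = n → Inv i σ →
      Runs ps (.loop b c) σ (j * (b.cost + T) + b.cost) (Inv n) := by
    intro j
    induction j with
    | zero =>
      intro i σ hi h
      obtain rfl : i = n := by omega
      exact ⟨_, σ, .loop_false (hend σ h), by omega, h⟩
    | succ j ih =>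
      intro i σ hi h
      obtain ⟨hb, t, τ, h1, h2, h3⟩ := hstep i (by omega) σ h
      obtain ⟨u, υ, h4, h5, h6⟩ := ih (i + 1) τ (by omega) h3
      refine ⟨_, υ, .loop_true hb h1 h4, ?_, h6⟩
      rw [Nat.succ_mul]
      omega
  exact key n 0 σ (by omega) h0

/-- A loop whose number of rounds is bounded by a variant. -/
theorem loop_variant {b : Test} (Inv : ℕ → Mem → Prop)
    (hstep : ∀ i σ, Inv i σ → b.Holds σ → ∃ j, i = j + 1 ∧ Runs ps c σ T (Inv j))
    (n : ℕ) (h0 : Inv n σ) :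
    Runs ps (.loop b c) σ (n * (b.cost + T) + b.cost) (fun τ => (∃ i, Inv i τ) ∧ ¬ b.Holds τ) := by
  induction n generalizing σ with
  | zero =>
    by_cases hb : b.Holds σ
    · obtain ⟨j, hj, -⟩ := hstep 0 σ h0 hb
      omega
    · exact ⟨_, σ, .loop_false hb, by omega, ⟨_, h0⟩, hb⟩
  | succ n ih =>
    by_cases hb : b.Holds σ
    · obtain ⟨j, hj, t, τ, h1, h2, h3⟩ := hstep _ σ h0 hb
      obtain rfl : n = j := by omega
      obtain ⟨u, υ, h4, h5, h6⟩ := ih h3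
      refine ⟨_, υ, .loop_true hb h1 h4, ?_, h6⟩
      rw [Nat.succ_mul]
      omega
    · exact ⟨_, σ, .loop_false hb, by omega, ⟨_, h0⟩, hb⟩

end Runs

/-! ### Reading a memory after an update -/

section Mem

variable (σ : Mem) (x y a b i v : ℕ) (w : ℝ)

@[simp] theorem Mem.setI_ivar : (σ.setI x v).ivar y = if y = x then v else σ.ivar y := by
  simp [Mem.setI, Function.update_apply]
@[simp] theorem Mem.setI_iarr : (σ.setI x v).iarr = σ.iarr := rfl
@[simp] theorem Mem.setI_rvar : (σ.setI x v).rvar = σ.rvar := rfl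
@[simp] theorem Mem.setI_rarr : (σ.setI x v).rarr = σ.rarr := rfl
@[simp] theorem Mem.putI_ivar : (σ.putI a i v).ivar = σ.ivar := rfl
@[simp] theorem Mem.putI_iarr :
    (σ.putI a i v).iarr b = if b = a then Function.update (σ.iarr a) i v else σ.iarr b := by
  simp [Mem.putI, Function.update_apply]
@[simp] theorem Mem.putI_rvar : (σ.putI a i v).rvar = σ.rvar := rfl
@[simp] theorem Mem.putI_rarr : (σ.putI a i v).rarr = σ.rarr := rfl
@[simp] theorem Mem.setR_ivar : (σ.setR x w).ivar = σ.ivar := rfl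
@[simp] theorem Mem.setR_iarr : (σ.setR x w).iarr = σ.iarr := rfl
@[simp] theorem Mem.setR_rvar : (σ.setR x w).rvar y = if y = x then w else σ.rvar y := by
  simp [Mem.setR, Function.update_apply]
@[simp] theorem Mem.setR_rarr : (σ.setR x w).rarr = σ.rarr := rfl
@[simp] theorem Mem.putR_ivar : (σ.putR a i w).ivar = σ.ivar := rfl
@[simp] theorem Mem.putR_iarr : (σ.putR a i w).iarr = σ.iarr := rfl
@[simp] theorem Mem.putR_rvar : (σ.putR a i w).rvar = σ.rvar := rfl
@[simp] theorem Mem.putR_rarr :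
    (σ.putR a i w).rarr b = if b = a then Function.update (σ.rarr a) i w else σ.rarr b := by
  simp [Mem.putR, Function.update_apply]

end Mem

attribute [simp] IExp.eval RExp.eval

@[simp] theorem Test.holds_ile (σ : Mem) (e f : IExp) :
    (Test.ile e f).Holds σ ↔ e.eval σ ≤ f.eval σ := Iff.rfl
@[simp] theorem Test.holds_ilt (σ : Mem) (e f : IExp) :
    (Test.ilt e f).Holds σ ↔ e.eval σ < f.eval σ := Iff.rfl
@[simp] theorem Test.holds_rle (σ : Mem) (e f : RExp) :
    (Test.rle e f).Holds σ ↔ e.eval σ ≤ f.eval σ := Iff.rfl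
@[simp] theorem Test.holds_rlt (σ : Mem) (e f : RExp) :
    (Test.rlt e f).Holds σ ↔ e.eval σ < f.eval σ := Iff.rfl

/-! ### Frame conditions between memories. -/

/-- The two memories agree on all names below `b`. -/
structure Below (b : ℕ) (σ τ : Mem) : Prop where
  ivar : ∀ x < b, τ.ivar x = σ.ivar x
  iarr : ∀ a < b, τ.iarr a = σ.iarr a
  rvar : ∀ x < b, τ.rvar x = σ.rvar x
  rarr : ∀ a < b, τ.rarr a = σ.rarr a

theorem Below.refl (b : ℕ) (σ : Mem) : Below b σ σ := ⟨by simp, by simp, by simp, by simp⟩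

theorem Below.trans {b : ℕ} {σ τ υ : Mem} (h : Below b σ τ) (h' : Below b τ υ) : Below b σ υ :=
  ⟨fun x hx => (h'.ivar x hx).trans (h.ivar x hx), fun x hx => (h'.iarr x hx).trans (h.iarr x hx),
    fun x hx => (h'.rvar x hx).trans (h.rvar x hx), fun x hx => (h'.rarr x hx).trans (h.rarr x hx)⟩

theorem Below.anti {b b' : ℕ} {σ τ : Mem} (h : Below b σ τ) (hb : b' ≤ b) : Below b' σ τ :=
  ⟨fun x hx => h.ivar x (by omega), fun x hx => h.iarr x (by omega),
    fun x hx => h.rvar x (by omega), fun x hx => h.rarr x (by omega)⟩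

theorem Below.setI {b : ℕ} {σ τ : Mem} (h : Below b σ τ) {x v : ℕ} (hx : b ≤ x) :
    Below b σ (τ.setI x v) :=
  ⟨fun y hy => by simp [h.ivar y hy, show y ≠ x by omega], h.iarr, h.rvar, h.rarr⟩

theorem Below.putI {b : ℕ} {σ τ : Mem} (h : Below b σ τ) {a i v : ℕ} (hx : b ≤ a) :
    Below b σ (τ.putI a i v) :=
  ⟨h.ivar, fun y hy => by simp [h.iarr y hy, show y ≠ a by omega], h.rvar, h.rarr⟩

/-! ### Sweeps: loops over an interval with a mixed-radix counter -/

/-- The two memories agree except for the counters of a sweep. -/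
structure OdoEq (σ τ : Mem) : Prop where
  ivar : ∀ x, x < 100 ∨ 106 ≤ x → τ.ivar x = σ.ivar x
  iarr : τ.iarr = σ.iarr
  rvar : τ.rvar = σ.rvar
  rarr : τ.rarr = σ.rarr

/-- Parameters of a sweep: its length, the radices of the two lower digits, and the strides of the
three digits. -/
structure Sweep where
  len : IExp
  rad : IExp
  quo : IExp
  sj : IExp
  si : IExp
  sg : IExp

/-- The values of the parameters of a sweep. -/
structure Shape where
  len : ℕ
  rad : ℕ
  quo : ℕ
  sj : ℕ
  si : ℕ
  sg : ℕ

/-- The parameters of the sweep have the given values in `σ`. -/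
structure Sweep.Vals (s : Sweep) (v : Shape) (σ : Mem) : Prop where
  len : s.len.eval σ = v.len
  rad : s.rad.eval σ = v.rad
  quo : s.quo.eval σ = v.quo
  sj : s.sj.eval σ = v.sj
  si : s.si.eval σ = v.si
  sg : s.sg.eval σ = v.sg

/-- The counters of the sweep at position `p`. -/
structure Shape.Digits (v : Shape) (p : ℕ) (σ : Mem) : Prop where
  pos : σ.ivar 100 = p
  j : σ.ivar 101 = p % v.rad
  i : σ.ivar 102 = p / v.rad % v.quo
  sj : σ.ivar 103 = p % v.rad * v.sj
  si : σ.ivar 104 = p / v.rad % v.quo * v.si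
  sg : σ.ivar 105 = p / v.rad / v.quo * v.sg

/-- Advance the counters of a sweep. -/
def Sweep.next (s : Sweep) : Cmd := block [
  .iset 100 (.add (.var 100) (.const 1)),
  .iset 101 (.add (.var 101) (.const 1)),
  .iset 103 (.add (.var 103) s.sj),
  .ite (.ilt (.var 101) s.rad) .skip (block [
    .iset 101 (.const 0),
    .iset 103 (.const 0),
    .iset 102 (.add (.var 102) (.const 1)),
    .iset 104 (.add (.var 104) s.si),
    .ite (.ilt (.var 102) s.quo) .skip (block [
      .iset 102 (.const 0),
      .iset 104 (.const 0),
      .iset 105 (.add (.var 105) s.sg)])])]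

/-- Run `body` at every position of the sweep. -/
def Sweep.cmd (s : Sweep) (body : Cmd) : Cmd := block [
  .iset 100 (.const 0), .iset 101 (.const 0), .iset 102 (.const 0), .iset 103 (.const 0),
  .iset 104 (.const 0), .iset 105 (.const 0),
  .loop (.ilt (.var 100) s.len) (.seq body s.next)]

/-- Time for one round of a sweep, apart from the body. -/
def Sweep.cost (s : Sweep) : ℕ :=
  s.len.cost + s.rad.cost + s.quo.cost + s.sj.cost + s.si.cost + s.sg.cost + 60

/-- The machine neither multiplies nor divides natural numbers (except by two). A sweep therefore
tracks remainder and quotient by carries. -/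
theorem Nat.odometer (p r : ℕ) (hr : 0 < r) :
    (p % r + 1 < r → (p + 1) % r = p % r + 1 ∧ (p + 1) / r = p / r) ∧
    (¬ p % r + 1 < r → (p + 1) % r = 0 ∧ (p + 1) / r = p / r + 1) := by
  have h1 := Nat.div_add_mod p r
  have h2 := Nat.mod_lt p hr
  constructor
  · intro h
    have := (Nat.div_mod_unique (a := p + 1) (d := p / r) (c := p % r + 1) hr).2
      ⟨by rw [add_comm (p % r + 1)]; omega, h⟩
    exact ⟨this.2, this.1⟩
  · intro h
    have := (Nat.div_mod_unique (a := p + 1) (d := p / r + 1) (c := 0) hr).2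
      ⟨by rw [Nat.mul_succ]; omega, hr⟩
    exact ⟨this.2, this.1⟩

theorem OdoEq.refl (σ : Mem) : OdoEq σ σ := ⟨by simp, rfl, rfl, rfl⟩

theorem OdoEq.setI {σ τ : Mem} (h : OdoEq σ τ) {x v : ℕ} (hx : 100 ≤ x ∧ x < 106) :
    OdoEq σ (τ.setI x v) :=
  ⟨fun y hy => by simp [h.ivar y hy, show y ≠ x by omega], h.iarr, h.rvar, h.rarr⟩

/-- The products of the digits with their strides are kept up to date by adding the stride at each
increment and resetting at each carry, so that matrix addresses are available without
multiplication. -/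
theorem Sweep.next_runs {ps : List Cmd} (s : Sweep) (v : Shape) (hr : 0 < v.rad) (hq : 0 < v.quo)
    (p : ℕ) (σ : Mem) (hv : ∀ τ, OdoEq σ τ → s.Vals v τ) (hd : v.Digits p σ) :
    Runs ps s.next σ (s.cost - s.len.cost - 5) (fun τ => OdoEq σ τ ∧ v.Digits (p + 1) τ) := by
  obtain ⟨o1, o2⟩ := Nat.odometer p v.rad hr
  obtain ⟨o3, o4⟩ := Nat.odometer (p / v.rad) v.quo hq
  have e0 := (OdoEq.refl σ).setI (x := 100) (v := p + 1) (by simp)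
  have e0' := e0.setI (x := 101) (v := p % v.rad + 1) (by simp)
  have e1 := e0'.setI (x := 103) (v := p % v.rad * v.sj + v.sj) (by simp)
  apply Runs.le
  case h =>
    unfold Sweep.next
    apply Runs.set (v := p + 1) (by simp [hd.pos])
    apply Runs.set (v := p % v.rad + 1) (by simp [hd.j])
    apply Runs.set (v := p % v.rad * v.sj + v.sj) (by simp [hd.sj, (hv _ e0').sj])
    apply Runs.cons
    apply Runs.ite
    · intro hb
      refine Runs.skip (Runs.nil ⟨e1, ?_⟩)
      have hlt : p % v.rad + 1 < v.rad := by
        simpa [(hv _ e1).rad] using hb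
      obtain ⟨a1, a2⟩ := o1 hlt
      constructor <;> simp [a1, a2, hd.i, hd.si, hd.sg, Nat.succ_mul]
    · intro hb
      have hlt : ¬ p % v.rad + 1 < v.rad := by
        simpa [(hv _ e1).rad] using hb
      obtain ⟨a1, a2⟩ := o2 hlt
      have e2 := e1.setI (x := 101) (v := 0) (by simp)
      have e3 := e2.setI (x := 103) (v := 0) (by simp)
      have e4 := e3.setI (x := 102) (v := p / v.rad % v.quo + 1) (by simp)
      have e5 := e4.setI (x := 104) (v := p / v.rad % v.quo * v.si + v.si) (by simp)
      apply Runs.set (v := 0) (by simp)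
      apply Runs.set (v := 0) (by simp)
      apply Runs.set (v := p / v.rad % v.quo + 1) (by simp [hd.i])
      apply Runs.set (v := p / v.rad % v.quo * v.si + v.si) (by simp [hd.si, (hv _ e4).si])
      apply Runs.cons
      apply Runs.ite
      · intro hb
        refine Runs.skip (Runs.nil (Runs.nil ⟨e5, ?_⟩))
        have hlt : p / v.rad % v.quo + 1 < v.quo := by
          simpa [(hv _ e5).quo] using hb
        obtain ⟨b1, b2⟩ := o3 hlt
        constructor <;> simp [a1, a2, b1, b2, hd.sg, Nat.succ_mul]
      · intro hb
        have hlt : ¬ p / v.rad % v.quo + 1 < v.quo := by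
          simpa [(hv _ e5).quo] using hb
        obtain ⟨b1, b2⟩ := o4 hlt
        have e6 := e5.setI (x := 102) (v := 0) (by simp)
        have e7 := e6.setI (x := 104) (v := 0) (by simp)
        apply Runs.set (v := 0) (by simp)
        apply Runs.set (v := 0) (by simp)
        apply Runs.set (v := p / v.rad / v.quo * v.sg + v.sg) (by simp [hd.sg, (hv _ e7).sg])
        refine Runs.nil (Runs.nil (Runs.nil ⟨e7.setI (by simp), ?_⟩))
        constructor <;> simp [a1, a2, b1, b2, Nat.succ_mul]
  case hT =>
    simp only [IExp.cost, Test.cost, Sweep.cost]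
    omega

/-- The rule for sweeps. -/
theorem Sweep.runs {ps : List Cmd} (s : Sweep) {body : Cmd} (v : Shape) (hr : 0 < v.rad)
    (hq : 0 < v.quo) (c : ℕ) (σ : Mem) (Inv : ℕ → Mem → Prop)
    (hodo : ∀ p σ τ, OdoEq σ τ → Inv p σ → Inv p τ)
    (hv : ∀ p σ, Inv p σ → s.Vals v σ)
    (hbody : ∀ p < v.len, ∀ σ, Inv p σ → v.Digits p σ →
      Runs ps body σ c (fun τ => Inv (p + 1) τ ∧ v.Digits p τ))
    (h0 : Inv 0 σ) :
    Runs ps (s.cmd body) σ ((c + s.cost) * (v.len + 1)) (Inv v.len) := by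
  have hloop : ∀ σ, Inv 0 σ → v.Digits 0 σ → Runs ps (.loop (.ilt (.var 100) s.len) (.seq body s.next)) σ
      (v.len * ((Test.ilt (.var 100) s.len).cost + (c + (s.cost - s.len.cost - 5))) +
        (Test.ilt (.var 100) s.len).cost) (fun τ => Inv v.len τ ∧ v.Digits v.len τ) := by
    intro σ h0 hd
    refine Runs.loop (fun p τ => Inv p τ ∧ v.Digits p τ) v.len ?_ ?_ ⟨h0, hd⟩
    · rintro p hp τ ⟨h1, h2⟩
      refine ⟨by simp [h2.pos, (hv p τ h1).len, hp], ?_⟩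
      refine Runs.seq ((hbody p hp τ h1 h2).post ?_)
      rintro υ ⟨h3, h4⟩
      refine (s.next_runs v hr hq p υ (fun τ hτ => hv _ _ (hodo _ _ _ hτ h3)) h4).post ?_
      rintro ω ⟨h5, h6⟩
      exact ⟨hodo _ _ _ h5 h3, h6⟩
    · rintro τ ⟨h1, h2⟩
      simp [h2.pos, (hv _ τ h1).len]
  apply Runs.le
  case h =>
    unfold Sweep.cmd
    iterate 6 apply Runs.set (v := 0) rfl
    apply Runs.cons
    refine (hloop _ ?_ ?_).post fun τ hτ => Runs.nil hτ.1
    · refine hodo 0 σ _ ?_ h0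
      exact OdoEq.setI (OdoEq.setI (OdoEq.setI (OdoEq.setI (OdoEq.setI (OdoEq.setI (OdoEq.refl σ)
        (by simp)) (by simp)) (by simp)) (by simp)) (by simp)) (by simp)
    · constructor <;> simp
  case hT =>
    simp only [IExp.cost, Test.cost]
    have : s.cost = (s.cost - s.len.cost - 5) + s.len.cost + 5 := by simp only [Sweep.cost]; omega
    set w := s.cost - s.len.cost - 5
    have h1 : v.len * (1 + s.len.cost + 1 + (c + w)) ≤ v.len * (c + s.cost) :=
      Nat.mul_le_mul_left _ (by omega)
    have h2 : (c + s.cost) * (v.len + 1) = v.len * (c + s.cost) + (c + s.cost) := by ring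
    have h3 : s.len.cost + 40 ≤ s.cost := by simp only [Sweep.cost]; omega
    omega

/-! ### Filling an array by a formula -/

/-- Real expressions with case distinctions. -/
inductive GExp where
  | leaf (e : RExp)
  | ite (b : Test) (e f : GExp)

open Classical in
/-- Value of an expression with case distinctions. -/
noncomputable def GExp.eval (σ : Mem) : GExp → ℝ
  | leaf e => e.eval σ
  | ite b e f => if b.Holds σ then e.eval σ else f.eval σ

/-- Write the value of the expression into the array `W` at the position of the sweep. -/
def GExp.cmd (W : ℕ) (off : IExp) : GExp → Cmd
  | leaf e => .rput W (.add off (.var 100)) e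
  | ite b e f => .ite b (e.cmd W off) (f.cmd W off)

/-- Bound for the time to evaluate an expression with case distinctions. -/
def GExp.cost : GExp → ℕ
  | leaf e => e.cost
  | ite b e f => b.cost + max e.cost f.cost

theorem GExp.runs {ps : List Cmd} (e : GExp) {W : ℕ} {off : IExp} {σ : Mem} {Q : Mem → Prop}
    (h : Q (σ.putR W (off.eval σ + σ.ivar 100) (e.eval σ))) :
    Runs ps (e.cmd W off) σ (e.cost + off.cost + 3) Q := by
  induction e with
  | leaf e =>
    refine Runs.le (Runs.rput ?_) ?_
    · simpa [GExp.eval] using h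
    · simp only [IExp.cost, GExp.cost]
      omega
  | ite b e f he hf =>
    refine Runs.le (Runs.ite (T := e.cost + off.cost + 3) (U := f.cost + off.cost + 3)
      (fun hb => he ?_) (fun hb => hf ?_)) ?_
    · simpa [GExp.eval, hb] using h
    · simpa [GExp.eval, hb] using h
    · simp only [GExp.cost]
      omega

/-- Fill the cells `off, off + 1, …` of the array `W` by the values of `e`. -/
def fill (s : Sweep) (W : ℕ) (off : IExp) (e : GExp) : Cmd := s.cmd (e.cmd W off)

/-- Time for one cell. -/
def fillCost (s : Sweep) (off : IExp) (e : GExp) : ℕ := e.cost + off.cost + 3 + s.cost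

/-- The two memories agree except for the counters of a sweep and the real array `W`. -/
structure FillEq (W : ℕ) (σ τ : Mem) : Prop where
  ivar : ∀ x, x < 100 ∨ 106 ≤ x → τ.ivar x = σ.ivar x
  iarr : τ.iarr = σ.iarr
  rvar : τ.rvar = σ.rvar
  rarr : ∀ a, a ≠ W → τ.rarr a = σ.rarr a

theorem FillEq.refl (W : ℕ) (σ : Mem) : FillEq W σ σ := ⟨by simp, rfl, rfl, by simp⟩

theorem FillEq.below {W : ℕ} {σ τ : Mem} (h : FillEq W σ τ) {b : ℕ} (hb : b ≤ 100) (hW : b ≤ W) :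
    Below b σ τ :=
  ⟨fun x hx => h.ivar x (by omega), fun x _ => by rw [h.iarr], fun x _ => by rw [h.rvar],
    fun x hx => h.rarr x (by omega)⟩

/-- The contents of an array that has been filled with `F` on `[o, o + n)`. -/
def fillFun (f : ℕ → ℝ) (o n : ℕ) (F : ℕ → ℝ) (x : ℕ) : ℝ :=
  if o ≤ x ∧ x < o + n then F (x - o) else f x

theorem fillFun_of_lt {f : ℕ → ℝ} {o n : ℕ} {F : ℕ → ℝ} {x : ℕ} (h : x < n) :
    fillFun f o n F (o + x) = F x := by simp [fillFun, h]

theorem fillFun_zero {f : ℕ → ℝ} {n : ℕ} {F : ℕ → ℝ} {x : ℕ} (h : x < n) :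
    fillFun f 0 n F x = F x := by simp [fillFun, h]

theorem fillFun_below {f : ℕ → ℝ} {o n : ℕ} {F : ℕ → ℝ} {x : ℕ} (h : x < o) :
    fillFun f o n F x = f x := by simp [fillFun, Nat.not_le.2 h]

/-- Only the counters and the part of `W` already passed change during the sweep, so the value of
the formula at a position can be described by a function `F` fixed in advance. -/
theorem fill_runs {ps : List Cmd} (s : Sweep) (W : ℕ) (off : IExp) (e : GExp) (σ : Mem) (v : Shape)
    (o : ℕ) (F : ℕ → ℝ) (hr : 0 < v.rad) (hq : 0 < v.quo)
    (hv : ∀ τ, FillEq W σ τ → s.Vals v τ ∧ off.eval τ = o)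
    (hF : ∀ p < v.len, ∀ τ, FillEq W σ τ → v.Digits p τ →
      (∀ x, o + p ≤ x → τ.rarr W x = σ.rarr W x) → e.eval τ = F p) :
    Runs ps (fill s W off e) σ (fillCost s off e * (v.len + 1))
      (fun τ => FillEq W σ τ ∧ τ.rarr W = fillFun (σ.rarr W) o v.len F) := by
  refine s.runs v hr hq _ σ
    (fun p τ => FillEq W σ τ ∧ τ.rarr W = fillFun (σ.rarr W) o p F) ?_ ?_ ?_ ?_
  · rintro p σ' τ h ⟨h1, h2⟩
    refine ⟨⟨fun x hx => (h.ivar x hx).trans (h1.ivar x hx), h.iarr.trans h1.iarr,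
      h.rvar.trans h1.rvar, fun a ha => by rw [h.rarr]; exact h1.rarr a ha⟩, by rw [h.rarr, h2]⟩
  · rintro p τ ⟨h1, h2⟩
    exact (hv τ h1).1
  · rintro p hp τ ⟨h1, h2⟩ hd
    refine GExp.runs e ⟨⟨⟨?_, ?_, ?_, ?_⟩, ?_⟩, ?_⟩
    · simpa using h1.ivar
    · simpa using h1.iarr
    · simpa using h1.rvar
    · intro a ha
      simp [ha, h1.rarr a ha]
    · rw [hF p hp τ h1 hd]
      · funext x
        simp only [Mem.putR_rarr, if_true, h2, (hv τ h1).2, hd.pos, Function.update_apply, fillFun]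
        by_cases hx : x = o + p
        · simp [hx]
        · have : (o ≤ x ∧ x < o + (p + 1)) ↔ (o ≤ x ∧ x < o + p) := by omega
          simp [hx, this]
      · intro x hx
        rw [h2, fillFun, if_neg (by omega)]
    · constructor <;> simp [hd.pos, hd.j, hd.i, hd.sj, hd.si, hd.sg]
  · refine ⟨FillEq.refl W σ, ?_⟩
    funext x
    simp only [fillFun]
    rw [if_neg (by omega)]

open Polynomial

/-! ### The ring-theoretic content of Nussbaumer's convolution -/

section Nussbaumer

variable {T : Type} [CommRing T]

/-- The polynomial with coefficients `a 0, …, a (n - 1)`. -/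
noncomputable def poly (n : ℕ) (a : ℕ → T) : T[X] := ∑ i ∈ Finset.range n, C (a i) * X ^ i

theorem poly_coeff (n : ℕ) (a : ℕ → T) (i : ℕ) : (poly n a).coeff i = if i < n then a i else 0 := by
  simp [poly, coeff_X_pow]

theorem poly_degree_lt [Nontrivial T] (n : ℕ) (a : ℕ → T) : (poly n a).degree < n := by
  rw [degree_lt_iff_coeff_zero]
  intro i hi
  rw [poly_coeff, if_neg (by omega)]

theorem poly_eval (n : ℕ) (a : ℕ → T) (t : T) :
    (poly n a).eval t = ∑ i ∈ Finset.range n, a i * t ^ i := by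
  simp [poly, eval_finsetSum]

theorem poly_congr {n : ℕ} {a b : ℕ → T} (h : ∀ i < n, a i = b i) : poly n a = poly n b :=
  Finset.sum_congr rfl fun i hi => by rw [h i (Finset.mem_range.1 hi)]

theorem poly_add (n : ℕ) (a b : ℕ → T) : poly n (fun i => a i + b i) = poly n a + poly n b := by
  simp [poly, add_mul, Finset.sum_add_distrib]

theorem poly_sub (n : ℕ) (a b : ℕ → T) : poly n (fun i => a i - b i) = poly n a - poly n b := by
  simp [poly, sub_mul]

theorem poly_split (h n : ℕ) (a : ℕ → T) :
    poly (h + n) a = poly h a + X ^ h * poly n (fun i => a (h + i)) := by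
  simp only [poly, Finset.sum_range_add, Finset.mul_sum]
  congr 1
  refine Finset.sum_congr rfl fun i _ => ?_
  ring

/-- The twist of the coefficients is a rescaling of the variable. It serves to carry a congruence
modulo `X ^ h - 1` to one modulo `X ^ h + 1`. -/
theorem poly_twist (n : ℕ) (a : ℕ → T) (w v : T) (hwv : w * v = 1) :
    (poly n (fun i => w ^ i * a i)).comp (C v * X) = poly n a := by
  rw [poly, ← coe_compRingHom_apply, map_sum]
  simp only [coe_compRingHom_apply, mul_comp, C_comp, pow_comp, X_comp]
  refine Finset.sum_congr rfl fun i _ => ?_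
  rw [mul_pow, ← C_pow, ← mul_assoc, ← C_mul]
  congr 2
  rw [mul_right_comm, ← mul_pow, hwv, one_pow, one_mul]

/-- A product modulo `X ^ (2 * h) - 1` is determined by its two halves, the product modulo
`X ^ h - 1` and, after a twist by a root of unity, the product modulo `X ^ h + 1`. -/
theorem butterfly [Algebra ℝ T] (h : ℕ) (hh : 0 < h) (w : T) (hw : w ^ h = -1) (a b c : ℕ → T)
    (hu : (X ^ h - 1 : T[X]) ∣ poly h (fun i => c i + c (h + i)) -
      poly h (fun i => a i + a (h + i)) * poly h (fun i => b i + b (h + i)))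
    (hv : (X ^ h - 1 : T[X]) ∣ poly h (fun i => w ^ i * (c i - c (h + i))) -
      poly h (fun i => w ^ i * (a i - a (h + i))) * poly h (fun i => w ^ i * (b i - b (h + i)))) :
    (X ^ (2 * h) - 1 : T[X]) ∣ poly (2 * h) c - poly (2 * h) a * poly (2 * h) b := by
  -- From `w ^ h = -1` the inverse of `w` is `-w ^ (h - 1)`, and its `h`-th power is again `-1`.
  have hwv : w * (- w ^ (h - 1)) = 1 := by
    rw [mul_neg, ← pow_succ', Nat.sub_add_cancel hh, hw, neg_neg]
  have hvh : (- w ^ (h - 1)) ^ h = -1 := by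
    have := congrArg (· ^ h) hwv
    simp only [mul_pow, hw, one_pow] at this
    linear_combination (-1 : T) * this
  have h2 : (X ^ h + 1 : T[X]) ∣ poly h (fun i => c i - c (h + i)) -
      poly h (fun i => a i - a (h + i)) * poly h (fun i => b i - b (h + i)) := by
    have := _root_.map_dvd (compRingHom (C (- w ^ (h - 1)) * X)) hv
    simp only [coe_compRingHom_apply, sub_comp, mul_comp, pow_comp, X_comp, one_comp,
      poly_twist _ _ _ _ hwv] at this
    rw [mul_pow, ← C_pow, hvh] at this
    -- Rescaling by `w⁻¹` has turned the modulus `X ^ h - 1` into `-X ^ h - 1`.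
    have e : (C (-1 : T) * X ^ h - 1 : T[X]) = -(X ^ h + 1) := by
      rw [C_neg, C_1]; ring
    rwa [e, neg_dvd] at this
  rw [two_mul]
  simp only [poly_split, poly_add, poly_sub] at hu h2 ⊢
  set c0 := poly h c
  set c1 := poly h (fun i => c (h + i))
  set a0 := poly h a
  set a1 := poly h (fun i => a (h + i))
  set b0 := poly h b
  set b1 := poly h (fun i => b (h + i))
  have e : (X ^ (h + h) - 1 : T[X]) = (X ^ h - 1) * (X ^ h + 1) := by ring
  rw [e]
  refine IsCoprime.mul_dvd ?_ ?_ ?_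
  -- Bézout: half the difference of `X ^ h + 1` and `X ^ h - 1` is `1`. This is where `2` must be
  -- invertible.
  · refine ⟨-C (algebraMap ℝ T (1 / 2)), C (algebraMap ℝ T (1 / 2)), ?_⟩
    have : C (algebraMap ℝ T (1 / 2)) * 2 = (1 : T[X]) := by
      rw [show (2 : T[X]) = C (algebraMap ℝ T 2) by rw [map_ofNat, map_ofNat], ← C_mul, ← map_mul]
      norm_num
    linear_combination this
  -- Substitute `X ^ h = (X ^ h - 1) + 1` and expand; the witness collects everything with a factor
  -- `X ^ h - 1`. The other case uses `X ^ h = (X ^ h + 1) - 1`.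
  · obtain ⟨q, hq⟩ := hu
    refine ⟨q + c1 - a1 * (b0 + b1) - b1 * (a0 + a1) - (X ^ h - 1) * a1 * b1, ?_⟩
    linear_combination hq
  · obtain ⟨q, hq⟩ := h2
    refine ⟨q + c1 - a1 * (b0 - b1) - b1 * (a0 - a1) - (X ^ h + 1) * a1 * b1, ?_⟩
    linear_combination hq

/-- There is no wrap-around for factors of half the length. -/
theorem eq_of_cyclic [Nontrivial T] (m : ℕ) (hm : 0 < m) (a b c : ℕ → T)
    (ha : ∀ i, m ≤ i → i < 2 * m → a i = 0) (hb : ∀ i, m ≤ i → i < 2 * m → b i = 0)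
    (h : (X ^ (2 * m) - 1 : T[X]) ∣ poly (2 * m) c - poly (2 * m) a * poly (2 * m) b) :
    poly (2 * m) c = poly m a * poly m b := by
  have key : ∀ a : ℕ → T, (∀ i, m ≤ i → i < 2 * m → a i = 0) → poly (2 * m) a = poly m a := by
    intro a ha
    ext i
    simp only [poly_coeff]
    by_cases h1 : i < m
    · simp [h1, show i < 2 * m by omega]
    · by_cases h2 : i < 2 * m
      · simp [h1, h2, ha i (by omega) h2]
      · simp [h1, h2]
  rw [key a ha, key b hb] at h
  have hmon : (X ^ (2 * m) - 1 : T[X]).Monic := monic_X_pow_sub_C 1 (by omega)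
  have hdeg : (X ^ (2 * m) - 1 : T[X]).degree = ((2 * m : ℕ) : WithBot ℕ) :=
    degree_X_pow_sub_C (by omega) 1
  -- The degree of the difference is below that of the monic modulus dividing it, so the difference
  -- is zero.
  have hlt : (poly (2 * m) c - poly m a * poly m b).degree < ((2 * m : ℕ) : WithBot ℕ) := by
    rw [degree_lt_iff_coeff_zero]
    intro i hi
    rw [coeff_sub, poly_coeff, if_neg (by omega), coeff_mul, Finset.sum_eq_zero, sub_zero]
    rintro ⟨x, y⟩ hxy
    rw [Finset.HasAntidiagonal.mem_antidiagonal] at hxy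
    simp only at hxy ⊢
    rw [poly_coeff, poly_coeff]
    by_cases hx : x < m
    · rw [if_neg (show ¬ y < m by omega), mul_zero]
    · rw [if_neg hx, zero_mul]
  by_contra hne
  exact hmon.not_dvd_of_degree_lt (sub_ne_zero.2 hne) (by rwa [hdeg]) h

/-! ### Real arrays as elements of an algebra: evaluation and signed rotation. -/

variable [Algebra ℝ T]

/-- The value at `t` of the polynomial with the real coefficients `f 0, …, f (n - 1)`. -/
noncomputable def ev (t : T) (n : ℕ) (f : ℕ → ℝ) : T :=
  ∑ i ∈ Finset.range n, algebraMap ℝ T (f i) * t ^ i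

theorem ev_congr {t : T} {n : ℕ} {f g : ℕ → ℝ} (h : ∀ i < n, f i = g i) : ev t n f = ev t n g :=
  Finset.sum_congr rfl fun i hi => by rw [h i (Finset.mem_range.1 hi)]

theorem ev_add (t : T) (n : ℕ) (f g : ℕ → ℝ) : ev t n (fun i => f i + g i) = ev t n f + ev t n g := by
  simp [ev, add_mul, Finset.sum_add_distrib]

theorem ev_sub (t : T) (n : ℕ) (f g : ℕ → ℝ) : ev t n (fun i => f i - g i) = ev t n f - ev t n g := by
  simp [ev, sub_mul]

/-- Multiplication by a power of `t` when `t ^ r = -1`. -/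
theorem ev_shift (t : T) (r e : ℕ) (ht : t ^ r = -1) (he : e ≤ r) (f : ℕ → ℝ) :
    ev t r (fun j => if e ≤ j then f (j - e) else -f (j + r - e)) = t ^ e * ev t r f := by
  obtain ⟨d, rfl⟩ := Nat.exists_eq_add_of_le he
  -- The cells pushed beyond the end reappear at the beginning; their factor `t ^ r = -1` is the
  -- sign.
  have h1 : ev t (e + d) (fun j => if e ≤ j then f (j - e) else -f (j + (e + d) - e)) =
      (∑ j ∈ Finset.range e, algebraMap ℝ T (-f (d + j)) * t ^ j) +
        ∑ j ∈ Finset.range d, algebraMap ℝ T (f j) * t ^ (e + j) := by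
    rw [ev, Finset.sum_range_add]
    congr 1
    · refine Finset.sum_congr rfl fun j hj => ?_
      rw [Finset.mem_range] at hj
      rw [if_neg (by omega), show j + (e + d) - e = d + j by omega]
    · refine Finset.sum_congr rfl fun j _ => ?_
      rw [if_pos (by omega), Nat.add_sub_cancel_left]
  rw [h1, ev, add_comm e d, Finset.sum_range_add, mul_add, add_comm]
  congr 1
  · rw [Finset.mul_sum]
    refine Finset.sum_congr rfl fun j _ => ?_
    ring
  · rw [Finset.mul_sum]
    refine Finset.sum_congr rfl fun j _ => ?_
    rw [map_neg]
    linear_combination (-algebraMap ℝ T (f (d + j)) * t ^ j) * ht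

/-- The array on the left is the rotation by `e` in the opposite direction, and `ev_shift` rotates
it back. -/
theorem ev_unshift (t : T) (r e : ℕ) (ht : t ^ r = -1) (he : e ≤ r) (f : ℕ → ℝ) :
    t ^ e * ev t r (fun j => if j + e < r then f (j + e) else -f (j + e - r)) = ev t r f := by
  rw [← ev_shift t r e ht he]
  refine ev_congr fun j hj => ?_
  by_cases h : e ≤ j
  · rw [if_pos h, if_pos (by omega), Nat.sub_add_cancel h]
  · rw [if_neg h, if_neg (by omega), neg_neg]
    congr 1
    omega

end Nussbaumer

/-! ### Negacyclic and cyclic products of arrays and their reduction to smaller ones. -/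

/-- `z` is the product of `x` and `y` modulo `X ^ N + 1`. -/
def NegProd (N : ℕ) (z x y : ℕ → ℝ) : Prop :=
  ∀ (T : Type) [CommRing T] [Algebra ℝ T] (t : T), t ^ N = -1 → ev t N z = ev t N x * ev t N y

/-- `z` is the product of `x` and `y` modulo `X ^ n - 1`, over rings with an `r`-th root of `-1`;
each coefficient occupies `r` cells. -/
def CycProd (r n : ℕ) (z x y : ℕ → ℝ) : Prop :=
  ∀ (T : Type) [CommRing T] [Algebra ℝ T] (t : T), t ^ r = -1 →
    (X ^ n - 1 : T[X]) ∣ poly n (fun i => ev t r fun j => z (i * r + j)) -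
      poly n (fun i => ev t r fun j => x (i * r + j)) * poly n (fun i => ev t r fun j => y (i * r + j))

theorem CycProd.one {r : ℕ} {z x y : ℕ → ℝ} (h : NegProd r z x y) : CycProd r 1 z x y := by
  intro T _ _ t ht
  have := h T t ht
  simp [poly, this]

/-- The array `x'` is obtained from `x` by one round of butterflies. -/
def Fwd (r h s : ℕ) (x x' : ℕ → ℝ) : Prop :=
  ∀ i < h, ∀ j < r, x' (i * r + j) = x (i * r + j) + x ((h + i) * r + j) ∧
    x' ((h + i) * r + j) = if i * s ≤ j then x (i * r + (j - i * s)) - x ((h + i) * r + (j - i * s))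
      else -(x (i * r + (j + r - i * s)) - x ((h + i) * r + (j + r - i * s)))

/-- The array `z` is obtained from `z'` by undoing one round of butterflies. -/
def Inv (r h s : ℕ) (z z' : ℕ → ℝ) : Prop :=
  ∀ i < h, ∀ j < r,
    z (i * r + j) = (z' (i * r + j) + if j + i * s < r then z' ((h + i) * r + (j + i * s))
      else -z' ((h + i) * r + (j + i * s - r))) / 2 ∧
    z ((h + i) * r + j) = (z' (i * r + j) - if j + i * s < r then z' ((h + i) * r + (j + i * s))
      else -z' ((h + i) * r + (j + i * s - r))) / 2

/-- The root of unity in `butterfly` is `t ^ s`, since `(t ^ s) ^ h = t ^ r = -1`. Twisting by its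
powers is a signed rotation of the `r` cells of a coefficient, which is what `Fwd` and `Inv` spell
out. -/
theorem CycProd.lift {r h s : ℕ} (hh : 0 < h) (hs : s * h = r) {x x' y y' z z' : ℕ → ℝ}
    (hx : Fwd r h s x x') (hy : Fwd r h s y y') (hz : Inv r h s z z')
    (hu : CycProd r h z' x' y')
    (hv : CycProd r h (fun i => z' (h * r + i)) (fun i => x' (h * r + i)) (fun i => y' (h * r + i))) :
    CycProd r (2 * h) z x y := by
  intro T _ _ t ht
  have his : ∀ i < h, i * s ≤ r := by
    intro i hi
    rw [← hs, mul_comm s h]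
    exact Nat.mul_le_mul_right s hi.le
  have fu : ∀ x x', Fwd r h s x x' → ∀ i < h, (ev t r fun j => x' (i * r + j)) =
      (ev t r fun j => x (i * r + j)) + ev t r fun j => x ((h + i) * r + j) := by
    intro x x' hx i hi
    rw [← ev_add]
    exact ev_congr fun j hj => (hx i hi j hj).1
  have fv : ∀ x x', Fwd r h s x x' → ∀ i < h, (ev t r fun j => x' (h * r + (i * r + j))) =
      (t ^ s) ^ i * ((ev t r fun j => x (i * r + j)) - ev t r fun j => x ((h + i) * r + j)) := by
    intro x x' hx i hi
    rw [← ev_sub, ← pow_mul, mul_comm s i, ← ev_shift t r (i * s) ht (his i hi)]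
    refine ev_congr fun j hj => ?_
    rw [← add_assoc, ← add_mul]
    exact (hx i hi j hj).2
  have gu : ∀ i < h, (ev t r fun j => z' (i * r + j)) =
      (ev t r fun j => z (i * r + j)) + ev t r fun j => z ((h + i) * r + j) := by
    intro i hi
    rw [← ev_add]
    refine ev_congr fun j hj => ?_
    rw [(hz i hi j hj).1, (hz i hi j hj).2]
    ring
  have gv : ∀ i < h, (ev t r fun j => z' (h * r + (i * r + j))) =
      (t ^ s) ^ i * ((ev t r fun j => z (i * r + j)) - ev t r fun j => z ((h + i) * r + j)) := by
    intro i hi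
    rw [← ev_sub, ← pow_mul, mul_comm s i]
    rw [← ev_unshift t r (i * s) ht (his i hi) (fun j => z' (h * r + (i * r + j)))]
    congr 1
    refine ev_congr fun j hj => ?_
    rw [(hz i hi j hj).1, (hz i hi j hj).2]
    simp only [← add_assoc, ← add_mul]
    ring
  have hw : (t ^ s) ^ h = -1 := by rw [← pow_mul, hs, ht]
  refine butterfly h hh (t ^ s) hw _ _ _ ?_ ?_
  · have := hu T t ht
    rwa [poly_congr gu, poly_congr (fu x x' hx), poly_congr (fu y y' hy)] at this
  · have := hv T t ht
    rwa [poly_congr gv, poly_congr (fv x x' hx), poly_congr (fv y y' hy)] at this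

/-- The array `x'` is the transpose of `x`, padded by zeros. -/
def Pad (r m : ℕ) (x x' : ℕ → ℝ) : Prop :=
  ∀ i < 2 * m, ∀ j < r, x' (i * r + j) = if i < m then x (j * m + i) else 0

/-- The array `z` is the transpose of `z'` after reduction of the upper half. -/
def Unpad (r m : ℕ) (z z' : ℕ → ℝ) : Prop :=
  ∀ i < m, ∀ j < r, z (j * m + i) = z' (i * r + j) +
    if 1 ≤ j then z' ((m + i) * r + (j - 1)) else -z' ((m + i) * r + (j + r - 1))

/-- Nussbaumer's step. With `y = t ^ m` one has `y ^ r = -1`, and an array of `r * m` cells is a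
polynomial in `t` of length `m` with coefficients that are polynomials in `y`. Padding to length `2
* m` leaves room for the product, so the cyclic product is the true one; replacing `t ^ m` by `y` in
its upper half gives the result. -/
theorem NegProd.of_cycProd {r m : ℕ} (hr : 0 < r) (hm : 0 < m) {x x' y y' z z' : ℕ → ℝ}
    (hx : Pad r m x x') (hy : Pad r m y y') (hz : Unpad r m z z')
    (h : CycProd r (2 * m) z' x' y') : NegProd (r * m) z x y := by
  intro T _ _ t ht
  rcases subsingleton_or_nontrivial T with hT | hT
  · exact Subsingleton.elim _ _
  have htr : (t ^ m) ^ r = -1 := by rw [← pow_mul, mul_comm, ht]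
  have hsum : ∀ x : ℕ → ℝ, ev t (r * m) x =
      ∑ i ∈ Finset.range m, (ev (t ^ m) r fun j => x (j * m + i)) * t ^ i := by
    intro x
    simp only [ev, Finset.sum_mul]
    rw [Finset.sum_comm]
    have : ∀ r, ∑ i ∈ Finset.range (r * m), algebraMap ℝ T (x i) * t ^ i =
        ∑ j ∈ Finset.range r, ∑ i ∈ Finset.range m,
          algebraMap ℝ T (x (j * m + i)) * (t ^ m) ^ j * t ^ i := by
      intro r
      induction r with
      | zero => simp
      | succ r ih =>
        rw [Finset.sum_range_succ, ← ih, Nat.succ_mul, Finset.sum_range_add]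
        congr 1
        refine Finset.sum_congr rfl fun i _ => ?_
        ring
    exact this r
  have hpad : ∀ x x', Pad r m x x' →
      (∀ i, m ≤ i → i < 2 * m → (ev (t ^ m) r fun j => x' (i * r + j)) = 0) ∧
      ∀ i < m, (ev (t ^ m) r fun j => x' (i * r + j)) = ev (t ^ m) r fun j => x (j * m + i) := by
    intro x x' hx
    constructor
    · intro i hi hi'
      rw [ev]
      refine Finset.sum_eq_zero fun j hj => ?_
      rw [hx i hi' j (Finset.mem_range.1 hj), if_neg (by omega), map_zero, zero_mul]
    · intro i hi
      refine ev_congr fun j hj => ?_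
      rw [hx i (by omega) j hj, if_pos hi]
  have key := eq_of_cyclic m hm _ _ _ (hpad x x' hx).1 (hpad y y' hy).1 (h T (t ^ m) htr)
  -- The variable may be replaced by `t` only after the cyclic congruence has become an identity of
  -- polynomials, as `t ^ (2 * m)` need not be `1`.
  have key2 := congrArg (eval t) key
  rw [eval_mul, poly_congr (hpad x x' hx).2, poly_congr (hpad y y' hy).2, poly_eval, poly_eval,
    poly_eval, ← hsum, ← hsum] at key2
  rw [← key2, hsum z, two_mul, Finset.sum_range_add, ← Finset.sum_add_distrib]
  refine Finset.sum_congr rfl fun i hi => ?_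
  -- The coefficient of index `m + i` acquires a factor `t ^ m`, which is a rotation by one cell.
  have h1 : (ev (t ^ m) r fun j => z (j * m + i)) = (ev (t ^ m) r fun j => z' (i * r + j)) +
      (t ^ m) ^ 1 * ev (t ^ m) r fun j => z' ((m + i) * r + j) := by
    rw [← ev_shift (t ^ m) r 1 htr hr, ← ev_add]
    exact ev_congr fun j hj => hz i (Finset.mem_range.1 hi) j hj
  rw [h1]
  ring

/-- A product modulo `X ^ 2 + 1`. -/
theorem NegProd.two {x y z : ℕ → ℝ} (h0 : z 0 = x 0 * y 0 - x 1 * y 1)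
    (h1 : z 1 = x 0 * y 1 + x 1 * y 0) : NegProd 2 z x y := by
  intro T _ _ t ht
  simp only [ev, Finset.sum_range_succ, Finset.sum_range_zero, h0, h1, map_add, map_sub, map_mul]
  linear_combination (algebraMap ℝ T (x 1) * algebraMap ℝ T (y 1)) * (-ht)

/-- The coefficients of a product modulo `X ^ N + 1`. -/
theorem NegProd.coeff {N : ℕ} (hN : 0 < N) {x y z : ℕ → ℝ} (h : NegProd N z x y) (i : ℕ) (hi : i < N) :
    z i = (poly N x * poly N y).coeff i - (poly N x * poly N y).coeff (N + i) := by
  have hroot : (AdjoinRoot.root (X ^ N + 1 : ℝ[X])) ^ N = -1 := by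
    have := AdjoinRoot.eval₂_root (X ^ N + 1 : ℝ[X])
    rw [eval₂_add, eval₂_pow, eval₂_X, eval₂_one] at this
    exact eq_neg_of_add_eq_zero_left this
  have h1 := h (AdjoinRoot (X ^ N + 1 : ℝ[X])) (AdjoinRoot.root _) hroot
  have hev : ∀ f : ℕ → ℝ, ev (AdjoinRoot.root (X ^ N + 1 : ℝ[X])) N f =
      AdjoinRoot.mk (X ^ N + 1) (poly N f) := by
    intro f
    simp [ev, poly, AdjoinRoot.algebraMap_eq]
  rw [hev, hev, hev, ← map_mul, AdjoinRoot.mk_eq_mk] at h1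
  set P := poly N x * poly N y with hP
  set lo := poly N (fun i => P.coeff i) with hlo
  set hi' := poly N (fun i => P.coeff (N + i)) with hhi
  have hsplit : P = lo + X ^ N * hi' := by
    rw [hlo, hhi, ← poly_split N N (fun i => P.coeff i)]
    ext j
    rw [poly_coeff]
    by_cases hj : j < N + N
    · rw [if_pos hj]
    · rw [if_neg hj, hP, coeff_mul, Finset.sum_eq_zero]
      rintro ⟨a, b⟩ hab
      rw [Finset.HasAntidiagonal.mem_antidiagonal] at hab
      simp only at hab ⊢
      rw [poly_coeff, poly_coeff]
      by_cases ha : a < N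
      · rw [if_neg (show ¬ b < N by omega), mul_zero]
      · rw [if_neg ha, zero_mul]
  have h2 : (X ^ N + 1 : ℝ[X]) ∣ poly N z - (lo - hi') := by
    have : poly N z - (lo - hi') = (poly N z - P) + (X ^ N + 1) * hi' := by
      rw [hsplit]; ring
    rw [this]
    exact dvd_add h1 (dvd_mul_right _ _)
  have hmon : (X ^ N + 1 : ℝ[X]).Monic := monic_X_pow_add_C 1 (by omega)
  have hdeg : (X ^ N + 1 : ℝ[X]).degree = (N : WithBot ℕ) := degree_X_pow_add_C (by omega) 1
  have h3 : poly N z - (lo - hi') = 0 := by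
    by_contra hne
    refine hmon.not_dvd_of_degree_lt hne ?_ h2
    rw [hdeg]
    exact (degree_sub_le _ _).trans_lt (max_lt (poly_degree_lt N z)
      ((degree_sub_le _ _).trans_lt (max_lt (poly_degree_lt N _) (poly_degree_lt N _))))
  have h4 := congrArg (fun p => p.coeff i) h3
  simp only [coeff_sub, hlo, hhi, poly_coeff, if_pos hi, coeff_zero] at h4
  linarith

/-! ### Transforming an array -/

/-- The array `f` read from the cell `o` on. -/
def shift (f : ℕ → ℝ) (o : ℕ) (i : ℕ) : ℝ := f (o + i)

theorem digits {b q i r j : ℕ} (hi : i < q) (hj : j < r) :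
    ((b * q + i) * r + j) % r = j ∧ ((b * q + i) * r + j) / r % q = i ∧
      ((b * q + i) * r + j) / r / q = b := by
  have h1 : ((b * q + i) * r + j) / r = b * q + i := by
    rw [mul_comm, Nat.mul_add_div (by omega), Nat.div_eq_of_lt hj, add_zero]
  refine ⟨by rw [Nat.mul_add_mod_self_right, Nat.mod_eq_of_lt hj], ?_, ?_⟩
  · rw [h1, Nat.mul_add_mod_self_right, Nat.mod_eq_of_lt hi]
  · rw [h1, mul_comm, Nat.mul_add_div (by omega), Nat.div_eq_of_lt hi, add_zero]

theorem digits_lt {B b q i r j : ℕ} (hb : b < B) (hi : i < q) (hj : j < r) :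
    (b * q + i) * r + j < B * (q * r) := by
  have h1 : b * q + i + 1 ≤ B * q := by
    have := Nat.mul_le_mul_right q (show b + 1 ≤ B from hb)
    rw [Nat.succ_mul] at this
    omega
  have h2 := Nat.mul_le_mul_right r h1
  rw [Nat.succ_mul, mul_assoc] at h2
  omega

/-- A sweep without use of the digits. -/
def flat (len : IExp) : Sweep := ⟨len, .const 1, .const 1, .const 0, .const 0, .const 0⟩

/-- Replace the array `dst` by the values of `e`, which may read `dst`. -/
def xform (s : Sweep) (dst : ℕ) (e : GExp) : Cmd := block [
  fill s 103 (.const 0) e,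
  fill (flat s.len) dst (.const 0) (.leaf (.get 103 (.var 100)))]

/-- Time for one cell of a transformation. -/
def xformCost (s : Sweep) (e : GExp) : ℕ :=
  fillCost s (.const 0) e + fillCost (flat s.len) (.const 0) (.leaf (.get 103 (.var 100))) + 1

/-- The two memories agree except for the counters of a sweep, the scratch array and `W`. -/
structure XEq (W : ℕ) (σ τ : Mem) : Prop where
  ivar : ∀ x, x < 100 ∨ 106 ≤ x → τ.ivar x = σ.ivar x
  iarr : τ.iarr = σ.iarr
  rvar : τ.rvar = σ.rvar
  rarr : ∀ a, a ≠ 103 → a ≠ W → τ.rarr a = σ.rarr a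

/-- The new values go to the array `103` first and are copied afterwards, so every evaluation of `e`
still sees the old contents of `dst`. -/
theorem xform_runs {ps : List Cmd} (s : Sweep) (dst : ℕ) (e : GExp) (σ : Mem) (v : Shape)
    (F : ℕ → ℝ) (hd : dst ≠ 103) (hr : 0 < v.rad) (hq : 0 < v.quo)
    (hv : ∀ τ, XEq dst σ τ → s.Vals v τ)
    (hF : ∀ p < v.len, ∀ τ, FillEq 103 σ τ → v.Digits p τ → e.eval τ = F p) :
    Runs ps (xform s dst e) σ (xformCost s e * (v.len + 1))
      (fun τ => XEq dst σ τ ∧ ∀ p < v.len, τ.rarr dst p = F p) := by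
  apply Runs.le
  case h =>
    unfold xform
    apply Runs.cons
    refine (fill_runs s 103 (.const 0) e σ v 0 F hr hq (fun τ hτ => ⟨hv τ ⟨hτ.ivar, hτ.iarr, hτ.rvar,
      fun a ha _ => hτ.rarr a ha⟩, rfl⟩) (fun p hp τ h1 h2 _ => hF p hp τ h1 h2)).post ?_
    rintro τ ⟨h1, h2⟩
    apply Runs.cons
    have hx : ∀ υ, FillEq dst τ υ → XEq dst σ υ := fun υ hυ =>
      ⟨fun x hx => (hυ.ivar x hx).trans (h1.ivar x hx), hυ.iarr.trans h1.iarr,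
        hυ.rvar.trans h1.rvar, fun a ha hb => (hυ.rarr a hb).trans (h1.rarr a ha)⟩
    refine (fill_runs (flat s.len) dst (.const 0) _ τ ⟨v.len, 1, 1, 0, 0, 0⟩ 0 F one_pos one_pos ?_ ?_).post ?_
    · intro υ hυ
      exact ⟨⟨(hv υ (hx υ hυ)).len, rfl, rfl, rfl, rfl, rfl⟩, rfl⟩
    · intro p hp υ hυ hd' _
      simp only [GExp.eval, RExp.eval, IExp.eval, hd'.pos]
      rw [hυ.rarr 103 hd.symm, h2, fillFun_zero hp]
    · rintro υ ⟨h3, h4⟩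
      refine Runs.nil ⟨hx υ h3, fun p hp => ?_⟩
      rw [h4, fillFun_zero hp]
  case hT =>
    have : (xformCost s e) * (v.len + 1) = fillCost s (.const 0) e * (v.len + 1) +
      (fillCost (flat s.len) (.const 0) (.leaf (.get 103 (.var 100))) * (v.len + 1) + (v.len + 1)) := by
      unfold xformCost; ring
    rw [this]
    simp

/-! ### Batched multiplication modulo `X ^ (2 ^ k) + 1` -/

/-- Set `x` to `2 ^ e`, with the counter `131`. -/
def powCmd (x : ℕ) (e : IExp) : Cmd := block [
  .iset x (.const 1), .iset 131 (.const 0),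
  .loop (.ilt (.var 131) e) (block [.iset x (.add (.var x) (.var x)),
    .iset 131 (.add (.var 131) (.const 1))])]

theorem powCmd_runs {ps : List Cmd} (x : ℕ) (e : IExp) (n : ℕ) (σ : Mem) (hx : x ≠ 131)
    (he : ∀ v w, e.eval ((σ.setI x v).setI 131 w) = n) :
    Runs ps (powCmd x e) σ ((e.cost + 15) * (n + 1))
      (fun τ => τ = (σ.setI x (2 ^ n)).setI 131 n) := by
  apply Runs.le
  case h =>
    unfold powCmd
    apply Runs.set (v := 1) rfl
    apply Runs.set (v := 0) rfl
    apply Runs.cons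
    refine (Runs.loop (T := 9) (fun i τ => τ = (σ.setI x (2 ^ i)).setI 131 i) n ?_ ?_ ?_).post fun τ hτ => Runs.nil hτ
    · rintro i hi τ rfl
      refine ⟨by simp [he, hi], ?_⟩
      have : Runs ps (block [.iset x (.add (.var x) (.var x)), .iset 131 (.add (.var 131) (.const 1))])
          ((σ.setI x (2 ^ i)).setI 131 i) (4 + (4 + 1))
          (fun τ => τ = (σ.setI x (2 ^ (i + 1))).setI 131 (i + 1)) := by
        refine Runs.set (v := 2 ^ (i + 1)) (by simp [hx, pow_succ, mul_two]) ?_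
        refine Runs.set (v := i + 1) (by simp [hx.symm]) ?_
        refine Runs.nil ?_
        ext y <;> simp
        grind
      exact this
    · rintro τ rfl
      simp [he]
    · simp
  case hT =>
    simp only [IExp.cost, Test.cost]
    nlinarith

/-- Sizes for one step of the recursion: the halves of the exponent `120` and the powers of two. -/
def setup : Cmd := block [
  .iset 129 (.half (.var 120)), .iset 130 (.sub (.var 120) (.var 129)),
  powCmd 125 (.var 129), powCmd 123 (.var 130), powCmd 132 (.var 120)]

/-- The sizes for the exponent `k` have been computed. -/
structure Sized (k : ℕ) (σ : Mem) : Prop where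
  hk : σ.ivar 120 = k
  hkh : σ.ivar 129 = k / 2
  hkr : σ.ivar 130 = k - k / 2
  hm : σ.ivar 125 = 2 ^ (k / 2)
  hr : σ.ivar 123 = 2 ^ (k - k / 2)
  hn : σ.ivar 132 = 2 ^ k

theorem setup_runs {ps : List Cmd} (k : ℕ) (σ : Mem) (hk : σ.ivar 120 = k) :
    Runs ps setup σ (100 * (k + 1)) (fun τ => Sized k τ ∧ OdoEq σ { τ with ivar := σ.ivar } ∧
      ∀ x, x < 123 ∨ x = 124 ∨ x = 126 ∨ x = 127 ∨ x = 128 ∨ 132 < x → τ.ivar x = σ.ivar x) := by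
  apply Runs.le
  case h =>
    unfold setup
    apply Runs.set (v := k / 2) (by simp [hk])
    apply Runs.set (v := k - k / 2) (by simp [hk])
    apply Runs.cons
    refine (powCmd_runs _ _ (k / 2) _ (by simp) (by simp)).post ?_
    rintro τ rfl
    apply Runs.cons
    refine (powCmd_runs _ _ (k - k / 2) _ (by simp) (by simp)).post ?_
    rintro τ rfl
    apply Runs.cons
    refine (powCmd_runs _ _ k _ (by simp) (by simp [hk])).post ?_
    rintro τ rfl
    apply Runs.nil
    refine ⟨?_, ?_, ?_⟩
    · constructor <;> simp [hk]
    · constructor <;> simp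
    · intro x hx
      simp only [Mem.setI_ivar]
      repeat rw [if_neg (by omega)]
  case hT =>
    simp only [IExp.cost]
    have h1 : (1 + 15) * (k / 2 + 1) ≤ 16 * (k + 1) := Nat.mul_le_mul (by omega) (by omega)
    have h2 : (1 + 15) * (k - k / 2 + 1) ≤ 16 * (k + 1) := Nat.mul_le_mul (by omega) (by omega)
    omega

/-- The positions and digits for `padCmd`. -/
def padSweep : Sweep := ⟨.add (.var 121) (.var 121), .var 123, .add (.var 125) (.var 125), .var 125, .const 0, .var 132⟩

/-- The new contents for `padCmd`. -/
def padExp (a : ℕ) : GExp :=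
  (.ite (.ilt (.var 102) (.var 125))
    (.leaf (.get a (.add (.add (.var 105) (.var 103)) (.var 102)))) (.leaf (.const 0)))

/-- Transposition and padding of the array `a`. -/
def padCmd (a : ℕ) : Cmd := xform padSweep a (padExp a)

/-- A block is an `r` by `m` matrix. After transposition each row of `r` cells is one coefficient
for the Fourier transform; the `m` zero rows that follow double the total length. -/
theorem padCmd_runs {ps : List Cmd} (a : ℕ) (ha : a ≠ 103) : ∃ c, ∀ (k B : ℕ) (σ : Mem), Sized k σ →
    σ.ivar 121 = B * 2 ^ k → Runs ps (padCmd a) σ (c * (2 * (B * 2 ^ k) + 1)) (fun τ => XEq a σ τ ∧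
      ∀ b < B, Pad (2 ^ (k - k / 2)) (2 ^ (k / 2)) (shift (σ.rarr a) (b * 2 ^ k))
        (shift (τ.rarr a) (b * (2 * 2 ^ k)))) := by
  refine ⟨xformCost padSweep (padExp a), fun k B σ hσ hS => ?_⟩
  set r := 2 ^ (k - k / 2) with hr
  set m := 2 ^ (k / 2) with hm
  have hN : 2 ^ k = r * m := by rw [hr, hm, ← pow_add]; congr 1; omega
  have hr0 : 0 < r := by positivity
  have hm0 : 0 < m := by positivity
  have := xform_runs (ps := ps) padSweep a (padExp a) σ
    ⟨2 * (B * 2 ^ k), r, 2 * m, m, 0, 2 ^ k⟩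
    (fun p => if p / r % (2 * m) < m then
      σ.rarr a (p / r / (2 * m) * 2 ^ k + p % r * m + p / r % (2 * m)) else 0) ha hr0 (by simp; omega) ?_ ?_
  · refine this.post ?_
    rintro τ ⟨h1, h2⟩
    refine ⟨h1, fun b hb i hi j hj => ?_⟩
    obtain ⟨d1, d2, d3⟩ := digits (b := b) hi hj
    have hlt := digits_lt hb hi hj
    have e1 : b * (2 * 2 ^ k) + (i * r + j) = (b * (2 * m) + i) * r + j := by rw [hN]; ring
    rw [shift, e1, h2 _ (by simp only; rw [hN]; convert hlt using 1; ring), d1, d2, d3]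
    simp only [shift, add_assoc]
  · intro τ hτ
    constructor <;> simp [padSweep, hτ.ivar, hS, hσ.hr, hσ.hm, hσ.hn, two_mul, r, m]
  · intro p hp τ hτ hd
    simp [padExp, GExp.eval, hd.i, hd.sj, hd.sg, hτ.ivar, hσ.hm, hτ.rarr _ ha, m]

/-- The positions and digits for `unpadCmd`. -/
def unpadSweep : Sweep := ⟨.var 121, .var 125, .var 123, .var 123, .const 0, .add (.var 132) (.var 132)⟩

/-- The new contents for `unpadCmd`. -/
def unpadExp : GExp :=
  (.ite (.ile (.const 1) (.var 102))
    (.leaf (.add (.get 102 (.add (.add (.var 105) (.var 103)) (.var 102)))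
      (.get 102 (.add (.add (.add (.var 105) (.var 132)) (.var 103)) (.sub (.var 102) (.const 1))))))
    (.leaf (.sub (.get 102 (.add (.add (.var 105) (.var 103)) (.var 102)))
      (.get 102 (.add (.add (.add (.var 105) (.var 132)) (.var 103)) (.sub (.var 123) (.const 1)))))))

/-- Reduction and transposition of the array `102`. -/
def unpadCmd : Cmd := xform unpadSweep 102 unpadExp

theorem unpadCmd_runs {ps : List Cmd} : ∃ c, ∀ (k B : ℕ) (σ : Mem), Sized k σ →
    σ.ivar 121 = B * 2 ^ k → Runs ps unpadCmd σ (c * (B * 2 ^ k + 1)) (fun τ => XEq 102 σ τ ∧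
      ∀ b < B, Unpad (2 ^ (k - k / 2)) (2 ^ (k / 2)) (shift (τ.rarr 102) (b * 2 ^ k))
        (shift (σ.rarr 102) (b * (2 * 2 ^ k)))) := by
  refine ⟨xformCost unpadSweep unpadExp, fun k B σ hσ hS => ?_⟩
  set r := 2 ^ (k - k / 2) with hr
  set m := 2 ^ (k / 2) with hm
  have hN : 2 ^ k = r * m := by rw [hr, hm, ← pow_add]; congr 1; omega
  have hr0 : 0 < r := by positivity
  have hm0 : 0 < m := by positivity
  have := xform_runs (ps := ps) unpadSweep 102 unpadExp σ
    ⟨B * 2 ^ k, m, r, r, 0, 2 ^ k + 2 ^ k⟩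
    (fun p => if 1 ≤ p / m % r then σ.rarr 102 (p / m / r * (2 ^ k + 2 ^ k) + p % m * r + p / m % r) +
        σ.rarr 102 (p / m / r * (2 ^ k + 2 ^ k) + 2 ^ k + p % m * r + (p / m % r - 1))
      else σ.rarr 102 (p / m / r * (2 ^ k + 2 ^ k) + p % m * r + p / m % r) -
        σ.rarr 102 (p / m / r * (2 ^ k + 2 ^ k) + 2 ^ k + p % m * r + (r - 1))) (by simp) hm0 hr0 ?_ ?_
  · refine this.post ?_
    rintro τ ⟨h1, h2⟩
    refine ⟨h1, fun b hb i hi j hj => ?_⟩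
    obtain ⟨d1, d2, d3⟩ := digits (b := b) hj hi
    have hlt := digits_lt hb hj hi
    have e1 : b * 2 ^ k + (j * m + i) = (b * r + j) * m + i := by rw [hN]; ring
    rw [shift, e1, h2 _ (by simp only; rw [hN]; exact hlt), d1, d2, d3]
    have e2 : b * (2 ^ k + 2 ^ k) + i * r + j = b * (2 * 2 ^ k) + (i * r + j) := by ring
    have e3 : ∀ x, b * (2 ^ k + 2 ^ k) + 2 ^ k + i * r + x = b * (2 * 2 ^ k) + ((m + i) * r + x) := by
      intro x
      linear_combination hN
    rw [e2, e3, e3]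
    simp only [shift]
    split_ifs with hj1
    · rfl
    · rw [show j + r - 1 = r - 1 by omega, sub_eq_add_neg]
  · intro τ hτ
    constructor <;> simp [unpadSweep, hτ.ivar, hS, hσ.hr, hσ.hm, hσ.hn, r, m]
  · intro p hp τ hτ hd
    simp [unpadExp, GExp.eval, hd.i, hd.sj, hd.sg, hτ.ivar, hσ.hr, hσ.hn, hτ.rarr _ (show 102 ≠ 103 by simp), r]

/-- The parameters of a recursive transform of length `len` over blocks of length `r`. -/
structure Node (r h s B : ℕ) (σ : Mem) : Prop where
  hr : σ.ivar 123 = r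
  hlen : σ.ivar 126 = 2 * h
  hlr : σ.ivar 127 = 2 * (h * r)
  hs : σ.ivar 128 = s
  hS : σ.ivar 121 = B * (2 * h * r)

/-- The positions and digits for `fwdCmd`. -/
def fwdSweep : Sweep := ⟨.var 121, .var 123, .var 126, .const 0, .var 128, .const 0⟩

/-- The new contents for `fwdCmd`. -/
def fwdExp (a : ℕ) : GExp :=
  (.ite (.ilt (.var 104) (.var 123))
    (.leaf (.add (.get a (.var 100)) (.get a (.add (.var 100) (.half (.var 127))))))
    (.ite (.ile (.sub (.var 104) (.var 123)) (.var 101))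
      (.leaf (.sub (.get a (.sub (.var 100) (.add (.half (.var 127)) (.sub (.var 104) (.var 123)))))
        (.get a (.sub (.var 100) (.sub (.var 104) (.var 123))))))
      (.leaf (.sub (.get a (.sub (.add (.var 100) (.var 123)) (.sub (.var 104) (.var 123))))
        (.get a (.sub (.add (.var 100) (.var 123))
          (.add (.half (.var 127)) (.sub (.var 104) (.var 123)))))))))

/-- One round of butterflies on the array `a`. -/
def fwdCmd (a : ℕ) : Cmd := xform fwdSweep a (fwdExp a)

theorem fwdCmd_runs {ps : List Cmd} (a : ℕ) (ha : a ≠ 103) : ∃ c, ∀ (r h s B : ℕ) (σ : Mem),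
    0 < r → 0 < h → s * h = r → Node r h s B σ →
    Runs ps (fwdCmd a) σ (c * (B * (2 * h * r) + 1)) (fun τ => XEq a σ τ ∧
      ∀ b < B, Fwd r h s (shift (σ.rarr a) (b * (2 * h * r))) (shift (τ.rarr a) (b * (2 * h * r)))) := by
  refine ⟨xformCost fwdSweep (fwdExp a), fun r h s B σ hr hh hs hσ => ?_⟩
  have := xform_runs (ps := ps) fwdSweep a (fwdExp a) σ
    ⟨B * (2 * h * r), r, 2 * h, 0, s, 0⟩
    (fun p => if p / r % (2 * h) * s < r then σ.rarr a p + σ.rarr a (p + h * r) else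
      if p / r % (2 * h) * s - r ≤ p % r then
        σ.rarr a (p - (h * r + (p / r % (2 * h) * s - r))) - σ.rarr a (p - (p / r % (2 * h) * s - r))
      else σ.rarr a (p + r - (p / r % (2 * h) * s - r)) -
        σ.rarr a (p + r - (h * r + (p / r % (2 * h) * s - r)))) ha hr (by simp; omega) ?_ ?_
  · refine this.post ?_
    rintro τ ⟨h1, h2⟩
    refine ⟨h1, fun b hb i hi j hj => ?_⟩
    have hs0 : 0 < s := Nat.pos_of_ne_zero fun h0 => by rw [h0, zero_mul] at hs; omega
    -- Because `s * h = r`, the product of the digit with `s` is below `r` exactly in the lower half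
    -- of a block. In the upper half it exceeds `r` by the rotation `i * s`, so a comparison and a
    -- subtraction yield both.
    have his : i * s < r := by
      rw [← hs, mul_comm s]
      exact Nat.mul_lt_mul_of_pos_right hi hs0
    constructor
    · obtain ⟨d1, d2, d3⟩ := digits (b := b) (show i < 2 * h by omega) hj
      have hlt := digits_lt hb (show i < 2 * h by omega) hj
      have e1 : b * (2 * h * r) + (i * r + j) = (b * (2 * h) + i) * r + j := by ring
      have e2 : b * (2 * h * r) + ((h + i) * r + j) = (b * (2 * h) + i) * r + j + h * r := by ring
      simp only [shift]
      rw [e1, e2, h2 _ hlt, d2, if_pos his]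
    · obtain ⟨d1, d2, d3⟩ := digits (b := b) (show h + i < 2 * h by omega) hj
      have hlt := digits_lt hb (show h + i < 2 * h by omega) hj
      have e1 : b * (2 * h * r) + ((h + i) * r + j) = (b * (2 * h) + (h + i)) * r + j := by ring
      have e2 : (h + i) * s = r + i * s := by rw [add_mul, mul_comm h, hs]
      have e3 : ∀ x, b * (2 * h * r) + (i * r + x) = b * (2 * h * r) + i * r + x := fun x => by ring
      have e4 : ∀ x, b * (2 * h * r) + ((h + i) * r + x) = b * (2 * h * r) + i * r + h * r + x :=
        fun x => by ring
      simp only [shift]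
      rw [e1, h2 _ hlt, d2, d1, e2, if_neg (by omega), Nat.add_sub_cancel_left, ← e1]
      simp only [e3, e4]
      split_ifs with hj1
      · congr 2 <;> omega
      · rw [neg_sub]
        congr 2 <;> omega
  · intro τ hτ
    constructor <;> simp [fwdSweep, hτ.ivar, hσ.hr, hσ.hlen, hσ.hs, hσ.hS]
  · intro p hp τ hτ hd
    simp [fwdExp, GExp.eval, hd.pos, hd.j, hd.si, hτ.ivar, hσ.hr, hσ.hlr, hτ.rarr _ ha]

/-- The positions and digits for `invCmd`. -/
def invSweep : Sweep := ⟨.var 121, .var 123, .var 126, .const 0, .var 128, .const 0⟩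

/-- The new contents for `invCmd`. -/
def invExp : GExp :=
  (.ite (.ilt (.var 104) (.var 123))
    (.ite (.ilt (.add (.var 101) (.var 104)) (.var 123))
      (.leaf (.div (.add (.get 102 (.var 100))
        (.get 102 (.add (.add (.var 100) (.half (.var 127))) (.var 104)))) (.const 2)))
      (.leaf (.div (.sub (.get 102 (.var 100))
        (.get 102 (.sub (.add (.add (.var 100) (.half (.var 127))) (.var 104)) (.var 123)))) (.const 2))))
    (.ite (.ilt (.add (.var 101) (.sub (.var 104) (.var 123))) (.var 123))
      (.leaf (.div (.sub (.get 102 (.sub (.var 100) (.half (.var 127))))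
        (.get 102 (.add (.var 100) (.sub (.var 104) (.var 123))))) (.const 2)))
      (.leaf (.div (.add (.get 102 (.sub (.var 100) (.half (.var 127))))
        (.get 102 (.sub (.add (.var 100) (.sub (.var 104) (.var 123))) (.var 123)))) (.const 2)))))

/-- Undo one round of butterflies on the array `102`. -/
def invCmd : Cmd := xform invSweep 102 invExp

theorem invCmd_runs {ps : List Cmd} : ∃ c, ∀ (r h s B : ℕ) (σ : Mem),
    0 < r → 0 < h → s * h = r → Node r h s B σ →
    Runs ps invCmd σ (c * (B * (2 * h * r) + 1)) (fun τ => XEq 102 σ τ ∧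
      ∀ b < B, Inv r h s (shift (τ.rarr 102) (b * (2 * h * r))) (shift (σ.rarr 102) (b * (2 * h * r)))) := by
  refine ⟨xformCost invSweep invExp, fun r h s B σ hr hh hs hσ => ?_⟩
  have := xform_runs (ps := ps) invSweep 102 invExp σ
    ⟨B * (2 * h * r), r, 2 * h, 0, s, 0⟩
    (fun p => if p / r % (2 * h) * s < r then
        if p % r + p / r % (2 * h) * s < r then
          (σ.rarr 102 p + σ.rarr 102 (p + h * r + p / r % (2 * h) * s)) / 2
        else (σ.rarr 102 p - σ.rarr 102 (p + h * r + p / r % (2 * h) * s - r)) / 2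
      else
        if p % r + (p / r % (2 * h) * s - r) < r then
          (σ.rarr 102 (p - h * r) - σ.rarr 102 (p + (p / r % (2 * h) * s - r))) / 2
        else (σ.rarr 102 (p - h * r) + σ.rarr 102 (p + (p / r % (2 * h) * s - r) - r)) / 2)
    (by simp) hr (by simp; omega) ?_ ?_
  · refine this.post ?_
    rintro τ ⟨h1, h2⟩
    refine ⟨h1, fun b hb i hi j hj => ?_⟩
    have hs0 : 0 < s := Nat.pos_of_ne_zero fun h0 => by rw [h0, zero_mul] at hs; omega
    have his : i * s < r := by
      rw [← hs, mul_comm s]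
      exact Nat.mul_lt_mul_of_pos_right hi hs0
    have e3 : ∀ x, b * (2 * h * r) + (i * r + x) = b * (2 * h * r) + i * r + x := fun x => by ring
    have e4 : ∀ x, b * (2 * h * r) + ((h + i) * r + x) = b * (2 * h * r) + i * r + h * r + x :=
      fun x => by ring
    constructor
    · obtain ⟨d1, d2, d3⟩ := digits (b := b) (show i < 2 * h by omega) hj
      have hlt := digits_lt hb (show i < 2 * h by omega) hj
      have e1 : b * (2 * h * r) + (i * r + j) = (b * (2 * h) + i) * r + j := by ring
      simp only [shift]
      rw [e1, h2 _ hlt, d2, d1, if_pos his, ← e1]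
      simp only [e3, e4]
      split_ifs with hj1
      · congr 3; omega
      · rw [← sub_eq_add_neg]
        congr 3; omega
    · obtain ⟨d1, d2, d3⟩ := digits (b := b) (show h + i < 2 * h by omega) hj
      have hlt := digits_lt hb (show h + i < 2 * h by omega) hj
      have e1 : b * (2 * h * r) + ((h + i) * r + j) = (b * (2 * h) + (h + i)) * r + j := by ring
      have e2 : (h + i) * s = r + i * s := by rw [add_mul, mul_comm h, hs]
      simp only [shift]
      rw [e1, h2 _ hlt, d2, d1, e2, if_neg (by omega), Nat.add_sub_cancel_left, ← e1]
      simp only [e3, e4]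
      split_ifs with hj1
      · congr 3 <;> omega
      · rw [sub_neg_eq_add]
        congr 3 <;> omega
  · intro τ hτ
    constructor <;> simp [invSweep, hτ.ivar, hσ.hr, hσ.hlen, hσ.hs, hσ.hS]
  · intro p hp τ hτ hd
    simp [invExp, GExp.eval, hd.pos, hd.j, hd.si, hτ.ivar, hσ.hr, hσ.hlr, hτ.rarr _ (show 102 ≠ 103 by simp)]

/-- The positions and digits for `baseCmd`. -/
def baseSweep : Sweep := ⟨.var 121, .const 2, .const 1, .const 0, .const 0, .const 0⟩

/-- The new contents for `baseCmd`. -/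
def baseExp : GExp :=
  (.ite (.ile (.var 101) (.const 0))
    (.leaf (.sub (.mul (.get 100 (.var 100)) (.get 101 (.var 100)))
      (.mul (.get 100 (.add (.var 100) (.const 1))) (.get 101 (.add (.var 100) (.const 1))))))
    (.leaf (.add (.mul (.get 100 (.sub (.var 100) (.const 1))) (.get 101 (.var 100)))
      (.mul (.get 100 (.var 100)) (.get 101 (.sub (.var 100) (.const 1)))))))

/-- Products modulo `X ^ 2 + 1`. -/
def baseCmd : Cmd := fill baseSweep 102 (.const 0) baseExp

theorem baseCmd_runs {ps : List Cmd} : ∃ c, ∀ (B : ℕ) (σ : Mem), σ.ivar 121 = B * 2 →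
    Runs ps baseCmd σ (c * (B * 2 + 1)) (fun τ => FillEq 102 σ τ ∧
      ∀ b < B, NegProd 2 (shift (τ.rarr 102) (b * 2)) (shift (σ.rarr 100) (b * 2))
        (shift (σ.rarr 101) (b * 2))) := by
  refine ⟨fillCost baseSweep (.const 0) baseExp, fun B σ hS => ?_⟩
  have := fill_runs (ps := ps) baseSweep 102 (.const 0) baseExp σ
    ⟨B * 2, 2, 1, 0, 0, 0⟩ 0
    (fun p => if p % 2 = 0 then
        σ.rarr 100 p * σ.rarr 101 p - σ.rarr 100 (p + 1) * σ.rarr 101 (p + 1)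
      else σ.rarr 100 (p - 1) * σ.rarr 101 p + σ.rarr 100 p * σ.rarr 101 (p - 1))
    (by simp) (by simp) ?_ ?_
  · refine this.post ?_
    rintro τ ⟨h1, h2⟩
    refine ⟨h1, fun b hb => NegProd.two ?_ ?_⟩
    · simp only [shift]
      rw [h2, fillFun_zero (by simp only; omega), if_pos (by omega), add_zero]
    · simp only [shift]
      rw [h2, fillFun_zero (by simp only; omega), if_neg (by omega)]
      simp
  · intro τ hτ
    refine ⟨?_, rfl⟩
    constructor <;> simp [baseSweep, hτ.ivar, hS]
  · intro p hp τ hτ hd _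
    have := Nat.mod_lt p (show 0 < 2 by simp)
    simp [baseExp, GExp.eval, hd.pos, hd.j, hτ.rarr]

/-- The procedure for batched multiplication: the array `102` gets the products of the blocks of
length `2 ^ k` of the arrays `100` and `101`; the exponent `k` is in `120`, the total length in `121`. -/
def mulBody : Cmd :=
  .ite (.ile (.var 120) (.const 1)) baseCmd (block [
    setup, padCmd 100, padCmd 101,
    .iset 121 (.add (.var 121) (.var 121)),
    .iset 126 (.add (.var 125) (.var 125)),
    .iset 127 (.add (.var 132) (.var 132)),
    .iset 128 (.add (.const 1) (.sub (.var 130) (.var 129))),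
    .call 1,
    .iset 121 (.half (.var 121)),
    unpadCmd])

/-- The procedure for batched cyclic products of length `126` over blocks of length `123`. -/
def nodeBody : Cmd :=
  .ite (.ile (.var 126) (.const 1)) (block [
    .iput 100 (.var 122) (.var 120),
    .iset 122 (.add (.var 122) (.const 1)),
    .iset 120 (.var 130),
    .call 0,
    .iset 122 (.sub (.var 122) (.const 1)),
    .iset 120 (.get 100 (.var 122)),
    setup,
    .iset 126 (.const 1),
    .iset 127 (.var 123),
    .iset 128 (.add (.var 123) (.var 123))])
  (block [
    fwdCmd 100, fwdCmd 101,
    .iset 126 (.half (.var 126)), .iset 127 (.half (.var 127)),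
    .iset 128 (.add (.var 128) (.var 128)),
    .call 1,
    .iset 126 (.add (.var 126) (.var 126)), .iset 127 (.add (.var 127) (.var 127)),
    .iset 128 (.half (.var 128)),
    invCmd])

/-! ### Correctness and running time of the batched multiplication. -/

/-- Everything outside the working memory of the multiplication is unchanged. -/
structure Stacked (σ τ : Mem) : Prop where
  below : Below 100 σ τ
  depth : τ.ivar 122 = σ.ivar 122
  stack : ∀ i < σ.ivar 122, τ.iarr 100 i = σ.iarr 100 i

theorem Stacked.trans {σ τ υ : Mem} (h : Stacked σ τ) (h' : Stacked τ υ) : Stacked σ υ :=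
  ⟨h.below.trans h'.below, h'.depth.trans h.depth, fun i hi => by
    rw [h'.stack i (by rw [h.depth]; exact hi), h.stack i hi]⟩

theorem XEq.stacked {W : ℕ} {σ τ : Mem} (h : XEq W σ τ) (hW : 100 ≤ W) : Stacked σ τ :=
  ⟨⟨fun x hx => h.ivar x (by omega), fun x _ => by rw [h.iarr], fun x _ => by rw [h.rvar],
    fun x hx => h.rarr x (by omega) (by omega)⟩, h.ivar 122 (by simp), fun i _ => by rw [h.iarr]⟩

theorem FillEq.stacked {W : ℕ} {σ τ : Mem} (h : FillEq W σ τ) (hW : 100 ≤ W) : Stacked σ τ :=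
  ⟨h.below le_rfl hW, h.ivar 122 (by simp), fun i _ => by rw [h.iarr]⟩

theorem Stacked.setI {σ τ : Mem} (h : Stacked σ τ) {x v : ℕ} (hx : 100 ≤ x) (hx' : x ≠ 122) :
    Stacked σ (τ.setI x v) :=
  ⟨h.below.setI hx, by simp [hx'.symm, h.depth], h.stack⟩

theorem Sized.xEq {k W : ℕ} {σ τ : Mem} (hs : Sized k σ) (h : XEq W σ τ) : Sized k τ := by
  constructor <;> rw [h.ivar _ (by simp)]
  exacts [hs.hk, hs.hkh, hs.hkr, hs.hm, hs.hr, hs.hn]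

theorem Sized.setI {k x v : ℕ} {σ : Mem} (hs : Sized k σ) (h : x = 121 ∨ x = 126 ∨ x = 127 ∨ x = 128) :
    Sized k (σ.setI x v) := by
  constructor <;> simp only [Mem.setI_ivar] <;> rw [if_neg (by omega)]
  exacts [hs.hk, hs.hkh, hs.hkr, hs.hm, hs.hr, hs.hn]

/-- The state at a transform of length `2 ^ l`. -/
structure NodeCtx (k l B : ℕ) (σ : Mem) : Prop where
  sized : Sized k σ
  hlen : σ.ivar 126 = 2 ^ l
  hlr : σ.ivar 127 = 2 ^ l * 2 ^ (k - k / 2)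
  hs : σ.ivar 128 * 2 ^ l = 2 * 2 ^ (k - k / 2)
  hS : σ.ivar 121 = B * (2 ^ l * 2 ^ (k - k / 2))

/-- Time per cell for the multiplication of blocks of length `2 ^ k`. -/
def mulRate (c k : ℕ) : ℕ :=
  if k ≤ 1 then c else c + 2 * ((k / 2 + 2) * c + mulRate c (k - k / 2))
termination_by k

/-- What the multiplication is required to do. -/
def MulSpec (ps : List Cmd) (c k : ℕ) : Prop :=
  ∀ (B : ℕ) (σ : Mem), 0 < B → σ.ivar 120 = k → σ.ivar 121 = B * 2 ^ k →
    Runs ps (.call 0) σ (mulRate c k * (B * 2 ^ k)) (fun τ => Stacked σ τ ∧ τ.ivar 120 = k ∧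
      τ.ivar 121 = B * 2 ^ k ∧ ∀ b < B, NegProd (2 ^ k) (shift (τ.rarr 102) (b * 2 ^ k))
        (shift (σ.rarr 100) (b * 2 ^ k)) (shift (σ.rarr 101) (b * 2 ^ k)))

/-- What the transform of length `2 ^ l` is required to do. -/
def NodeSpec (ps : List Cmd) (c k l : ℕ) : Prop :=
  ∀ (B : ℕ) (σ : Mem), 0 < B → NodeCtx k l B σ → k + 1 ≤ B * (2 ^ l * 2 ^ (k - k / 2)) →
    Runs ps (.call 1) σ (((l + 1) * c + mulRate c (k - k / 2)) * (B * (2 ^ l * 2 ^ (k - k / 2))))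
      (fun τ => Stacked σ τ ∧
      NodeCtx k l B τ ∧ ∀ b < B, CycProd (2 ^ (k - k / 2)) (2 ^ l)
        (shift (τ.rarr 102) (b * (2 ^ l * 2 ^ (k - k / 2))))
        (shift (σ.rarr 100) (b * (2 ^ l * 2 ^ (k - k / 2))))
        (shift (σ.rarr 101) (b * (2 ^ l * 2 ^ (k - k / 2)))))

theorem shift_shift (f : ℕ → ℝ) (a b : ℕ) : (fun i => shift f a (b + i)) = shift f (a + b) := by
  funext i
  simp [shift, add_assoc]

/-- At length one only products modulo `y ^ r + 1` remain. The recursive multiplication overwrites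
the sizes, so `k` is pushed on a stack and the sizes are recomputed on return. This takes time O(k),
which the total length covers by the assumption in `NodeSpec`. -/
theorem node_leaf {ps : List Cmd} (h1 : ps[1]? = some nodeBody) (c : ℕ) (hc : 400 ≤ c) (k : ℕ)
    (hmul : MulSpec ps c (k - k / 2)) : NodeSpec ps c k 0 := by
  intro B σ hB hσ hS
  have hSv := hσ.hS
  rw [pow_zero, one_mul] at hSv hS
  apply Runs.le
  case h =>
    apply Runs.call h1
    unfold nodeBody
    apply Runs.ite_pos (by simp [hσ.hlen])
    apply Runs.cons
    apply Runs.iput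
    apply Runs.set (v := σ.ivar 122 + 1) (by simp)
    apply Runs.set (v := k - k / 2) (by simp [hσ.sized.hkr])
    apply Runs.cons
    refine (hmul B _ hB (by simp) (by simp [hSv])).post ?_
    rintro τ ⟨hst, hk, hSτ, hprod⟩
    have hd : τ.ivar 122 = σ.ivar 122 + 1 := by simpa using hst.depth
    have hstack : ∀ i < σ.ivar 122 + 1, τ.iarr 100 i = if i = σ.ivar 122 then k else σ.iarr 100 i := by
      intro i hi
      have := hst.stack i (by simpa using hi)
      simp only [Mem.setI_iarr, Mem.putI_iarr, if_true, IExp.eval, Function.update_apply,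
        hσ.sized.hk] at this
      exact this
    apply Runs.set (v := σ.ivar 122) (by simp [hd])
    apply Runs.set (v := k) (by simp [hstack])
    apply Runs.cons
    refine (setup_runs k _ (by simp)).post ?_
    rintro υ ⟨hsz, ho, hiv⟩
    apply Runs.set (v := 1) rfl
    apply Runs.set (v := 2 ^ (k - k / 2)) (by simp [hsz.hr])
    apply Runs.set (v := 2 ^ (k - k / 2) + 2 ^ (k - k / 2)) (by simp [hsz.hr])
    apply Runs.nil
    have hiarr : υ.iarr = τ.iarr := ho.iarr
    have hrarr : υ.rarr = τ.rarr := ho.rarr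
    have hrvar : υ.rvar = τ.rvar := ho.rvar
    refine ⟨⟨⟨fun x hx => ?_, fun a ha => ?_, fun x hx => ?_, fun a ha => ?_⟩, ?_, ?_⟩, ⟨?_, ?_, ?_, ?_, ?_⟩, ?_⟩
    · simp only [Mem.setI_ivar]
      repeat rw [if_neg (by omega)]
      rw [hiv x (by omega)]
      simp only [Mem.setI_ivar]
      repeat rw [if_neg (by omega)]
      rw [hst.below.ivar x hx]
      simp only [Mem.setI_ivar]
      repeat rw [if_neg (by omega)]
      rfl
    · simp only [Mem.setI_iarr, hiarr, hst.below.iarr a ha, Mem.putI_iarr]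
      rw [if_neg (by omega)]
    · simp only [Mem.setI_rvar, hrvar, hst.below.rvar x hx, Mem.putI_rvar]
    · simp only [Mem.setI_rarr, hrarr, hst.below.rarr a ha, Mem.putI_rarr]
    · simp [hiv 122 (by simp)]
    · intro i hi
      simp only [Mem.setI_iarr, hiarr]
      rw [hstack i (by omega), if_neg (by omega)]
    · exact ((hsz.setI (by simp)).setI (by simp)).setI (by simp)
    · simp
    · simp
    · simp [two_mul]
    · simp [hiv 121 (by simp), hSτ]
    · intro b hb
      simp only [Mem.setI_rarr, hrarr, pow_zero, one_mul]
      exact CycProd.one (hprod b hb)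
  case hT =>
    simp only [IExp.cost, Test.cost]
    rw [pow_zero, one_mul]
    nlinarith

/-- The halves of `B` blocks are treated as a batch of `2 * B` blocks of half the length. There is
one recursive call on an unchanged total length, and each level adds a constant per cell. -/
theorem node_step {ps : List Cmd} (h1 : ps[1]? = some nodeBody) : ∃ c0, ∀ c, c0 ≤ c → ∀ k l : ℕ,
    NodeSpec ps c k l → NodeSpec ps c k (l + 1) := by
  obtain ⟨c1, hc1⟩ := fwdCmd_runs (ps := ps) 100 (by simp)
  obtain ⟨c2, hc2⟩ := fwdCmd_runs (ps := ps) 101 (by simp)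
  obtain ⟨c3, hc3⟩ := invCmd_runs (ps := ps)
  refine ⟨2 * c1 + 2 * c2 + 2 * c3 + 100, fun c hc k l ih B σ hB hσ hS => ?_⟩
  set r := 2 ^ (k - k / 2) with hr
  set h := 2 ^ l with hh
  have hr0 : 0 < r := by positivity
  have hh0 : 0 < h := by positivity
  set s := σ.ivar 128 with hs
  have hsr : s * h = r := by
    have := hσ.hs
    rw [pow_succ] at this
    change s * (h * 2) = 2 * r at this
    linarith
  have hlen : (2 : ℕ) ^ (l + 1) = 2 * h := by rw [pow_succ, hh]; ring
  have hSv : σ.ivar 121 = B * (2 * h * r) := by rw [hσ.hS, hlen]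
  have node0 : ∀ τ : Mem, (∀ x, x < 100 ∨ 106 ≤ x → τ.ivar x = σ.ivar x) → Node r h s B τ := by
    intro τ hτ
    constructor
    · rw [hτ _ (by simp), hσ.sized.hr]
    · rw [hτ _ (by simp), hσ.hlen, hlen]
    · rw [hτ _ (by simp), hσ.hlr, hlen, mul_assoc]
    · rw [hτ _ (by simp)]
    · rw [hτ _ (by simp), hSv]
  apply Runs.le
  case h =>
    apply Runs.call h1
    unfold nodeBody
    apply Runs.ite_neg (by simp [hσ.hlen, hlen]; omega)
    apply Runs.cons
    refine (hc1 r h s B σ hr0 hh0 hsr (node0 σ fun _ _ => rfl)).post ?_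
    rintro τ1 ⟨x1, f1⟩
    apply Runs.cons
    refine (hc2 r h s B τ1 hr0 hh0 hsr (node0 τ1 x1.ivar)).post ?_
    rintro τ2 ⟨x2, f2⟩
    have hiv2 : ∀ x, x < 100 ∨ 106 ≤ x → τ2.ivar x = σ.ivar x := fun x hx =>
      (x2.ivar x hx).trans (x1.ivar x hx)
    have n2 := node0 τ2 hiv2
    apply Runs.set (v := h) (by simp [n2.hlen])
    apply Runs.set (v := h * r) (by simp [n2.hlr])
    -- At half the length the root `t ^ s` is replaced by its square.
    apply Runs.set (v := s + s) (by simp [n2.hs])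
    set τ3 := ((τ2.setI 126 h).setI 127 (h * r)).setI 128 (s + s) with hτ3
    have hst3 : Stacked σ τ3 := ((((x1.stacked (by simp)).trans (x2.stacked (by simp))).setI
      (by simp) (by simp)).setI (by simp) (by simp)).setI (by simp) (by simp)
    apply Runs.cons
    refine (ih (2 * B) τ3 (by omega) ⟨?_, ?_, ?_, ?_, ?_⟩ ?_).post ?_
    · exact ((((hσ.sized.xEq x1).xEq x2).setI (by simp)).setI (by simp)).setI (by simp)
    · simp [hτ3, hh]
    · simp [hτ3, hh, hr]
    · simp only [hτ3, Mem.setI_ivar, if_true, ← hh, ← hr]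
      linarith
    · simp [hτ3, n2.hS, ← hh, ← hr]
      ring
    · rw [hlen] at hS
      refine hS.trans (le_of_eq ?_)
      rw [← hh, ← hr]
      ring
    rintro τ4 ⟨st4, n4, prod4⟩
    apply Runs.set (v := 2 * h) (by simp [n4.hlen, ← hh, two_mul])
    apply Runs.set (v := 2 * (h * r)) (by simp [n4.hlr, ← hh, ← hr, two_mul])
    have hs4 : τ4.ivar 128 = s + s := by
      have h4 := n4.hs
      rw [← hh, ← hr, ← hsr] at h4
      have : τ4.ivar 128 * h = (2 * s) * h := by linarith
      have := Nat.eq_of_mul_eq_mul_right hh0 this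
      omega
    apply Runs.set (v := s) (by simp [hs4]; omega)
    set τ5 := ((τ4.setI 126 (2 * h)).setI 127 (2 * (h * r))).setI 128 s with hτ5
    have sz5 : Sized k τ5 := ((n4.sized.setI (by simp)).setI (by simp)).setI (by simp)
    have st5 : Stacked σ τ5 := (((hst3.trans st4).setI (by simp) (by simp)).setI
      (by simp) (by simp)).setI (by simp) (by simp)
    have hS5 : τ5.ivar 121 = B * (2 * h * r) := by
      simp [hτ5, n4.hS, ← hh, ← hr]
      ring
    apply Runs.cons
    refine (hc3 r h s B τ5 hr0 hh0 hsr ⟨sz5.hr, ?_, ?_, ?_, hS5⟩).post ?_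
    · simp [hτ5]
    · simp [hτ5]
    · simp [hτ5]
    rintro τ6 ⟨x6, f6⟩
    apply Runs.nil
    refine ⟨st5.trans (x6.stacked (by simp)), ⟨sz5.xEq x6, ?_, ?_, ?_, ?_⟩, ?_⟩
    · rw [x6.ivar _ (by simp), hlen]; simp [hτ5]
    · rw [x6.ivar _ (by simp), hlen, ← hr]; simp [hτ5, mul_assoc]
    · rw [x6.ivar _ (by simp), hlen, ← hr]
      simp only [hτ5, Mem.setI_ivar, if_true]
      linarith
    · rw [x6.ivar _ (by simp), hlen, hS5]
    · intro b hb
      have e : (2 : ℕ) ^ (l + 1) * 2 ^ (k - k / 2) = 2 * h * r := by rw [hlen]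
      rw [e, hlen]
      have a100 : τ3.rarr 100 = τ1.rarr 100 := by
        simp only [hτ3, Mem.setI_rarr]
        exact x2.rarr 100 (by simp) (by simp)
      have a101 : τ3.rarr 101 = τ2.rarr 101 := rfl
      have a101' : τ1.rarr 101 = σ.rarr 101 := x1.rarr 101 (by simp) (by simp)
      refine CycProd.lift hh0 hsr (x' := shift (τ3.rarr 100) (b * (2 * h * r)))
        (y' := shift (τ3.rarr 101) (b * (2 * h * r))) (z' := shift (τ4.rarr 102) (b * (2 * h * r))) ?_ ?_ ?_ ?_ ?_
      · rw [a100]; exact f1 b hb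
      · rw [a101, ← a101']; exact f2 b hb
      · exact f6 b hb
      · have := prod4 (2 * b) (by omega)
        rw [show 2 * b * (2 ^ l * 2 ^ (k - k / 2)) = b * (2 * h * r) by rw [← hh, ← hr]; ring] at this
        exact this
      · have := prod4 (2 * b + 1) (by omega)
        rw [show (2 * b + 1) * (2 ^ l * 2 ^ (k - k / 2)) = b * (2 * h * r) + h * r by
          rw [← hh, ← hr]; ring] at this
        simp only [shift_shift]
        exact this
  case hT =>
    simp only [IExp.cost, Test.cost]
    rw [hlen, ← hr, ← hh, show 2 * B * (h * r) = B * (2 * h * r) by ring]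
    have hV : 1 ≤ B * (2 * h * r) := by
      have : 0 < B * (2 * h * r) := by positivity
      omega
    generalize B * (2 * h * r) = V at hV
    have h2 : c1 * (V + 1) + c2 * (V + 1) + c3 * (V + 1) + 100 ≤ c * V := by
      have := Nat.mul_le_mul_right V hc
      nlinarith
    have h3 : ((l + 1 + 1) * c + mulRate c (k - k / 2)) * V =
      c * V + ((l + 1) * c + mulRate c (k - k / 2)) * V := by ring
    omega

/-- Padding doubles the number of cells, whence the factor `2` in `mulRate`. The transform of length
`2 * m = 2 ^ (k / 2 + 1)` has `k / 2 + 1` rounds and a leaf. The O(k) steps of `setup` are paid for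
by `k + 1 ≤ 2 ^ k`. -/
theorem mul_step {ps : List Cmd} (h0 : ps[0]? = some mulBody) : ∃ c0, ∀ c, c0 ≤ c → ∀ k : ℕ, 1 ≤ k →
    (1 < k → NodeSpec ps c k (k / 2 + 1)) → MulSpec ps c k := by
  obtain ⟨c1, hc1⟩ := padCmd_runs (ps := ps) 100 (by simp)
  obtain ⟨c2, hc2⟩ := padCmd_runs (ps := ps) 101 (by simp)
  obtain ⟨c3, hc3⟩ := unpadCmd_runs (ps := ps)
  obtain ⟨c4, hc4⟩ := baseCmd_runs (ps := ps)
  refine ⟨3 * c1 + 3 * c2 + 2 * c3 + 2 * c4 + 200, fun c hc k hk ih B σ hB hσk hσS => ?_⟩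
  have hV0 : k + 1 ≤ 2 ^ k := Nat.lt_two_pow_self
  have hV1 : 2 ^ k ≤ B * 2 ^ k := Nat.le_mul_of_pos_left _ hB
  by_cases hk1 : k ≤ 1
  · obtain rfl : k = 1 := by omega
    rw [pow_one] at hσS ⊢
    apply Runs.le
    case h =>
      apply Runs.call h0
      unfold mulBody
      apply Runs.ite_pos (by simp [hσk])
      refine (hc4 B σ hσS).post ?_
      rintro τ ⟨h1, h2⟩
      exact ⟨h1.stacked (by simp), by rw [h1.ivar _ (by simp), hσk], by rw [h1.ivar _ (by simp), hσS], h2⟩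
    case hT =>
      rw [mulRate, if_pos le_rfl]
      simp only [IExp.cost, Test.cost]
      rw [pow_one] at hV1
      nlinarith
  set r := 2 ^ (k - k / 2) with hr
  set m := 2 ^ (k / 2) with hm
  have hN : 2 ^ k = r * m := by rw [hr, hm, ← pow_add]; congr 1; omega
  have hr0 : 0 < r := by positivity
  have hm0 : 0 < m := by positivity
  have hlen : 2 ^ (k / 2 + 1) = 2 * m := by rw [pow_succ, hm]; ring
  apply Runs.le
  case h =>
    apply Runs.call h0
    unfold mulBody
    apply Runs.ite_neg (by simp [hσk]; omega)
    apply Runs.cons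
    refine (setup_runs k σ hσk).post ?_
    rintro τ0 ⟨sz0, od0, iv0⟩
    have a0 : τ0.rarr = σ.rarr := od0.rarr
    have st0 : Stacked σ τ0 := by
      refine ⟨⟨fun x hx => iv0 x (by omega), fun a _ => ?_, fun x _ => ?_, fun a _ => by rw [a0]⟩,
        iv0 122 (by simp), fun i _ => ?_⟩
      · rw [show τ0.iarr = σ.iarr from od0.iarr]
      · rw [show τ0.rvar = σ.rvar from od0.rvar]
      · rw [show τ0.iarr = σ.iarr from od0.iarr]
    apply Runs.cons
    refine (hc1 k B τ0 sz0 (by rw [iv0 121 (by simp), hσS])).post ?_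
    rintro τ1 ⟨x1, f1⟩
    have sz1 := sz0.xEq x1
    have hS1 : τ1.ivar 121 = B * 2 ^ k := by rw [x1.ivar _ (by simp), iv0 121 (by simp), hσS]
    apply Runs.cons
    refine (hc2 k B τ1 sz1 hS1).post ?_
    rintro τ2 ⟨x2, f2⟩
    have sz2 := sz1.xEq x2
    have hS2 : τ2.ivar 121 = B * 2 ^ k := by rw [x2.ivar _ (by simp), hS1]
    have st2 := (st0.trans (x1.stacked (by simp))).trans (x2.stacked (by simp))
    apply Runs.set (v := 2 * (B * 2 ^ k)) (by simp [hS2, two_mul])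
    apply Runs.set (v := 2 * m) (by simp [sz2.hm, two_mul, hm])
    apply Runs.set (v := 2 * 2 ^ k) (by simp [sz2.hn, two_mul])
    apply Runs.set (v := 1 + (k - k / 2 - k / 2)) (by simp [sz2.hkh, sz2.hkr])
    set τ3 := (((τ2.setI 121 (2 * (B * 2 ^ k))).setI 126 (2 * m)).setI 127 (2 * 2 ^ k)).setI 128
      (1 + (k - k / 2 - k / 2)) with hτ3
    have st3 : Stacked σ τ3 := (((st2.setI (by simp) (by simp)).setI (by simp) (by simp)).setI
      (by simp) (by simp)).setI (by simp) (by simp)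
    apply Runs.cons
    refine (ih (by omega) B τ3 hB ⟨?_, ?_, ?_, ?_, ?_⟩ ?_).post ?_
    · exact (((sz2.setI (by simp)).setI (by simp)).setI (by simp)).setI (by simp)
    · simp [hτ3, hlen]
    · simp only [hτ3, Mem.setI_ivar]
      norm_num
      rw [hlen, ← hr, hN]
      ring
    · simp only [hτ3, Mem.setI_ivar, if_true, hlen, ← hr]
      -- The first root is `y ^ s` with `s = r / m`, which is `1` for even `k` and `2` for odd `k`.
      -- The program finds it without division.
      have : (1 + (k - k / 2 - k / 2)) * m = r := by
        rcases Nat.even_or_odd' k with ⟨j, rfl | rfl⟩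
        · rw [hm, hr, show 1 + (2 * j - 2 * j / 2 - 2 * j / 2) = 1 by omega, one_mul]
          congr 1; omega
        · rw [hm, hr, show 1 + (2 * j + 1 - (2 * j + 1) / 2 - (2 * j + 1) / 2) = 2 by omega, ← pow_succ']
          congr 1; omega
      linarith
    · simp only [hτ3, Mem.setI_ivar]
      norm_num
      rw [hlen, ← hr, hN]
      ring
    · rw [hlen, ← hr, mul_assoc, mul_comm m r, ← hN]
      nlinarith
    rintro τ4 ⟨st4, n4, prod4⟩
    have e4 : 2 ^ (k / 2 + 1) * 2 ^ (k - k / 2) = 2 * 2 ^ k := by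
      rw [hlen, ← hr, hN]; ring
    apply Runs.set (v := B * 2 ^ k) (by
      simp only [IExp.eval, n4.hS, e4]
      rw [show B * (2 * 2 ^ k) = 2 * (B * 2 ^ k) by ring]
      omega)
    apply Runs.cons
    refine (hc3 k B _ (n4.sized.setI (by simp)) (by simp)).post ?_
    rintro τ5 ⟨x5, f5⟩
    apply Runs.nil
    refine ⟨((st3.trans st4).setI (by simp) (by simp)).trans (x5.stacked (by simp)), ?_, ?_, ?_⟩
    · rw [x5.ivar _ (by simp)]; simp [n4.sized.hk]
    · rw [x5.ivar _ (by simp)]; simp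
    · intro b hb
      have b100 : τ3.rarr 100 = τ1.rarr 100 := by
        simp only [hτ3, Mem.setI_rarr]
        exact x2.rarr 100 (by simp) (by simp)
      have b101 : τ1.rarr 101 = τ0.rarr 101 := x1.rarr 101 (by simp) (by simp)
      have hp := prod4 b hb
      rw [e4, hlen, b100] at hp
      have g2 := f2 b hb
      rw [b101, a0] at g2
      have g1 := f1 b hb
      rw [a0] at g1
      have := NegProd.of_cycProd hr0 hm0 g1 g2 (f5 b hb) hp
      rwa [← hN] at this
  case hT =>
    rw [show mulRate c k = c + 2 * ((k / 2 + 2) * c + mulRate c (k - k / 2)) by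
      rw [mulRate, if_neg hk1]]
    simp only [IExp.cost, Test.cost]
    rw [hlen, ← hr, show B * (2 * m * r) = 2 * (B * 2 ^ k) by rw [hN]; ring]
    have hV : k + 1 ≤ B * 2 ^ k := hV0.trans hV1
    generalize B * 2 ^ k = V at hV
    have h2 : c1 * (2 * V + 1) + c2 * (2 * V + 1) + c3 * (V + 1) + 100 * (k + 1) + 100 ≤ c * V := by
      have := Nat.mul_le_mul_right V hc
      nlinarith
    have h3 : (c + 2 * ((k / 2 + 2) * c + mulRate c (k - k / 2))) * V =
      c * V + ((k / 2 + 1 + 1) * c + mulRate c (k - k / 2)) * (2 * V) := by ring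
    omega

/-- The two procedures are mutually recursive: an outer strong induction on the exponent supplies
the leaves of an inner induction on the length of the transform. -/
theorem mul_spec {ps : List Cmd} (h0 : ps[0]? = some mulBody) (h1 : ps[1]? = some nodeBody) :
    ∃ c, ∀ k, 1 ≤ k → MulSpec ps c k := by
  obtain ⟨c0, hc0⟩ := mul_step h0
  obtain ⟨c1, hc1⟩ := node_step h1
  refine ⟨c0 + c1 + 400, fun k => ?_⟩
  induction k using Nat.strong_induction_on with
  | _ k ih =>
    intro hk
    refine hc0 _ (by omega) k hk fun hk1 => ?_
    have : ∀ l, NodeSpec ps (c0 + c1 + 400) k l := by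
      intro l
      induction l with
      | zero => exact node_leaf h1 _ (by omega) k (ih (k - k / 2) (by omega) (by omega))
      | succ l hl => exact hc1 _ (by omega) k l hl
    exact this _

/-- In terms of `j = k - 1` the recursion `k ↦ k - k / 2` becomes `j ↦ j / 2`, so the recurrence has
the form `T(j) ≤ 2 T(j / 2) + c j + 6 c`. The summand `6 * c` on the left absorbs the constant, as
`6 c = 2 * 6 c - 6 c`, and each halving contributes one unit of the logarithm. -/
theorem mulRate_succ_le (c j : ℕ) (hj : 1 ≤ j) :
    mulRate c (j + 1) + 6 * c ≤ c * (j * (Nat.log 2 j + 15)) := by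
  induction j using Nat.strong_induction_on with
  | _ j ih =>
    have h1 : mulRate c (j + 1) = c + 2 * (((j + 1) / 2 + 2) * c + mulRate c (j / 2 + 1)) := by
      rw [mulRate, if_neg (by omega)]
      congr 4
      omega
    rcases Nat.lt_or_ge j 2 with h2 | h2
    · obtain rfl : j = 1 := by omega
      rw [h1, mulRate, if_pos (by norm_num)]
      norm_num
      omega
    · have h3 := ih (j / 2) (by omega) (by omega)
      have h4 : Nat.log 2 j = Nat.log 2 (j / 2) + 1 := Nat.log_of_one_lt_of_le (by norm_num) h2
      rw [h1, h4]
      set w := Nat.log 2 (j / 2)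
      have h5 : c * (2 * ((j + 1) / 2)) ≤ c * (j + 1) := Nat.mul_le_mul_left _ (by omega)
      have h6 : c * ((2 * (j / 2)) * (w + 15)) ≤ c * (j * (w + 15)) :=
        Nat.mul_le_mul_left _ (Nat.mul_le_mul_right _ (by omega))
      nlinarith

theorem mulRate_le (c k : ℕ) (hk : 1 ≤ k) : mulRate c k ≤ 15 * c * (k * (Nat.log 2 k + 1)) := by
  rcases Nat.lt_or_ge k 2 with h | h
  · obtain rfl : k = 1 := by omega
    rw [mulRate, if_pos le_rfl]
    simp
    omega
  · obtain ⟨j, rfl⟩ : ∃ j, k = j + 1 := ⟨k - 1, by omega⟩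
    have h1 := mulRate_succ_le c j (by omega)
    have h2 : Nat.log 2 j ≤ Nat.log 2 (j + 1) := Nat.log_mono_right (by omega)
    have h3 : j * (Nat.log 2 j + 15) ≤ 15 * ((j + 1) * (Nat.log 2 (j + 1) + 1)) := by
      nlinarith
    have := Nat.mul_le_mul_left c h3
    nlinarith

/-! ### Products of blocks -/

/-- Multiplication of blocks of length at most `2 ^ K` takes time `R` per cell. -/
def MulBound (ps : List Cmd) (K R : ℕ) : Prop :=
  1 ≤ R ∧ ∀ k, 1 ≤ k → k ≤ K → ∀ (B : ℕ) (σ : Mem), 0 < B → σ.ivar 120 = k → σ.ivar 121 = B * 2 ^ k →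
    Runs ps (.call 0) σ (R * (B * 2 ^ k)) (fun τ => Below 100 σ τ ∧
      ∀ b < B, NegProd (2 ^ k) (shift (τ.rarr 102) (b * 2 ^ k))
        (shift (σ.rarr 100) (b * 2 ^ k)) (shift (σ.rarr 101) (b * 2 ^ k)))

theorem exists_mulBound {ps : List Cmd} (h0 : ps[0]? = some mulBody) (h1 : ps[1]? = some nodeBody) :
    ∃ c, ∀ K, 1 ≤ K → MulBound ps K (c * (K * (Nat.log 2 K + 1))) := by
  obtain ⟨c, hc⟩ := mul_spec h0 h1
  refine ⟨15 * c + 1, fun K hK => ⟨Nat.mul_pos (by omega) (Nat.mul_pos hK (by omega)),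
    fun k hk hkK B σ hB h2 h3 => ?_⟩⟩
  refine (hc k hk B σ hB h2 h3).mono (Nat.mul_le_mul_right _ ?_) fun τ hτ => ⟨hτ.1.below, hτ.2.2.2⟩
  refine (mulRate_le c k hk).trans (Nat.mul_le_mul (by omega) (Nat.mul_le_mul hkK ?_))
  have := Nat.log_mono_right (b := 2) hkK
  omega

theorem poly_mul_coeff_eq_zero {a b i : ℕ} (x y : ℕ → ℝ) (h : a + b ≤ i + 1) :
    (poly a x * poly b y).coeff i = 0 := by
  rw [coeff_mul, Finset.sum_eq_zero]
  rintro ⟨u, v⟩ huv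
  rw [Finset.HasAntidiagonal.mem_antidiagonal] at huv
  simp only at huv ⊢
  rw [poly_coeff, poly_coeff]
  by_cases ha : u < a
  · rw [if_neg (show ¬ v < b by omega), mul_zero]
  · rw [if_neg ha, zero_mul]

theorem poly_pad {n m : ℕ} (hnm : n ≤ m) {x y : ℕ → ℝ} (h : ∀ i < m, x i = if i < n then y i else 0) :
    poly m x = poly n y := by
  ext i
  rw [poly_coeff, poly_coeff]
  by_cases hi : i < m
  · rw [if_pos hi, h i hi]
  · rw [if_neg hi, if_neg (by omega)]

/-- Copy every second block of length `b` of `src`, from the cell `off` on, and pad by zeros. -/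
def padTo (dst src : ℕ) (off len b : IExp) : Cmd :=
  fill ⟨len, b, .const 2, .const 0, .const 0, .const 0⟩ dst (.const 0)
    (.ite (.ile (.var 102) (.const 0)) (.leaf (.get src (.add off (.var 100)))) (.leaf (.const 0)))

theorem padTo_runs {ps : List Cmd} (dst src : ℕ) (hd : 100 ≤ dst) (hs : src < 100) (off len b : IExp) :
    ∃ c, ∀ (o B G : ℕ) (σ : Mem), 0 < B → (∀ τ, Below 100 σ τ → off.eval τ = o ∧
      len.eval τ = G * (2 * B) ∧ b.eval τ = B) →
    Runs ps (padTo dst src off len b) σ (c * (G * (2 * B) + 1)) (fun τ => FillEq dst σ τ ∧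
      ∀ g < G, poly (2 * B) (shift (τ.rarr dst) (g * (2 * B))) =
        poly B (shift (σ.rarr src) (o + g * (2 * B)))) := by
  refine ⟨fillCost ⟨len, b, .const 2, .const 0, .const 0, .const 0⟩ (.const 0)
    (.ite (.ile (.var 102) (.const 0)) (.leaf (.get src (.add off (.var 100)))) (.leaf (.const 0))),
    fun o B G σ hB hv => ?_⟩
  refine (fill_runs ⟨len, b, .const 2, .const 0, .const 0, .const 0⟩ dst (.const 0)
    (.ite (.ile (.var 102) (.const 0)) (.leaf (.get src (.add off (.var 100)))) (.leaf (.const 0))) σ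
    ⟨G * (2 * B), B, 2, 0, 0, 0⟩ 0 (fun p => if p / B % 2 = 0 then σ.rarr src (o + p) else 0)
    hB (by simp) ?_ ?_).post ?_
  · intro τ hτ
    obtain ⟨h1, h2, h3⟩ := hv τ (hτ.below le_rfl hd)
    exact ⟨⟨h2, h3, rfl, rfl, rfl, rfl⟩, rfl⟩
  · intro p hp τ hτ hdg _
    obtain ⟨h1, h2, h3⟩ := hv τ (hτ.below le_rfl hd)
    simp [GExp.eval, hdg.i, hdg.pos, h1, hτ.rarr src (by omega)]
  · rintro τ ⟨h1, h2⟩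
    refine ⟨h1, fun g hg => poly_pad (by omega) fun i hi => ?_⟩
    have hlt : g * (2 * B) + i < G * (2 * B) := by
      have := Nat.mul_le_mul_right (2 * B) (show g + 1 ≤ G from hg)
      rw [Nat.succ_mul] at this
      omega
    rw [shift, h2, fillFun_zero hlt]
    have e : (g * (2 * B) + i) / B % 2 = i / B := by
      rw [show g * (2 * B) + i = B * (g * 2) + i by ring, Nat.mul_add_div hB,
        Nat.mul_add_mod_self_right]
      exact Nat.mod_eq_of_lt (by rw [Nat.div_lt_iff_lt_mul hB]; exact hi)
    rw [e]
    by_cases hiB : i < B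
    · rw [if_pos (Nat.div_eq_of_lt hiB), if_pos hiB, shift, add_assoc]
    · rw [if_neg (by rw [Nat.div_eq_zero_iff]; omega), if_neg hiB]

/-- Products of blocks of length `b = 2 ^ e`. -/
def prodCmd (A B : ℕ) (oA oB len b e : IExp) : Cmd := block [
  padTo 100 A oA len b, padTo 101 B oB len b,
  .iset 120 (.add e (.const 1)), .iset 121 len, .call 0]

/-- Factors of half the length have a product of degree less than `2 * n`, so nothing wraps around.
-/
theorem NegProd.poly_eq {n : ℕ} (hn : 0 < n) {x y z u v : ℕ → ℝ} (h : NegProd (2 * n) z x y)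
    (hx : poly (2 * n) x = poly n u) (hy : poly (2 * n) y = poly n v) :
    poly (2 * n) z = poly n u * poly n v := by
  ext i
  rw [poly_coeff]
  by_cases hi : i < 2 * n
  · rw [if_pos hi, h.coeff (by omega) i hi, hx, hy,
      poly_mul_coeff_eq_zero (i := 2 * n + i) _ _ (by omega), sub_zero]
  · rw [if_neg hi, poly_mul_coeff_eq_zero _ _ (by omega)]

/-- Each array contributes every second block. When the two offsets differ by one block length,
neighbouring blocks are multiplied, which is one step up in a binary tree. -/
theorem prodCmd_runs {ps : List Cmd} (A B : ℕ) (hA : A < 100) (hB : B < 100)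
    (oA oB len b e : IExp) : ∃ c, ∀ (K R : ℕ), MulBound ps K R → ∀ (oa ob k G : ℕ) (σ : Mem), 0 < G →
      k + 1 ≤ K → (∀ τ, Below 100 σ τ → oA.eval τ = oa ∧ oB.eval τ = ob ∧
        len.eval τ = G * (2 * 2 ^ k) ∧ b.eval τ = 2 ^ k ∧ e.eval τ = k) →
    Runs ps (prodCmd A B oA oB len b e) σ (c * (R * (G * (2 * 2 ^ k)))) (fun τ => Below 100 σ τ ∧
      ∀ g < G, poly (2 * 2 ^ k) (shift (τ.rarr 102) (g * (2 * 2 ^ k))) =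
        poly (2 ^ k) (shift (σ.rarr A) (oa + g * (2 * 2 ^ k))) *
        poly (2 ^ k) (shift (σ.rarr B) (ob + g * (2 * 2 ^ k)))) := by
  obtain ⟨c1, hc1⟩ := padTo_runs (ps := ps) 100 A le_rfl hA oA len b
  obtain ⟨c2, hc2⟩ := padTo_runs (ps := ps) 101 B (by simp) hB oB len b
  refine ⟨2 * c1 + 2 * c2 + e.cost + len.cost + 20, fun K R hR oa ob k G σ hG hk hv => ?_⟩
  have hk0 : 0 < 2 ^ k := by positivity
  apply Runs.le
  case h =>
    unfold prodCmd
    apply Runs.cons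
    refine (hc1 oa (2 ^ k) G σ hk0 fun τ hτ => ?_).post ?_
    · exact ⟨(hv τ hτ).1, (hv τ hτ).2.2.1, (hv τ hτ).2.2.2.1⟩
    rintro τ1 ⟨f1, p1⟩
    have b1 := f1.below le_rfl le_rfl
    apply Runs.cons
    refine (hc2 ob (2 ^ k) G τ1 hk0 fun τ hτ => ?_).post ?_
    · have := hv τ (b1.trans hτ)
      exact ⟨this.2.1, this.2.2.1, this.2.2.2.1⟩
    rintro τ2 ⟨f2, p2⟩
    have b2 := b1.trans (f2.below le_rfl (by simp))
    have b3 : Below 100 σ (τ2.setI 120 (k + 1)) := b2.setI (by simp)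
    apply Runs.set (v := k + 1) (by simp [(hv τ2 b2).2.2.2.2])
    apply Runs.set (v := G * 2 ^ (k + 1)) (by rw [(hv _ b3).2.2.1, pow_succ]; ring)
    apply Runs.cons
    refine (hR.2 (k + 1) (by omega) hk G _ hG (by simp) (by simp)).post ?_
    rintro τ3 ⟨b4, p3⟩
    refine Runs.nil ⟨(b3.setI (by simp)).trans b4, fun g hg => ?_⟩
    have e1 : 2 ^ (k + 1) = 2 * 2 ^ k := by rw [pow_succ]; ring
    rw [e1] at p3
    have h2 := p2 g hg
    rw [b1.rarr B hB] at h2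
    have h1 := p1 g hg
    rw [← f2.rarr 100 (by simp)] at h1
    exact (p3 g hg).poly_eq hk0 h1 h2
  case hT =>
    have e1 : G * 2 ^ (k + 1) = G * (2 * 2 ^ k) := by rw [pow_succ]; ring
    rw [e1]
    simp only [IExp.cost]
    have hV : 1 ≤ G * (2 * 2 ^ k) := by
      have : 0 < G * (2 * 2 ^ k) := by positivity
      omega
    generalize G * (2 * 2 ^ k) = V at hV
    have hRV : V ≤ R * V := Nat.le_mul_of_pos_left _ hR.1
    have h1 := Nat.mul_le_mul_left (2 * c1 + 2 * c2) hRV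
    have h2 : e.cost + len.cost ≤ (e.cost + len.cost) * (R * V) :=
      Nat.le_mul_of_pos_right _ (by omega)
    nlinarith

/-! ### Evaluation of a polynomial at many points: algebra -/

theorem X_pow_dvd_sub_poly (n : ℕ) (P : ℝ[X]) {f : ℕ → ℝ} (h : ∀ i < n, f i = P.coeff i) :
    X ^ n ∣ P - poly n f := by
  rw [X_pow_dvd_iff]
  intro d hd
  rw [coeff_sub, poly_coeff, if_pos hd, h d hd, sub_self]

/-- One step of Newton's iteration for the inverse of a power series. -/
theorem newton_step {M G U G' : ℝ[X]} {e n : ℕ} (h : X ^ e ∣ 1 - M * G) (hU : X ^ n ∣ 2 - M * G - U)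
    (hG : X ^ n ∣ U * G - G') : X ^ (min (2 * e) n) ∣ 1 - M * G' := by
  have h1 : X ^ (min (2 * e) n) ∣ (1 - M * G) * (1 - M * G) := by
    refine (pow_dvd_pow X (min_le_left _ _)).trans ?_
    rw [two_mul, pow_add]
    exact mul_dvd_mul h h
  have h2 := (pow_dvd_pow X (min_le_right (2 * e) n)).trans hU
  have h3 := (pow_dvd_pow X (min_le_right (2 * e) n)).trans hG
  have e1 : 1 - M * G' = (1 - M * G) * (1 - M * G) + (2 - M * G - U) * (M * G) + (U * G - G') * M := by
    ring
  rw [e1]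
  exact dvd_add (dvd_add h1 (dvd_mul_of_dvd_left h2 _)) (dvd_mul_of_dvd_left h3 _)

/-- The quotient of two polynomials as a power series. -/
noncomputable def quot (A M : ℝ[X]) : PowerSeries ℝ := (A : PowerSeries ℝ) * (M : PowerSeries ℝ)⁻¹

theorem coe_inv {M : ℝ[X]} (h : M.coeff 0 = 1) :
    (M : PowerSeries ℝ) * (M : PowerSeries ℝ)⁻¹ = 1 := by
  apply PowerSeries.mul_inv_cancel
  rw [← PowerSeries.coeff_zero_eq_constantCoeff_apply, coeff_coe, h]
  exact one_ne_zero

/-- Truncating the denominator and inverting it modulo `X ^ n` does not affect the first `n`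
coefficients of the quotient. -/
theorem quot_coeff {A M M' G : ℝ[X]} {n : ℕ} (hM0 : M.coeff 0 = 1) (hM : X ^ n ∣ M - M')
    (hG : X ^ n ∣ 1 - M' * G) (i : ℕ) (hi : i < n) :
    (A * G).coeff i = PowerSeries.coeff i (quot A M) := by
  have h1 : X ^ n ∣ 1 - M * G := by
    have : 1 - M * G = (1 - M' * G) - (M - M') * G := by ring
    rw [this]
    exact dvd_sub hG (dvd_mul_of_dvd_left hM _)
  obtain ⟨q, hq⟩ := h1
  have h2 : ((A * G : ℝ[X]) : PowerSeries ℝ) - quot A M =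
      (PowerSeries.X) ^ n * (-(q : PowerSeries ℝ) * quot A M) := by
    have h3 := congrArg (fun p : ℝ[X] => (p : PowerSeries ℝ)) hq
    simp only [coe_sub, coe_one, coe_mul, coe_pow, coe_X] at h3
    rw [quot, coe_mul]
    linear_combination (-(A : PowerSeries ℝ) * (M : PowerSeries ℝ)⁻¹) * h3 -
      ((A : PowerSeries ℝ) * G) * coe_inv hM0
  have h4 : PowerSeries.coeff i (((A * G : ℝ[X]) : PowerSeries ℝ) - quot A M) = 0 :=
    (PowerSeries.X_pow_dvd_iff.1 ⟨_, h2⟩) i hi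
  rw [map_sub, coeff_coe] at h4
  linarith

/-- The descent in the product tree: multiplying the quotient at a node by one child gives the
quotient at the other child, so one division at the root is enough. -/
theorem quot_mul {A M N : ℝ[X]} (hN : N.coeff 0 = 1) :
    quot A (M * N) * (N : PowerSeries ℝ) = quot A M := by
  have := coe_inv hN
  rw [quot, coe_mul, PowerSeries.mul_inv_rev, quot]
  linear_combination ((A : PowerSeries ℝ) * (M : PowerSeries ℝ)⁻¹) * this

/-- The upper half of a product modulo `X ^ (2 * h) + 1` with a polynomial of degree at most `h`. -/
theorem NegProd.middle {h L : ℕ} (hh : 0 < h) (hL : 2 * h ≤ L) {x y z : ℕ → ℝ} (hz : NegProd (2 * h) z x y)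
    (Q : PowerSeries ℝ) (hx : ∀ j < 2 * h, x j = PowerSeries.coeff (L - 2 * h + j) Q)
    (hy : (poly (2 * h) y).natDegree ≤ h) (i : ℕ) (hi : i < h) :
    z (h + i) = PowerSeries.coeff (L - h + i) (Q * ((poly (2 * h) y : ℝ[X]) : PowerSeries ℝ)) := by
  set P := poly (2 * h) y with hP
  have hP0 : ∀ v, h < v → P.coeff v = 0 := fun v hv => coeff_eq_zero_of_natDegree_lt (by omega)
  rw [hz.coeff (by omega) (h + i) (by omega)]
  -- The coefficient that would wrap around vanishes because `P` has degree at most `h`. For the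
  -- same reason the wanted coefficient involves only the window of `2 * h` coefficients of `Q`
  -- given by `x`.
  have h1 : (poly (2 * h) x * P).coeff (2 * h + (h + i)) = 0 := by
    rw [coeff_mul, Finset.sum_eq_zero]
    rintro ⟨u, v⟩ huv
    rw [Finset.HasAntidiagonal.mem_antidiagonal] at huv
    simp only at huv ⊢
    by_cases hv : h < v
    · rw [hP0 v hv, mul_zero]
    · rw [poly_coeff, if_neg (by omega), zero_mul]
  rw [h1, sub_zero, mul_comm, mul_comm Q, coeff_mul, PowerSeries.coeff_mul,
    Finset.Nat.sum_antidiagonal_eq_sum_range_succ (fun u v => P.coeff u * (poly (2 * h) x).coeff v),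
    Finset.Nat.sum_antidiagonal_eq_sum_range_succ
      (fun u v => PowerSeries.coeff u (P : PowerSeries ℝ) * PowerSeries.coeff v Q)]
  have hsub : ∀ (n : ℕ) (f : ℕ → ℝ), h ≤ n → (∀ v, h < v → f v = 0) →
      ∑ v ∈ Finset.range n.succ, f v = ∑ v ∈ Finset.range (h + 1), f v := by
    intro n f hn hf
    symm
    refine Finset.sum_subset (Finset.range_mono (by omega)) fun v _ hv => hf v ?_
    rw [Finset.mem_range] at hv
    omega
  rw [hsub (h + i) _ (by omega) fun v hv => by rw [hP0 v hv, zero_mul],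
    hsub (L - h + i) _ (by omega) fun v hv => by rw [coeff_coe, hP0 v hv, zero_mul]]
  refine Finset.sum_congr rfl fun v hv => ?_
  rw [Finset.mem_range] at hv
  rw [coeff_coe, poly_coeff (2 * h) x, if_pos (by omega), hx _ (by omega)]
  congr 3
  omega

/-- The value of a polynomial as a coefficient of a power series. -/
theorem coeff_quot_linear (n : ℕ) (a : ℕ → ℝ) (u : ℝ) :
    PowerSeries.coeff n (quot (poly (n + 1) fun i => a (n - i)) (1 - C u * X)) =
      ∑ i ∈ Finset.range (n + 1), a i * u ^ i := by
  -- The geometric series; convolving it with the reversed coefficients sums `a i * u ^ i`.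
  have h1 : ((1 - C u * X : ℝ[X]) : PowerSeries ℝ)⁻¹ = PowerSeries.mk fun i => u ^ i := by
    have h0 : (1 - C u * X : ℝ[X]).coeff 0 = 1 := by simp
    have h2 : ((1 - C u * X : ℝ[X]) : PowerSeries ℝ) * PowerSeries.mk (fun i => u ^ i) = 1 := by
      rw [mul_comm]
      have := PowerSeries.mk_one_mul_one_sub_eq_one ℝ
      ext i
      rw [coe_sub, coe_one, coe_mul, coe_C, coe_X, mul_sub, mul_one]
      cases i with
      | zero => simp
      | succ i =>
        rw [map_sub, mul_comm (PowerSeries.C u), ← mul_assoc, PowerSeries.coeff_mul_C,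
          PowerSeries.coeff_succ_mul_X]
        simp [pow_succ]
    have h3 := coe_inv h0
    calc ((1 - C u * X : ℝ[X]) : PowerSeries ℝ)⁻¹ = ((1 - C u * X : ℝ[X]) : PowerSeries ℝ)⁻¹ *
          (((1 - C u * X : ℝ[X]) : PowerSeries ℝ) * PowerSeries.mk (fun i => u ^ i)) := by rw [h2, mul_one]
      _ = (((1 - C u * X : ℝ[X]) : PowerSeries ℝ) * ((1 - C u * X : ℝ[X]) : PowerSeries ℝ)⁻¹) *
          PowerSeries.mk (fun i => u ^ i) := by ring
      _ = _ := by rw [h3, one_mul]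
  rw [quot, h1, PowerSeries.coeff_mul, Finset.Nat.sum_antidiagonal_eq_sum_range_succ
    (fun v w => PowerSeries.coeff v ((poly (n + 1) fun i => a (n - i) : ℝ[X]) : PowerSeries ℝ) *
      PowerSeries.coeff w (PowerSeries.mk fun i => u ^ i)), ← Finset.sum_range_reflect]
  refine Finset.sum_congr rfl fun i hi => ?_
  rw [Finset.mem_range] at hi
  rw [coeff_coe, poly_coeff, if_pos (by omega), PowerSeries.coeff_mk]
  congr 2 <;> omega

/-! ### Evaluation of a polynomial at many points: the procedure -/

theorem shift_zero (f : ℕ → ℝ) : shift f 0 = f := by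
  funext i
  simp [shift]

theorem flat_runs {ps : List Cmd} (len : IExp) (W : ℕ) (off : IExp) (e : GExp) (σ : Mem) (o n : ℕ)
    (F : ℕ → ℝ) (hv : ∀ τ, FillEq W σ τ → len.eval τ = n ∧ off.eval τ = o)
    (hF : ∀ p < n, ∀ τ, FillEq W σ τ → τ.ivar 100 = p → e.eval τ = F p) :
    Runs ps (fill (flat len) W off e) σ (fillCost (flat len) off e * (n + 1))
      (fun τ => FillEq W σ τ ∧ τ.rarr W = fillFun (σ.rarr W) o n F) :=
  fill_runs (flat len) W off e σ ⟨n, 1, 1, 0, 0, 0⟩ o F one_pos one_pos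
    (fun τ hτ => ⟨⟨(hv τ hτ).1, rfl, rfl, rfl, rfl, rfl⟩, (hv τ hτ).2⟩)
    fun p hp τ h1 h2 _ => hF p hp τ h1 h2.pos

/-- One step of Newton's iteration. -/
def newtonBody : Cmd := block [
  prodCmd 55 58 (.var 52) (.const 0) (.var 53) (.var 4) (.var 3),
  fill (flat (.var 4)) 59 (.const 0) (.ite (.ile (.var 100) (.const 0))
    (.leaf (.sub (.const 2) (.get 102 (.var 100)))) (.leaf (.sub (.const 0) (.get 102 (.var 100))))),
  prodCmd 59 58 (.const 0) (.const 0) (.var 53) (.var 4) (.var 3),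
  fill (flat (.var 4)) 58 (.const 0) (.leaf (.get 102 (.var 100))),
  .iset 54 (.add (.var 54) (.const 1))]

/-- The top level of the evaluation: division of power series. -/
def evalTop : Cmd := block [
  fill (flat (.var 4)) 58 (.const 0)
    (.ite (.ile (.var 100) (.const 0)) (.leaf (.const 1)) (.leaf (.const 0))),
  .iset 54 (.const 0),
  .loop (.ilt (.var 54) (.var 3)) newtonBody,
  fill (flat (.var 4)) 59 (.const 0) (.leaf (.get 6 (.sub (.sub (.var 4) (.const 1)) (.var 100)))),
  prodCmd 59 58 (.const 0) (.const 0) (.var 53) (.var 4) (.var 3),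
  fill (flat (.var 4)) 57 (.const 0) (.leaf (.get 102 (.var 100)))]

/-- The two memories agree for the input of the evaluation. -/
structure EvalEq (σ τ : Mem) : Prop where
  below : Below 50 σ τ
  tree : τ.rarr 55 = σ.rarr 55
  ivar : ∀ x, 50 ≤ x → x < 54 → τ.ivar x = σ.ivar x

theorem EvalEq.trans {σ τ υ : Mem} (h : EvalEq σ τ) (h' : EvalEq τ υ) : EvalEq σ υ :=
  ⟨h.below.trans h'.below, h'.tree.trans h.tree, fun x h1 h2 => (h'.ivar x h1 h2).trans (h.ivar x h1 h2)⟩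

theorem Below.evalEq {σ τ : Mem} (h : Below 100 σ τ) : EvalEq σ τ :=
  ⟨h.anti (by simp), h.rarr 55 (by simp), fun x _ h2 => h.ivar x (by omega)⟩

theorem FillEq.evalEq {W : ℕ} {σ τ : Mem} (h : FillEq W σ τ) (hW : 55 < W) : EvalEq σ τ :=
  ⟨h.below (by simp) (by omega), h.rarr 55 (by omega), fun x _ h2 => h.ivar x (by omega)⟩

theorem EvalEq.setI {σ τ : Mem} (h : EvalEq σ τ) {x v : ℕ} (hx : 54 ≤ x) : EvalEq σ (τ.setI x v) :=
  ⟨h.below.setI (by omega), h.tree, fun y _ h2 => by simp [show y ≠ x by omega, h.ivar y ‹_› h2]⟩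

/-- The parameters at level `t` of the evaluation at `2 ^ l` points. -/
structure EvalCtx (l t : ℕ) (σ : Mem) : Prop where
  hl : σ.ivar 3 = l
  hL : σ.ivar 4 = 2 ^ l
  ht : σ.ivar 50 = t
  hb : σ.ivar 51 = 2 ^ (t + 1)
  ho : σ.ivar 52 = t * 2 ^ (l + 1)
  hS : σ.ivar 53 = 2 * 2 ^ l

theorem EvalCtx.evalEq {l t : ℕ} {σ τ : Mem} (h : EvalCtx l t σ) (e : EvalEq σ τ) : EvalCtx l t τ :=
  ⟨(e.below.ivar 3 (by simp)).trans h.hl, (e.below.ivar 4 (by simp)).trans h.hL,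
    (e.ivar 50 (by simp) (by simp)).trans h.ht, (e.ivar 51 (by simp) (by simp)).trans h.hb,
    (e.ivar 52 (by simp) (by simp)).trans h.ho, (e.ivar 53 (by simp) (by simp)).trans h.hS⟩

theorem newtonBody_runs {ps : List Cmd} : ∃ c, ∀ (K R : ℕ), MulBound ps K R → ∀ (l t e : ℕ) (σ : Mem),
    EvalCtx l t σ → l + 1 ≤ K →
    X ^ e ∣ 1 - poly (2 ^ l) (shift (σ.rarr 55) (t * 2 ^ (l + 1))) * poly (2 ^ l) (σ.rarr 58) →
    Runs ps newtonBody σ (c * (R * 2 ^ l)) (fun τ => EvalEq σ τ ∧ τ.ivar 54 = σ.ivar 54 + 1 ∧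
      X ^ (min (2 * e) (2 ^ l)) ∣
        1 - poly (2 ^ l) (shift (σ.rarr 55) (t * 2 ^ (l + 1))) * poly (2 ^ l) (τ.rarr 58)) := by
  obtain ⟨c1, hc1⟩ := prodCmd_runs (ps := ps) 55 58 (by simp) (by simp) (.var 52) (.const 0) (.var 53)
    (.var 4) (.var 3)
  obtain ⟨c2, hc2⟩ := prodCmd_runs (ps := ps) 59 58 (by simp) (by simp) (.const 0) (.const 0) (.var 53)
    (.var 4) (.var 3)
  refine ⟨2 * c1 + 2 * c2 + 2 * fillCost (flat (.var 4)) (.const 0) (.ite (.ile (.var 100) (.const 0))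
    (.leaf (.sub (.const 2) (.get 102 (.var 100)))) (.leaf (.sub (.const 0) (.get 102 (.var 100))))) +
    2 * fillCost (flat (.var 4)) (.const 0) (.leaf (.get 102 (.var 100))) + 10,
    fun K R hR l t e σ hσ hl hdvd => ?_⟩
  set L := 2 ^ l with hL
  set PM := poly L (shift (σ.rarr 55) (t * 2 ^ (l + 1))) with hPM
  set PG := poly L (σ.rarr 58) with hPG
  apply Runs.le
  case h =>
    unfold newtonBody
    apply Runs.cons
    refine (hc1 K R hR (t * 2 ^ (l + 1)) 0 l 1 σ one_pos hl fun τ hτ => ?_).post ?_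
    · have := hσ.evalEq hτ.evalEq
      simp [this.ho, this.hS, this.hL, this.hl]
    rintro τ1 ⟨b1, p1⟩
    have e1 := b1.evalEq
    have z1 := p1 0 one_pos
    simp only [zero_mul, add_zero, shift_zero, ← hL, ← hPM, ← hPG] at z1
    apply Runs.cons
    refine (flat_runs (.var 4) 59 (.const 0) _ τ1 0 L (fun p => if p = 0 then 2 - τ1.rarr 102 p else
      0 - τ1.rarr 102 p) ?_ ?_).post ?_
    · intro τ hτ
      exact ⟨((hσ.evalEq e1).evalEq (hτ.evalEq (by simp))).hL, rfl⟩
    · intro p hp τ hτ h100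
      simp [GExp.eval, h100, hτ.rarr 102 (by simp)]
    rintro τ2 ⟨f2, r2⟩
    have e2 := e1.trans (f2.evalEq (by simp))
    apply Runs.cons
    refine (hc2 K R hR 0 0 l 1 τ2 one_pos hl fun τ hτ => ?_).post ?_
    · have := (hσ.evalEq e2).evalEq hτ.evalEq
      simp [this.hS, this.hL, this.hl]
    rintro τ3 ⟨b3, p3⟩
    have e3 := e2.trans b3.evalEq
    have z3 := p3 0 one_pos
    simp only [zero_mul, add_zero, shift_zero, ← hL] at z3
    rw [f2.rarr 58 (by simp), b1.rarr 58 (by simp), ← hPG] at z3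
    apply Runs.cons
    refine (flat_runs (.var 4) 58 (.const 0) _ τ3 0 L (fun p => τ3.rarr 102 p) ?_ ?_).post ?_
    · intro τ hτ
      exact ⟨((hσ.evalEq e3).evalEq (hτ.evalEq (by simp))).hL, rfl⟩
    · intro p hp τ hτ h100
      simp [GExp.eval, h100, hτ.rarr 102 (by simp)]
    rintro τ4 ⟨f4, r4⟩
    have e4 := e3.trans (f4.evalEq (by simp))
    have h54 : τ4.ivar 54 = σ.ivar 54 := by
      rw [f4.ivar _ (by simp), b3.ivar _ (by simp), f2.ivar _ (by simp), b1.ivar _ (by simp)]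
    apply Runs.set (v := σ.ivar 54 + 1) (by simp [h54])
    refine Runs.nil ⟨e4.setI le_rfl, by simp, ?_⟩
    -- Both `U = 2 - M G` and the new approximation `U G` are kept only modulo `X ^ L`.
    refine newton_step hdvd (U := poly L (τ2.rarr 59)) (X_pow_dvd_sub_poly _ _ fun i hi => ?_)
      (X_pow_dvd_sub_poly _ _ fun i hi => ?_)
    · rw [r2, fillFun_zero hi, ← z1, coeff_sub, poly_coeff, if_pos (show i < 2 * L by omega)]
      by_cases h0 : i = 0
      · simp [h0]
      · rw [if_neg h0, ← map_ofNat C 2, coeff_C_of_ne_zero h0]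
    · simp only [Mem.setI_rarr]
      rw [r4, fillFun_zero hi, ← z3, poly_coeff, if_pos (by omega)]
  case hT =>
    simp only [IExp.cost, one_mul, ← hL]
    have hV : 1 ≤ L := Nat.one_le_two_pow
    have hRV : L ≤ R * L := Nat.le_mul_of_pos_left _ hR.1
    set d1 := fillCost (flat (.var 4)) (.const 0) (.ite (.ile (.var 100) (.const 0))
      (.leaf (.sub (.const 2) (.get 102 (.var 100)))) (.leaf (.sub (.const 0) (.get 102 (.var 100)))))
    set d2 := fillCost (flat (.var 4)) (.const 0) (.leaf (.get 102 (.var 100)))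
    rw [show R * (2 * L) = 2 * (R * L) by ring]
    generalize R * L = V at *
    have h1 : d1 * (L + 1) ≤ d1 * (2 * V) := Nat.mul_le_mul_left _ (by omega)
    have h2 : d2 * (L + 1) ≤ d2 * (2 * V) := Nat.mul_le_mul_left _ (by omega)
    nlinarith

/-- The polynomial in the array `6` with its coefficients in reverse order. -/
noncomputable def revPoly (l : ℕ) (σ : Mem) : ℝ[X] := poly (2 ^ l) fun i => σ.rarr 6 (2 ^ l - 1 - i)

theorem revPoly_congr {l : ℕ} {σ τ : Mem} (h : τ.rarr 6 = σ.rarr 6) : revPoly l τ = revPoly l σ := by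
  rw [revPoly, h, revPoly]

/-- Precision doubles at each Newton step, so `l` steps at full length reach `2 ^ l`. The root
occupies `2 * 2 ^ l` cells, but modulo `X ^ (2 ^ l)` its first half is enough. -/
theorem evalTop_runs {ps : List Cmd} : ∃ c, ∀ (K R : ℕ), MulBound ps K R → ∀ (l t : ℕ) (σ : Mem) (M : ℝ[X]),
    EvalCtx l t σ → l + 1 ≤ K → poly (2 * 2 ^ l) (shift (σ.rarr 55) (t * 2 ^ (l + 1))) = M →
    M.coeff 0 = 1 →
    Runs ps evalTop σ (c * ((l + 1) * (R * 2 ^ l))) (fun τ => EvalEq σ τ ∧ ∀ i < 2 ^ l,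
      τ.rarr 57 i = PowerSeries.coeff i (quot (revPoly l σ) M)) := by
  obtain ⟨c1, hc1⟩ := newtonBody_runs (ps := ps)
  obtain ⟨c2, hc2⟩ := prodCmd_runs (ps := ps) 59 58 (by simp) (by simp) (.const 0) (.const 0) (.var 53)
    (.var 4) (.var 3)
  refine ⟨c1 + 2 * c2 + 2 * fillCost (flat (.var 4)) (.const 0)
    (.ite (.ile (.var 100) (.const 0)) (.leaf (.const 1)) (.leaf (.const 0))) + 2 * fillCost (flat (.var 4))
    (.const 0) (.leaf (.get 6 (.sub (.sub (.var 4) (.const 1)) (.var 100)))) +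
    2 * fillCost (flat (.var 4)) (.const 0) (.leaf (.get 102 (.var 100))) + 20,
    fun K R hR l t σ M hσ hl hM hM0 => ?_⟩
  have hLpos : 0 < 2 ^ l := by positivity
  set L := 2 ^ l with hL
  set PM := poly L (shift (σ.rarr 55) (t * 2 ^ (l + 1))) with hPM
  have hMPM : X ^ L ∣ M - PM := by
    refine X_pow_dvd_sub_poly _ _ fun i hi => ?_
    rw [← hM, poly_coeff, if_pos (by omega)]
  have hPM0 : PM.coeff 0 = 1 := by
    rw [← hM0, ← hM, poly_coeff, poly_coeff, if_pos hLpos, if_pos (by omega)]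
  apply Runs.le
  case h =>
    unfold evalTop
    apply Runs.cons
    refine (flat_runs (.var 4) 58 (.const 0) _ σ 0 L (fun p => if p = 0 then 1 else 0) ?_ ?_).post ?_
    · intro τ hτ
      exact ⟨(hσ.evalEq (hτ.evalEq (by simp))).hL, rfl⟩
    · intro p hp τ hτ h100
      simp [GExp.eval, h100]
    rintro τ1 ⟨f1, r1⟩
    have e1 := (f1.evalEq (by simp)).setI (x := 54) (v := 0) le_rfl
    apply Runs.set (v := 0) rfl
    apply Runs.cons
    refine (Runs.loop (fun i τ => EvalEq σ τ ∧ τ.ivar 54 = i ∧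
      X ^ (min (2 ^ i) L) ∣ 1 - PM * poly L (τ.rarr 58)) l (T := c1 * (R * L)) ?_ ?_ ?_).post ?_
    · rintro i hi τ ⟨h1, h2, h3⟩
      refine ⟨by simp [h2, (hσ.evalEq h1).hl, hi], ?_⟩
      rw [hPM, ← h1.tree] at h3
      refine (hc1 K R hR l t _ τ (hσ.evalEq h1) hl h3).post ?_
      rintro υ ⟨h4, h5, h6⟩
      refine ⟨h1.trans h4, by rw [h5, h2], ?_⟩
      rw [h1.tree, ← hPM] at h6
      refine (pow_dvd_pow X ?_).trans h6
      rw [pow_succ]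
      omega
    · rintro τ ⟨h1, h2, h3⟩
      simp [h2, (hσ.evalEq h1).hl]
    -- The iteration starts with `G = 1`, correct modulo `X` because the constant term of `M` is
    -- `1`.
    · refine ⟨e1, by simp, ?_⟩
      have : poly L (τ1.rarr 58) = 1 := by
        ext i
        rw [poly_coeff, r1, coeff_one]
        by_cases hi : i < L
        · rw [if_pos hi, fillFun_zero hi]
        · rw [if_neg hi, if_neg (by omega)]
      rw [Mem.setI_rarr, this, pow_zero, min_eq_left (by omega), pow_one, mul_one, X_dvd_iff, coeff_sub,
        hPM0, coeff_one_zero, sub_self]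
    rintro τ2 ⟨e2, -, d2⟩
    rw [min_eq_right le_rfl] at d2
    apply Runs.cons
    refine (flat_runs (.var 4) 59 (.const 0) _ τ2 0 L (fun p => σ.rarr 6 (L - 1 - p)) ?_ ?_).post ?_
    · intro τ hτ
      exact ⟨((hσ.evalEq e2).evalEq (hτ.evalEq (by simp))).hL, rfl⟩
    · intro p hp τ hτ h100
      simp [GExp.eval, h100, ((hσ.evalEq e2).evalEq (hτ.evalEq (by simp))).hL,
        hτ.rarr 6 (by simp), e2.below.rarr 6 (by simp), hL]
    rintro τ3 ⟨f3, r3⟩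
    have e3 := e2.trans (f3.evalEq (by simp))
    apply Runs.cons
    refine (hc2 K R hR 0 0 l 1 τ3 one_pos hl fun τ hτ => ?_).post ?_
    · have := (hσ.evalEq e3).evalEq hτ.evalEq
      simp [this.hS, this.hL, this.hl]
    rintro τ4 ⟨b4, p4⟩
    have e4 := e3.trans b4.evalEq
    have z4 := p4 0 one_pos
    simp only [zero_mul, add_zero, shift_zero, ← hL] at z4
    have hrev : poly L (τ3.rarr 59) = revPoly l σ :=
      poly_congr fun i hi => by rw [r3, fillFun_zero hi]
    rw [hrev, f3.rarr 58 (by simp)] at z4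
    apply Runs.cons
    refine (flat_runs (.var 4) 57 (.const 0) _ τ4 0 L (fun p => τ4.rarr 102 p) ?_ ?_).post ?_
    · intro τ hτ
      exact ⟨((hσ.evalEq e4).evalEq (hτ.evalEq (by simp))).hL, rfl⟩
    · intro p hp τ hτ h100
      simp [GExp.eval, h100, hτ.rarr 102 (by simp)]
    rintro τ5 ⟨f5, r5⟩
    refine Runs.nil ⟨e4.trans (f5.evalEq (by simp)), fun i hi => ?_⟩
    rw [r5, fillFun_zero hi, ← quot_coeff hM0 hMPM d2 i hi, ← z4, poly_coeff, if_pos (by omega)]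
  case hT =>
    simp only [IExp.cost, Test.cost, one_mul, ← hL]
    have hRV : L ≤ R * L := Nat.le_mul_of_pos_left _ hR.1
    set d1 := fillCost (flat (.var 4)) (.const 0)
      (.ite (.ile (.var 100) (.const 0)) (.leaf (.const 1)) (.leaf (.const 0)))
    set d2 := fillCost (flat (.var 4))
      (.const 0) (.leaf (.get 6 (.sub (.sub (.var 4) (.const 1)) (.var 100))))
    set d3 := fillCost (flat (.var 4)) (.const 0) (.leaf (.get 102 (.var 100)))
    rw [show R * (2 * L) = 2 * (R * L) by ring]
    generalize R * L = V at *
    have h1 : d1 * (L + 1) ≤ d1 * (2 * V) := Nat.mul_le_mul_left _ (by omega)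
    have h2 : d2 * (L + 1) ≤ d2 * (2 * V) := Nat.mul_le_mul_left _ (by omega)
    have h3 : d3 * (L + 1) ≤ d3 * (2 * V) := Nat.mul_le_mul_left _ (by omega)
    have h4 : (c1 + 2 * c2 + 2 * d1 + 2 * d2 + 2 * d3 + 20) * ((l + 1) * V) =
      (c1 + 2 * c2 + 2 * d1 + 2 * d2 + 2 * d3 + 20) * V + (c1 + 2 * c2 + 2 * d1 + 2 * d2 + 2 * d3 + 20) * (l * V) := by
      ring
    have h5 : l ≤ l * V := Nat.le_mul_of_pos_right _ (by omega)
    have h6 : l * (1 + 1 + 1 + c1 * V) ≤ (c1 + 2 * c2 + 2 * d1 + 2 * d2 + 2 * d3 + 20) * (l * V) := by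
      have : l * (1 + 1 + 1 + c1 * V) = 3 * l + c1 * (l * V) := by ring
      nlinarith [Nat.zero_le (c2 * (l * V)), Nat.zero_le (d1 * (l * V)), Nat.zero_le (d2 * (l * V)), Nat.zero_le (d3 * (l * V))]
    rw [h4]
    nlinarith

/-! ### Evaluation of a polynomial at many points: the recursion -/

/-- Compute the next level of the product tree and go there. -/
def evalUp : Cmd := block [
  prodCmd 55 55 (.var 52) (.add (.var 52) (.var 51)) (.var 53) (.var 51) (.add (.var 50) (.const 1)),
  fill (flat (.var 53)) 55 (.add (.var 52) (.var 53)) (.leaf (.get 102 (.var 100))),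
  .iset 50 (.add (.var 50) (.const 1)),
  .iset 51 (.add (.var 51) (.var 51)),
  .iset 52 (.add (.var 52) (.var 53))]

/-- Go back to the lower level of the product tree and distribute the coefficients to it. -/
def evalDown : Cmd := block [
  .iset 52 (.sub (.var 52) (.var 53)),
  .iset 51 (.half (.var 51)),
  .iset 50 (.sub (.var 50) (.const 1)),
  fill ⟨.var 53, .var 51, .const 2, .const 1, .const 0, .var 51⟩ 100 (.const 0)
    (.leaf (.get 57 (.add (.var 105) (.var 103)))),
  fill ⟨.var 53, .var 51, .const 2, .const 0, .const 0, .const 0⟩ 101 (.const 0)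
    (.ite (.ile (.var 102) (.const 0))
      (.leaf (.get 55 (.add (.add (.var 52) (.var 100)) (.var 51))))
      (.leaf (.get 55 (.sub (.add (.var 52) (.var 100)) (.var 51))))),
  .iset 120 (.add (.var 50) (.const 1)),
  .iset 121 (.var 53),
  .call 0,
  fill ⟨.var 4, .half (.var 51), .const 1, .const 1, .const 0, .var 51⟩ 57 (.const 0)
    (.leaf (.get 102 (.add (.add (.var 105) (.half (.var 51))) (.var 103))))]

/-- The evaluation of a polynomial at many points. -/
def evalBody : Cmd :=
  .ite (.ile (.var 3) (.var 50)) evalTop (block [evalUp, .call 2, evalDown])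

/-- The node `v` at level `t` of the product tree. -/
noncomputable def node (l t : ℕ) (σ : Mem) (v : ℕ) : ℝ[X] :=
  poly (2 ^ (t + 1)) (shift (σ.rarr 55) (t * 2 ^ (l + 1) + v * 2 ^ (t + 1)))

theorem mul_pow_le {l t v : ℕ} (ht : t ≤ l) (hv : v < 2 ^ (l - t)) :
    v * 2 ^ (t + 1) + 2 ^ (t + 1) ≤ 2 ^ (l + 1) := by
  rw [← Nat.succ_mul, show l + 1 = (l - t) + (t + 1) by omega, pow_add 2 (l - t)]
  exact Nat.mul_le_mul_right _ hv

theorem node_congr {l t v : ℕ} {σ τ : Mem} (ht : t ≤ l) (hv : v < 2 ^ (l - t))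
    (h : ∀ x < (t + 1) * 2 ^ (l + 1), τ.rarr 55 x = σ.rarr 55 x) : node l t τ v = node l t σ v := by
  refine poly_congr fun i hi => h _ ?_
  have := mul_pow_le ht hv
  rw [Nat.succ_mul]
  omega

/-- A node at level `t` has degree at most `2 ^ t`, thus up to `2 ^ t + 1` coefficients, and gets a
block of `2 ^ (t + 1)` cells. Each level fills `2 ^ (l + 1)` cells of the array `55` and is kept for
the descent. -/
theorem evalUp_runs {ps : List Cmd} : ∃ c, ∀ (K R : ℕ), MulBound ps K R → ∀ (l t : ℕ) (σ : Mem),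
    EvalCtx l t σ → l + 1 ≤ K → t < l →
    Runs ps evalUp σ (c * (R * 2 ^ l)) (fun τ => Below 50 σ τ ∧ EvalCtx l (t + 1) τ ∧
      (∀ x < (t + 1) * 2 ^ (l + 1), τ.rarr 55 x = σ.rarr 55 x) ∧
      ∀ v < 2 ^ (l - (t + 1)), node l (t + 1) τ v = node l t σ (2 * v) * node l t σ (2 * v + 1)) := by
  obtain ⟨c1, hc1⟩ := prodCmd_runs (ps := ps) 55 55 (by simp) (by simp) (.var 52)
    (.add (.var 52) (.var 51)) (.var 53) (.var 51) (.add (.var 50) (.const 1))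
  refine ⟨2 * c1 + 3 * fillCost (flat (.var 53)) (.add (.var 52) (.var 53)) (.leaf (.get 102 (.var 100))) + 20,
    fun K R hR l t σ hσ hl ht => ?_⟩
  have hLpos : 0 < 2 ^ l := by positivity
  have hG : 2 ^ (l - (t + 1)) * (2 * 2 ^ (t + 1)) = 2 * 2 ^ l := by
    rw [mul_left_comm, ← pow_add]
    congr 2
    omega
  have hl1 : 2 ^ (l + 1) = 2 * 2 ^ l := by rw [pow_succ, mul_comm]
  have hS : (t + 1) * 2 ^ (l + 1) = t * 2 ^ (l + 1) + 2 * 2 ^ l := by rw [Nat.succ_mul, hl1]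
  apply Runs.le
  case h =>
    unfold evalUp
    apply Runs.cons
    refine (hc1 K R hR (t * 2 ^ (l + 1)) (t * 2 ^ (l + 1) + 2 ^ (t + 1)) (t + 1) (2 ^ (l - (t + 1))) σ
      (by positivity) (by omega) fun τ hτ => ?_).post ?_
    · have := hσ.evalEq hτ.evalEq
      simp [this.ho, this.hS, this.hb, this.ht, hG]
    rintro τ1 ⟨b1, p1⟩
    have e1 := b1.evalEq
    apply Runs.cons
    refine (flat_runs (.var 53) 55 _ _ τ1 (t * 2 ^ (l + 1) + 2 * 2 ^ l) (2 * 2 ^ l)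
      (fun p => τ1.rarr 102 p) ?_ ?_).post ?_
    · intro τ hτ
      have := hσ.evalEq e1
      simp [hτ.ivar 52, hτ.ivar 53, this.ho, this.hS]
    · intro p hp τ hτ h100
      simp [GExp.eval, h100, hτ.rarr 102 (by simp)]
    rintro τ2 ⟨f2, r2⟩
    have c1 := hσ.evalEq e1
    have b2 : Below 50 σ τ2 := (b1.anti (by simp)).trans (f2.below (by simp) (by simp))
    apply Runs.set (v := t + 1) (by simp [f2.ivar 50, c1.ht])
    apply Runs.set (v := 2 ^ (t + 1 + 1)) (by simp [f2.ivar 51, c1.hb]; ring)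
    apply Runs.set (v := (t + 1) * 2 ^ (l + 1)) (by simp [f2.ivar 52, f2.ivar 53, c1.ho, c1.hS, hS])
    have hsame : ∀ x < (t + 1) * 2 ^ (l + 1), τ2.rarr 55 x = σ.rarr 55 x := by
      intro x hx
      rw [r2, fillFun_below (by omega), e1.tree]
    refine Runs.nil ⟨((b2.setI (by simp)).setI (by simp)).setI (by simp), ?_, hsame, fun v hv => ?_⟩
    · constructor <;> simp [f2.ivar, c1.hl, c1.hL, c1.hS]
    · have hlt := mul_pow_le (show t + 1 ≤ l by omega) hv
      have e2 : 2 ^ (t + 1 + 1) = 2 * 2 ^ (t + 1) := by rw [pow_succ, mul_comm]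
      have h1 := p1 v hv
      have h3 : node l (t + 1) ((((τ2.setI 50 (t + 1)).setI 51 (2 ^ (t + 1 + 1))).setI 52
          ((t + 1) * 2 ^ (l + 1)))) v = poly (2 * 2 ^ (t + 1)) (shift (τ1.rarr 102) (v * (2 * 2 ^ (t + 1)))) := by
        rw [node, e2]
        rw [e2] at hlt
        refine poly_congr fun i hi => ?_
        rw [shift, shift, Mem.setI_rarr, Mem.setI_rarr, Mem.setI_rarr, r2, hS, add_assoc, fillFun_of_lt]
        omega
      rw [h3, h1, node, node]
      congr 3 <;> ring
  case hT =>
    simp only [IExp.cost]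
    rw [hG]
    generalize 2 ^ l = L at *
    have hRV : L ≤ R * L := Nat.le_mul_of_pos_left _ hR.1
    set d1 := fillCost (flat (.var 53)) (.add (.var 52) (.var 53)) (.leaf (.get 102 (.var 100)))
    rw [show R * (2 * L) = 2 * (R * L) by ring]
    generalize R * L = V at *
    have h1 : d1 * (2 * L + 1) ≤ d1 * (3 * V) := Nat.mul_le_mul_left _ (by omega)
    nlinarith

/-- At a node of level `t + 1` the array `57` holds the `2 ^ (t + 1)` coefficients of its quotient
that end just before degree `2 ^ l`. The window is copied once for each child and multiplied by the
sibling of that child. The upper half of the negacyclic product is the window of the child, by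
`NegProd.middle`. -/
theorem evalDown_runs {ps : List Cmd} : ∃ c, ∀ (K R : ℕ), MulBound ps K R → ∀ (l t : ℕ) (σ : Mem),
    EvalCtx l (t + 1) σ → l + 1 ≤ K → t < l →
    Runs ps evalDown σ (c * (R * 2 ^ l)) (fun τ => Below 50 σ τ ∧ EvalCtx l t τ ∧
      τ.rarr 55 = σ.rarr 55 ∧ ∀ v < 2 ^ (l - (t + 1)), ∀ Q : PowerSeries ℝ,
        (∀ j < 2 ^ (t + 1), σ.rarr 57 (v * 2 ^ (t + 1) + j) = PowerSeries.coeff (2 ^ l - 2 ^ (t + 1) + j) Q) →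
        ∀ u w, (u = 0 ∧ w = 1 ∨ u = 1 ∧ w = 0) → (node l t σ (2 * v + w)).natDegree ≤ 2 ^ t → ∀ i < 2 ^ t,
          τ.rarr 57 ((2 * v + u) * 2 ^ t + i) =
            PowerSeries.coeff (2 ^ l - 2 ^ t + i) (Q * (node l t σ (2 * v + w) : PowerSeries ℝ))) := by
  refine ⟨3 * fillCost ⟨.var 53, .var 51, .const 2, .const 1, .const 0, .var 51⟩ (.const 0)
      (.leaf (.get 57 (.add (.var 105) (.var 103)))) +
    3 * fillCost ⟨.var 53, .var 51, .const 2, .const 0, .const 0, .const 0⟩ (.const 0)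
      (.ite (.ile (.var 102) (.const 0))
        (.leaf (.get 55 (.add (.add (.var 52) (.var 100)) (.var 51))))
        (.leaf (.get 55 (.sub (.add (.var 52) (.var 100)) (.var 51))))) +
    2 * fillCost ⟨.var 4, .half (.var 51), .const 1, .const 1, .const 0, .var 51⟩ (.const 0)
      (.leaf (.get 102 (.add (.add (.var 105) (.half (.var 51))) (.var 103)))) + 40,
    fun K R hR l t σ hσ hl ht => ?_⟩
  have hLpos : 0 < 2 ^ l := by positivity
  have hhpos : 0 < 2 ^ t := by positivity
  have hG : 2 ^ (l - t) * 2 ^ (t + 1) = 2 * 2 ^ l := by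
    rw [← pow_add, mul_comm 2, ← pow_succ]
    congr 1
    omega
  have hl1 : 2 ^ (l + 1) = 2 * 2 ^ l := by rw [pow_succ, mul_comm]
  have ht1 : 2 ^ (t + 1) = 2 * 2 ^ t := by rw [pow_succ, mul_comm]
  have hS : (t + 1) * 2 ^ (l + 1) = t * 2 ^ (l + 1) + 2 * 2 ^ l := by rw [Nat.succ_mul, hl1]
  set σ1 := ((σ.setI 52 (t * 2 ^ (l + 1))).setI 51 (2 ^ (t + 1))).setI 50 t with hσ1
  have c1 : EvalCtx l t σ1 := by constructor <;> simp [hσ1, hσ.hl, hσ.hL, hσ.hS]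
  have b1 : Below 50 σ σ1 := (((Below.refl 50 σ).setI (by simp)).setI (by simp)).setI (by simp)
  apply Runs.le
  case h =>
    unfold evalDown
    apply Runs.set (v := t * 2 ^ (l + 1)) (by simp [hσ.ho, hσ.hS, hS])
    apply Runs.set (v := 2 ^ (t + 1)) (by simp [hσ.hb, pow_succ])
    apply Runs.set (v := t) (by simp [hσ.ht])
    rw [← hσ1]
    apply Runs.cons
    refine (fill_runs ⟨.var 53, .var 51, .const 2, .const 1, .const 0, .var 51⟩ 100 (.const 0) _ σ1
      ⟨2 * 2 ^ l, 2 ^ (t + 1), 2, 1, 0, 2 ^ (t + 1)⟩ 0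
      (fun p => σ.rarr 57 (p / 2 ^ (t + 1) / 2 * 2 ^ (t + 1) + p % 2 ^ (t + 1))) (by positivity)
      (by simp) ?_ ?_).post ?_
    · intro τ hτ
      have c2 := c1.evalEq (hτ.evalEq (by simp))
      exact ⟨⟨c2.hS, c2.hb, rfl, rfl, rfl, c2.hb⟩, rfl⟩
    · intro p hp τ hτ hd _
      simp [GExp.eval, hd.sg, hd.sj, hτ.rarr 57, hσ1]
    rintro τ2 ⟨f2, r2⟩
    have e2 := f2.evalEq (by simp)
    apply Runs.cons
    refine (fill_runs ⟨.var 53, .var 51, .const 2, .const 0, .const 0, .const 0⟩ 101 (.const 0) _ τ2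
      ⟨2 * 2 ^ l, 2 ^ (t + 1), 2, 0, 0, 0⟩ 0
      (fun p => if p / 2 ^ (t + 1) % 2 = 0 then σ.rarr 55 (t * 2 ^ (l + 1) + p + 2 ^ (t + 1)) else
        σ.rarr 55 (t * 2 ^ (l + 1) + p - 2 ^ (t + 1))) (by positivity)
      (by simp) ?_ ?_).post ?_
    · intro τ hτ
      have c2 := c1.evalEq (e2.trans (hτ.evalEq (by simp)))
      exact ⟨⟨c2.hS, c2.hb, rfl, rfl, rfl, rfl⟩, rfl⟩
    · intro p hp τ hτ hd _
      have c2 := c1.evalEq (e2.trans (hτ.evalEq (by simp)))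
      simp [GExp.eval, hd.i, hd.pos, c2.ho, c2.hb, hτ.rarr 55, e2.tree, hσ1]
    rintro τ3 ⟨f3, r3⟩
    have e3 := e2.trans (f3.evalEq (by simp))
    have c3 := c1.evalEq e3
    apply Runs.set (v := t + 1) (by simp [c3.ht])
    apply Runs.set (v := 2 ^ (l - t) * 2 ^ (t + 1)) (by simp [c3.hS, hG])
    apply Runs.cons
    refine (hR.2 (t + 1) (by omega) (by omega) (2 ^ (l - t)) _ (by positivity) (by simp) (by simp)).post ?_
    rintro τ4 ⟨b4, p4⟩
    have e4 := (e3.setI (x := 120) (v := t + 1) (by simp)).setI (x := 121)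
      (v := 2 ^ (l - t) * 2 ^ (t + 1)) (by simp) |>.trans b4.evalEq
    apply Runs.cons
    refine (fill_runs ⟨.var 4, .half (.var 51), .const 1, .const 1, .const 0, .var 51⟩ 57 (.const 0) _ τ4
      ⟨2 ^ l, 2 ^ t, 1, 1, 0, 2 ^ (t + 1)⟩ 0
      (fun p => τ4.rarr 102 (p / 2 ^ t * 2 ^ (t + 1) + 2 ^ t + p % 2 ^ t)) (by positivity)
      (by simp) ?_ ?_).post ?_
    · intro τ hτ
      have c2 := c1.evalEq (e4.trans (hτ.evalEq (by simp)))
      exact ⟨⟨c2.hL, by simp [c2.hb, pow_succ], rfl, rfl, rfl, c2.hb⟩, rfl⟩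
    · intro p hp τ hτ hd _
      have c2 := c1.evalEq (e4.trans (hτ.evalEq (by simp)))
      simp [GExp.eval, hd.sg, hd.sj, c2.hb, hτ.rarr 102, show 2 ^ (t + 1) / 2 = 2 ^ t by rw [ht1]; simp]
    rintro τ5 ⟨f5, r5⟩
    have e5 := e4.trans (f5.evalEq (by simp))
    refine Runs.nil ⟨b1.trans e5.below, c1.evalEq e5, by rw [e5.tree, hσ1]; rfl, ?_⟩
    intro v hv Q hQ u w huw hdeg i hi
    have hw : 2 * v + u < 2 ^ (l - t) := by
      have : 2 ^ (l - t) = 2 * 2 ^ (l - (t + 1)) := by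
        rw [mul_comm, ← pow_succ]
        congr 1
        omega
      omega
    have hlt : (2 * v + u) * 2 ^ (t + 1) + 2 ^ (t + 1) ≤ 2 * 2 ^ l := by
      have := mul_pow_le ht.le hw
      omega
    have hp : (2 * v + u) * 2 ^ t + i < 2 ^ l := by
      have : (2 * v + u) * 2 ^ (t + 1) = 2 * ((2 * v + u) * 2 ^ t) := by rw [ht1]; ring
      omega
    rw [r5, fillFun_zero hp, Nat.mul_add_mod_self_right, Nat.mod_eq_of_lt hi, mul_comm _ (2 ^ t),
      Nat.mul_add_div hhpos, Nat.div_eq_of_lt hi, add_zero]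
    have hz := p4 (2 * v + u) hw
    have hd : ∀ j < 2 ^ (t + 1), ((2 * v + u) * 2 ^ (t + 1) + j) / 2 ^ (t + 1) = 2 * v + u ∧
        ((2 * v + u) * 2 ^ (t + 1) + j) % 2 ^ (t + 1) = j := by
      intro j hj
      rw [mul_comm, Nat.mul_add_div (by positivity), Nat.div_eq_of_lt hj, Nat.mul_add_mod,
        Nat.mod_eq_of_lt hj]
      simp
    have hy : poly (2 * 2 ^ t) (shift (τ3.rarr 101) ((2 * v + u) * 2 ^ (t + 1))) = node l t σ (2 * v + w) := by
      rw [← ht1, node]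
      refine poly_congr fun j hj => ?_
      rw [shift, r3, fillFun_zero (show _ < 2 * 2 ^ l by omega), (hd j hj).1, shift]
      -- The child `u` receives the tree node of its sibling `w`: the next block for a left child,
      -- the previous one for a right child.
      rcases huw with ⟨rfl, rfl⟩ | ⟨rfl, rfl⟩
      · rw [if_pos (by omega)]
        congr 1
        ring
      · rw [if_neg (by omega), add_mul (2 * v), add_zero, one_mul]
        congr 1
        omega
    have h2L : 2 * 2 ^ t ≤ 2 ^ l := by
      rw [← ht1]
      exact Nat.pow_le_pow_right (by simp) ht
    have hm := NegProd.middle (h := 2 ^ t) (L := 2 ^ l) hhpos h2L (by rw [← ht1]; exact hz) Q ?_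
      (by rw [Mem.setI_rarr, Mem.setI_rarr, hy]; exact hdeg) i hi
    · rw [Mem.setI_rarr, Mem.setI_rarr, hy] at hm
      rw [← hm, shift]
      congr 1
      ring
    · intro j hj
      rw [← ht1] at hj ⊢
      rw [shift, Mem.setI_rarr, Mem.setI_rarr, f3.rarr 100 (by simp), r2,
        fillFun_zero (show _ < 2 * 2 ^ l by omega), (hd j hj).1, (hd j hj).2, ← hQ j hj]
      congr 3
      omega
  case hT =>
    simp only [IExp.cost]
    rw [hG]
    generalize 2 ^ l = L at *
    have hRV : L ≤ R * L := Nat.le_mul_of_pos_left _ hR.1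
    rw [show R * (2 * L) = 2 * (R * L) by ring]
    generalize fillCost ⟨.var 53, .var 51, .const 2, .const 1, .const 0, .var 51⟩ (.const 0)
      (.leaf (.get 57 (.add (.var 105) (.var 103)))) = d1
    generalize fillCost ⟨.var 53, .var 51, .const 2, .const 0, .const 0, .const 0⟩ (.const 0)
      (.ite (.ile (.var 102) (.const 0))
        (.leaf (.get 55 (.add (.add (.var 52) (.var 100)) (.var 51))))
        (.leaf (.get 55 (.sub (.add (.var 52) (.var 100)) (.var 51))))) = d2
    generalize fillCost ⟨.var 4, .half (.var 51), .const 1, .const 1, .const 0, .var 51⟩ (.const 0)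
      (.leaf (.get 102 (.add (.add (.var 105) (.half (.var 51))) (.var 103)))) = d3
    generalize R * L = V at *
    have h1 : d1 * (2 * L + 1) ≤ d1 * (3 * V) := Nat.mul_le_mul_left _ (by omega)
    have h2 : d2 * (2 * L + 1) ≤ d2 * (3 * V) := Nat.mul_le_mul_left _ (by omega)
    have h3 : d3 * (L + 1) ≤ d3 * (2 * V) := Nat.mul_le_mul_left _ (by omega)
    nlinarith

/-- Evaluation at many points: from the level `t` of the product tree, the reverse of the polynomial is
divided by each node of that level. -/
theorem eval_runs {ps : List Cmd} (h2 : ps[2]? = some evalBody) : ∃ c, ∀ (K R : ℕ), MulBound ps K R →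
    ∀ (l : ℕ), l + 1 ≤ K → ∀ (d t : ℕ) (σ : Mem), t + d = l → EvalCtx l t σ →
    (∀ v < 2 ^ (l - t), (node l t σ v).natDegree ≤ 2 ^ t ∧ (node l t σ v).coeff 0 = 1) →
    Runs ps (.call 2) σ ((l + 1 + d) * (c * (R * 2 ^ l))) (fun τ => Below 50 σ τ ∧ EvalCtx l t τ ∧
      (∀ x < (t + 1) * 2 ^ (l + 1), τ.rarr 55 x = σ.rarr 55 x) ∧
      ∀ v < 2 ^ (l - t), ∀ i < 2 ^ t, τ.rarr 57 (v * 2 ^ t + i) =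
        PowerSeries.coeff (2 ^ l - 2 ^ t + i) (quot (revPoly l σ) (node l t σ v))) := by
  obtain ⟨c1, hc1⟩ := evalTop_runs (ps := ps)
  obtain ⟨c2, hc2⟩ := evalUp_runs (ps := ps)
  obtain ⟨c3, hc3⟩ := evalDown_runs (ps := ps)
  refine ⟨c1 + c2 + c3 + 10, fun K R hR l hl d => ?_⟩
  have hLpos : 0 < 2 ^ l := by positivity
  have hRV : 2 ^ l ≤ R * 2 ^ l := Nat.le_mul_of_pos_left _ hR.1
  induction d with
  | zero =>
    intro t σ htd hσ hnode
    obtain rfl : t = l := by omega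
    have hM : poly (2 * 2 ^ t) (shift (σ.rarr 55) (t * 2 ^ (t + 1))) = node t t σ 0 := by
      rw [node, zero_mul, add_zero, pow_succ, mul_comm 2]
    apply Runs.le
    case h =>
      apply Runs.call h2
      unfold evalBody
      apply Runs.ite_pos (by simp [hσ.hl, hσ.ht])
      refine (hc1 K R hR t t σ _ hσ hl hM (hnode 0 (by simp)).2).post ?_
      rintro τ ⟨e1, p1⟩
      refine ⟨e1.below, hσ.evalEq e1, fun x _ => by rw [e1.tree], fun v hv i hi => ?_⟩
      obtain rfl : v = 0 := by simpa using hv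
      simpa using p1 i hi
    case hT =>
      simp only [IExp.cost, Test.cost]
      generalize R * 2 ^ t = V at *
      have h1 : 1 ≤ V := by omega
      have : (t + 1 + 0) * ((c1 + c2 + c3 + 10) * V) = c1 * ((t + 1) * V) + (c2 + c3 + 10) * ((t + 1) * V) := by ring
      have : V ≤ (t + 1) * V := Nat.le_mul_of_pos_left _ (by omega)
      nlinarith
  | succ d ih =>
    intro t σ htd hσ hnode
    have ht : t < l := by omega
    have hpow : 2 ^ (l - t) = 2 * 2 ^ (l - (t + 1)) := by
      rw [mul_comm, ← pow_succ]
      congr 1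
      omega
    apply Runs.le
    case h =>
      apply Runs.call h2
      unfold evalBody
      apply Runs.ite_neg (by simp [hσ.hl, hσ.ht, ht])
      apply Runs.cons
      refine (hc2 K R hR l t σ hσ hl ht).post ?_
      rintro τ1 ⟨b1, x1, s1, n1⟩
      apply Runs.cons
      refine (ih (t + 1) τ1 (by omega) x1 fun v hv => ?_).post ?_
      · have h3 := hnode (2 * v) (by omega)
        have h4 := hnode (2 * v + 1) (by omega)
        rw [n1 v hv]
        refine ⟨natDegree_mul_le.trans ?_, by rw [mul_coeff_zero, h3.2, h4.2, one_mul]⟩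
        rw [pow_succ]
        omega
      rintro τ2 ⟨b2, x2, s2, p2⟩
      apply Runs.cons
      refine (hc3 K R hR l t τ2 x2 hl ht).post ?_
      rintro τ3 ⟨b3, x3, s3, p3⟩
      have s23 : ∀ x < (t + 1) * 2 ^ (l + 1), τ2.rarr 55 x = σ.rarr 55 x := by
        intro x hx
        rw [s2 x (hx.trans_le (Nat.mul_le_mul_right _ (by omega))), s1 x hx]
      refine Runs.nil ⟨(b1.trans b2).trans b3, x3, fun x hx => by rw [s3, s23 x hx], ?_⟩
      intro w hw i hi
      obtain ⟨v, u, hu, rfl⟩ : ∃ v u, u < 2 ∧ w = 2 * v + u :=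
        ⟨w / 2, w % 2, Nat.mod_lt _ (by simp), by omega⟩
      have hv : v < 2 ^ (l - (t + 1)) := by omega
      have hn0 := node_congr ht.le (show 2 * v < 2 ^ (l - t) by omega) s23
      have hn1 := node_congr ht.le (show 2 * v + 1 < 2 ^ (l - t) by omega) s23
      have h3 := hnode (2 * v) (by omega)
      have h4 := hnode (2 * v + 1) (by omega)
      have hrev : revPoly l τ1 = revPoly l σ := revPoly_congr (b1.rarr 6 (by simp))
      have key := p3 v hv _ (p2 v hv)
      rw [n1 v hv, hrev] at key
      -- For each child the factor contributed by the sibling cancels from the denominator.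
      interval_cases u
      · rw [key 0 1 (by simp) (by rw [hn1]; exact h4.1) i hi, hn1, quot_mul h4.2, add_zero]
      · rw [key 1 0 (by simp) (by rw [add_zero, hn0]; exact h3.1) i hi, add_zero, hn0,
          mul_comm (node l t σ (2 * v)), quot_mul h3.2]
    case hT =>
      simp only [IExp.cost, Test.cost]
      generalize R * 2 ^ l = V at *
      have h1 : 1 ≤ V := by omega
      have : (l + 1 + (d + 1)) * ((c1 + c2 + c3 + 10) * V) =
        (l + 1 + d) * ((c1 + c2 + c3 + 10) * V) + (c1 + c2 + c3 + 10) * V := by ring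
      nlinarith

/-! ### The sum of the signals as a quotient of two polynomials -/

/-- A power with a fixed exponent. -/
def RExp.pow (e : RExp) : ℕ → RExp
  | 0 => .const 1
  | k + 1 => .mul (e.pow k) e

@[simp] theorem RExp.eval_pow (σ : Mem) (e : RExp) (k : ℕ) : (e.pow k).eval σ = e.eval σ ^ k := by
  induction k with
  | zero => simp [RExp.pow]
  | succ k ih => simp [RExp.pow, ih, pow_succ]

/-- Case distinction by the lowest digit of a sweep. -/
def pick (f : ℕ → RExp) : ℕ → GExp
  | 0 => .leaf (.const 0)
  | k + 1 => .ite (.ile (.const k) (.var 101)) (.leaf (f k)) (pick f k)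

theorem pick_eval (f : ℕ → RExp) (σ : Mem) (m : ℕ) (h : σ.ivar 101 < m) :
    (pick f m).eval σ = (f (σ.ivar 101)).eval σ := by
  induction m with
  | zero => omega
  | succ m ih =>
    simp only [pick, GExp.eval, Test.holds_ile, IExp.eval]
    by_cases hm : m ≤ σ.ivar 101
    · rw [if_pos hm, show σ.ivar 101 = m by omega]
    · rw [if_neg hm, ih (by omega)]

/-- The numerators of the leaves. -/
def leafNum : GExp :=
  .ite (.ilt (.var 105) (.var 0))
    (.ite (.ile (.var 101) (.const 0)) (.leaf (.const 1)) (.leaf (.const 0))) (.leaf (.const 0))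

/-- The denominators of the leaves. -/
def leafDen (α : ℕ) : GExp :=
  .ite (.ilt (.var 105) (.var 0))
    (pick (fun k => .mul (.pow (.sub (.const 0) (.get 0 (.var 105))) (α - k)) (.const (α.choose k))) (2 ^ α))
    (.ite (.ile (.var 101) (.const 0)) (.leaf (.const 1)) (.leaf (.const 0)))

/-- The leaves of the tree of fractions. -/
def leafCmd (α : ℕ) : Cmd := block [
  fill ⟨.var 4, .const (2 ^ α), .const 1, .const 0, .const 0, .const 1⟩ 2 (.const 0) leafNum,
  fill ⟨.var 4, .const (2 ^ α), .const 1, .const 0, .const 0, .const 1⟩ 3 (.const 0) (leafDen α)]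

/-- Addition of neighbouring fractions. -/
def mergeCmd : Cmd := block [
  prodCmd 2 3 (.const 0) (.var 6) (.var 4) (.var 6) (.var 5),
  fill (flat (.var 4)) 4 (.const 0) (.leaf (.get 102 (.var 100))),
  prodCmd 2 3 (.var 6) (.const 0) (.var 4) (.var 6) (.var 5),
  fill (flat (.var 4)) 2 (.const 0) (.leaf (.add (.get 4 (.var 100)) (.get 102 (.var 100)))),
  prodCmd 3 3 (.const 0) (.var 6) (.var 4) (.var 6) (.var 5),
  fill (flat (.var 4)) 3 (.const 0) (.leaf (.get 102 (.var 100))),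
  .iset 5 (.add (.var 5) (.const 1)),
  .iset 6 (.add (.var 6) (.var 6))]

/-- Sizes of the tree of fractions. -/
def sizeCmd (α : ℕ) : Cmd := block [
  .iset 5 (.const 0),
  .iset 6 (.const 1),
  .loop (.ilt (.var 6) (.var 0)) (block [.iset 5 (.add (.var 5) (.const 1)), .iset 6 (.add (.var 6) (.var 6))]),
  .iset 3 (.add (.var 5) (.const α)),
  powCmd 4 (.var 3),
  .iset 5 (.const α),
  .iset 6 (.const (2 ^ α))]

/-- The tree of fractions. -/
def treeCmd (α : ℕ) : Cmd := block [
  sizeCmd α, leafCmd α, .loop (.ilt (.var 5) (.var 3)) mergeCmd]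

/-- The signal of transmitter `k` at `x`. -/
noncomputable def signal (α n : ℕ) (s : ℕ → ℝ) (x : ℝ) (k : ℕ) : ℝ := if k < n then 1 / (x - s k) ^ α else 0

/-- The scalars at level `j` of the tree of fractions. -/
structure TreeCtx (α κ n j : ℕ) (σ : Mem) : Prop where
  hn : σ.ivar 0 = n
  hl : σ.ivar 3 = α + κ
  hL : σ.ivar 4 = 2 ^ (α + κ)
  he : σ.ivar 5 = α + j
  hb : σ.ivar 6 = 2 ^ (α + j)

/-- The numerator (`W = 2`) or denominator (`W = 3`) with index `v` at a level with blocks of length `b`. -/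
noncomputable def part (W b : ℕ) (σ : Mem) (v : ℕ) : ℝ[X] := poly b (shift (σ.rarr W) (v * b))

/-- The tree of fractions represents the sums of the signals at level `j`. -/
def TreeSum (α κ n j : ℕ) (s : ℕ → ℝ) (σ : Mem) : Prop :=
  ∀ x, (∀ k < n, x ≠ s k) → ∀ v < 2 ^ (κ - j),
    (part 3 (2 ^ (α + j)) σ v).eval x ≠ 0 ∧
    (part 2 (2 ^ (α + j)) σ v).eval x = (part 3 (2 ^ (α + j)) σ v).eval x *
      ∑ i ∈ Finset.range (2 ^ j), signal α n s x (v * 2 ^ j + i)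

theorem sizeCmd_runs {ps : List Cmd} (α : ℕ) : ∃ c, ∀ (n : ℕ) (σ : Mem), σ.ivar 0 = n →
    Runs ps (sizeCmd α) σ (c * (α + Nat.clog 2 n + 1)) (fun τ => Below 2 σ τ ∧
      TreeCtx α (Nat.clog 2 n) n 0 τ) := by
  refine ⟨60, fun n σ hn => ?_⟩
  set κ := Nat.clog 2 n with hκ
  apply Runs.le
  case h =>
    unfold sizeCmd
    apply Runs.set (v := 0) rfl
    apply Runs.set (v := 1) rfl
    apply Runs.cons
    refine (Runs.loop (fun i τ => Below 2 σ τ ∧ τ.ivar 5 = i ∧ τ.ivar 6 = 2 ^ i) κ (T := 9) ?_ ?_ ?_).post ?_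
    · rintro i hi τ ⟨h1, h2, h3⟩
      have h4 : 2 ^ i < n := (Nat.lt_clog_iff_pow_lt (by simp)).1 hi
      refine ⟨by simp [h3, h1.ivar, hn, h4], ?_⟩
      apply Runs.le
      case h =>
        apply Runs.set (v := i + 1) (by simp [h2])
        apply Runs.set (v := 2 ^ (i + 1)) (by simp [h3, pow_succ, mul_two])
        exact Runs.nil ⟨(h1.setI (by simp)).setI (by simp), by simp, by simp⟩
      case hT => simp [IExp.cost]
    · rintro τ ⟨h1, h2, h3⟩
      have := Nat.le_pow_clog (b := 2) (by simp) n
      simp [h3, h1.ivar, hn, hκ, this]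
    · exact ⟨((Below.refl 2 σ).setI (by simp)).setI (by simp), by simp, by simp⟩
    rintro τ ⟨h1, h2, h3⟩
    apply Runs.set (v := α + κ) (by simp [h2, add_comm])
    apply Runs.cons
    refine (powCmd_runs 4 (.var 3) (α + κ) _ (by simp) (by simp)).post ?_
    rintro τ2 rfl
    apply Runs.set (v := α) rfl
    apply Runs.set (v := 2 ^ α) rfl
    refine Runs.nil ⟨?_, ?_⟩
    · exact ((((h1.setI (by simp)).setI (by simp)).setI (by simp)).setI (by simp)).setI (by simp)
    · constructor <;> simp [h1.ivar, hn]
  case hT =>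
    simp only [IExp.cost, Test.cost]
    ring_nf
    omega

/-- The denominator `(X - s) ^ α` is expanded by the binomial theorem and fits into `2 ^ α` cells
because `α < 2 ^ α`. The leaves from `n` on are the fraction `0 / 1` and do not change the sum. As
`α` is fixed, a finite case distinction provides the coefficients. -/
theorem leafCmd_runs {ps : List Cmd} (α : ℕ) (hα : 0 < α) : ∃ c, ∀ (κ n : ℕ) (σ : Mem), TreeCtx α κ n 0 σ →
    Runs ps (leafCmd α) σ (c * 2 ^ (α + κ)) (fun τ => Below 2 σ τ ∧ TreeCtx α κ n 0 τ ∧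
      TreeSum α κ n 0 (σ.rarr 0) τ) := by
  refine ⟨2 * fillCost ⟨.var 4, .const (2 ^ α), .const 1, .const 0, .const 0, .const 1⟩ (.const 0) leafNum +
    2 * fillCost ⟨.var 4, .const (2 ^ α), .const 1, .const 0, .const 0, .const 1⟩ (.const 0) (leafDen α) + 1,
    fun κ n σ hσ => ?_⟩
  have hw : 0 < 2 ^ α := by positivity
  have hαw : α < 2 ^ α := Nat.lt_two_pow_self
  have hctx : ∀ W τ, FillEq W σ τ → TreeCtx α κ n 0 τ := fun W τ h =>
    ⟨(h.ivar _ (by simp)).trans hσ.hn, (h.ivar _ (by simp)).trans hσ.hl, (h.ivar _ (by simp)).trans hσ.hL,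
      (h.ivar _ (by simp)).trans hσ.he, (h.ivar _ (by simp)).trans hσ.hb⟩
  have hctx' : ∀ W W' τ τ', FillEq W σ τ → FillEq W' τ τ' → TreeCtx α κ n 0 τ' := fun W W' τ τ' h' h =>
    ⟨(h.ivar _ (by simp)).trans (hctx _ _ h').hn, (h.ivar _ (by simp)).trans (hctx _ _ h').hl,
      (h.ivar _ (by simp)).trans (hctx _ _ h').hL, (h.ivar _ (by simp)).trans (hctx _ _ h').he,
      (h.ivar _ (by simp)).trans (hctx _ _ h').hb⟩
  apply Runs.le
  case h =>
    unfold leafCmd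
    apply Runs.cons
    refine (fill_runs _ 2 (.const 0) leafNum σ ⟨2 ^ (α + κ), 2 ^ α, 1, 0, 0, 1⟩ 0
      (fun p => if p / 2 ^ α < n then if p % 2 ^ α = 0 then 1 else 0 else 0) hw (by simp) ?_ ?_).post ?_
    · intro τ hτ
      exact ⟨⟨(hctx _ _ hτ).hL, rfl, rfl, rfl, rfl, rfl⟩, rfl⟩
    · intro p hp τ hτ hd _
      simp [leafNum, GExp.eval, hd.sg, hd.j, (hctx _ _ hτ).hn]
    rintro τ1 ⟨f1, r1⟩
    apply Runs.cons
    refine (fill_runs _ 3 (.const 0) (leafDen α) τ1 ⟨2 ^ (α + κ), 2 ^ α, 1, 0, 0, 1⟩ 0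
      (fun p => if p / 2 ^ α < n then (0 - σ.rarr 0 (p / 2 ^ α)) ^ (α - p % 2 ^ α) * (α.choose (p % 2 ^ α)) else
        if p % 2 ^ α = 0 then 1 else 0) hw (by simp) ?_ ?_).post ?_
    · intro τ hτ
      exact ⟨⟨(hctx' _ _ _ _ f1 hτ).hL, rfl, rfl, rfl, rfl, rfl⟩, rfl⟩
    · intro p hp τ hτ hd _
      have h101 : τ.ivar 101 < 2 ^ α := by rw [hd.j]; exact Nat.mod_lt _ hw
      simp [leafDen, GExp.eval, pick_eval _ _ _ h101, hd.sg, hd.j, (hctx' _ _ _ _ f1 hτ).hn, hτ.rarr 0,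
        f1.rarr 0]
    rintro τ2 ⟨f2, r2⟩
    refine Runs.nil ⟨(f1.below (by simp) (by simp)).trans (f2.below (by simp) (by simp)),
      hctx' _ _ _ _ f1 f2, ?_⟩
    intro x hx v hv
    simp only [add_zero, pow_zero, mul_one, Finset.range_one, Finset.sum_singleton, tsub_zero] at hv ⊢
    have hlt : ∀ i < 2 ^ α, v * 2 ^ α + i < 2 ^ (α + κ) ∧ (v * 2 ^ α + i) / 2 ^ α = v ∧
        (v * 2 ^ α + i) % 2 ^ α = i := by
      intro i hi
      refine ⟨?_, ?_, ?_⟩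
      · have := Nat.mul_le_mul_right (2 ^ α) (show v + 1 ≤ 2 ^ κ from hv)
        rw [Nat.succ_mul, ← pow_add, add_comm κ] at this
        omega
      · rw [mul_comm, Nat.mul_add_div hw, Nat.div_eq_of_lt hi, add_zero]
      · rw [Nat.mul_add_mod_self_right, Nat.mod_eq_of_lt hi]
    have hnum : part 2 (2 ^ α) τ2 v = if v < n then 1 else 0 := by
      ext i
      rw [part, poly_coeff]
      by_cases hi : i < 2 ^ α
      · obtain ⟨a1, a2, a3⟩ := hlt i hi
        rw [if_pos hi, shift, f2.rarr 2 (by simp), r1, fillFun_zero a1, a2, a3]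
        split_ifs <;> simp [coeff_one, *]
      · rw [if_neg hi]
        split_ifs with h1
        · rw [coeff_one, if_neg (by omega)]
        · simp
    have hden : part 3 (2 ^ α) τ2 v = if v < n then (X - C (σ.rarr 0 v)) ^ α else 1 := by
      ext i
      rw [part, poly_coeff]
      by_cases hi : i < 2 ^ α
      · obtain ⟨a1, a2, a3⟩ := hlt i hi
        rw [if_pos hi, shift, r2, fillFun_zero a1, a2, a3]
        split_ifs with h1 h2
        · rw [sub_eq_add_neg X, ← C_neg, coeff_X_add_C_pow, zero_sub]
        · simp [coeff_one, h2]
        · simp [coeff_one, h2]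
      · rw [if_neg hi]
        split_ifs with h1
        · rw [sub_eq_add_neg X, ← C_neg, coeff_X_add_C_pow, Nat.choose_eq_zero_of_lt (by omega)]
          simp
        · rw [coeff_one, if_neg (by omega)]
    rw [hnum, hden, signal]
    by_cases h1 : v < n
    · have := pow_ne_zero α (sub_ne_zero.2 (hx v h1))
      simp only [h1, if_true, eval_pow, eval_sub, eval_X, eval_C, eval_one]
      exact ⟨this, by field_simp⟩
    · simp [h1]
  case hT =>
    have hL : 1 ≤ 2 ^ (α + κ) := Nat.one_le_two_pow
    generalize fillCost ⟨.var 4, .const (2 ^ α), .const 1, .const 0, .const 0, .const 1⟩ (.const 0) leafNum = d1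
    generalize fillCost ⟨.var 4, .const (2 ^ α), .const 1, .const 0, .const 0, .const 1⟩ (.const 0) (leafDen α) = d2
    dsimp only
    generalize 2 ^ (α + κ) = L at *
    nlinarith

/-- Fractions are added over the product of their denominators, without cancellation. The first
cross product is saved in the array `4`, as the next multiplication overwrites `102`. -/
theorem mergeCmd_runs {ps : List Cmd} (α : ℕ) : ∃ c, ∀ (K R : ℕ), MulBound ps K R → ∀ (κ n j : ℕ) (s : ℕ → ℝ) (σ : Mem),
    TreeCtx α κ n j σ → α + κ ≤ K → j < κ → TreeSum α κ n j s σ →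
    Runs ps mergeCmd σ (c * (R * 2 ^ (α + κ))) (fun τ => Below 2 σ τ ∧ TreeCtx α κ n (j + 1) τ ∧
      TreeSum α κ n (j + 1) s τ) := by
  obtain ⟨c1, hc1⟩ := prodCmd_runs (ps := ps) 2 3 (by simp) (by simp) (.const 0) (.var 6) (.var 4) (.var 6) (.var 5)
  obtain ⟨c2, hc2⟩ := prodCmd_runs (ps := ps) 2 3 (by simp) (by simp) (.var 6) (.const 0) (.var 4) (.var 6) (.var 5)
  obtain ⟨c3, hc3⟩ := prodCmd_runs (ps := ps) 3 3 (by simp) (by simp) (.const 0) (.var 6) (.var 4) (.var 6) (.var 5)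
  refine ⟨c1 + c2 + c3 + 4 * fillCost (flat (.var 4)) (.const 0) (.leaf (.get 102 (.var 100))) +
    2 * fillCost (flat (.var 4)) (.const 0) (.leaf (.add (.get 4 (.var 100)) (.get 102 (.var 100)))) + 20,
    fun K R hR κ n j s σ hσ hK hj hsum => ?_⟩
  have hG : 2 ^ (κ - (j + 1)) * (2 * 2 ^ (α + j)) = 2 ^ (α + κ) := by
    rw [mul_left_comm, ← pow_add, ← pow_succ']
    congr 1
    omega
  have hGpos : 0 < 2 ^ (κ - (j + 1)) := by positivity
  have hκ : 2 ^ (κ - j) = 2 * 2 ^ (κ - (j + 1)) := by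
    rw [← pow_succ']
    congr 1
    omega
  have hb2 : 2 ^ (α + (j + 1)) = 2 * 2 ^ (α + j) := by rw [← add_assoc, pow_succ, mul_comm]
  set L := 2 ^ (α + κ) with hL
  set b := 2 ^ (α + j) with hb
  apply Runs.le
  case h =>
    unfold mergeCmd
    apply Runs.cons
    refine (hc1 K R hR 0 b (α + j) (2 ^ (κ - (j + 1))) σ hGpos (by omega) fun τ hτ => ?_).post ?_
    · simp [hτ.ivar, hσ.he, hσ.hL, hσ.hb, hG, ← hb, ← hL]
    rintro τ1 ⟨b1, p1⟩
    apply Runs.cons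
    refine (flat_runs (.var 4) 4 (.const 0) _ τ1 0 L (fun p => τ1.rarr 102 p) ?_ ?_).post ?_
    · intro τ hτ
      simp [hτ.ivar, b1.ivar, hσ.hL, ← hL]
    · intro p hp τ hτ h100
      simp [GExp.eval, h100, hτ.rarr 102 (by simp)]
    rintro τ2 ⟨f2, r2⟩
    have i2 : ∀ x < 100, τ2.ivar x = σ.ivar x := fun x hx => (f2.ivar x (by omega)).trans (b1.ivar x hx)
    apply Runs.cons
    refine (hc2 K R hR b 0 (α + j) (2 ^ (κ - (j + 1))) τ2 hGpos (by omega) fun τ hτ => ?_).post ?_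
    · simp [hτ.ivar, i2, hσ.he, hσ.hL, hσ.hb, hG, ← hb, ← hL]
    rintro τ3 ⟨b3, p3⟩
    have i3 : ∀ x < 100, τ3.ivar x = σ.ivar x := fun x hx => (b3.ivar x hx).trans (i2 x hx)
    apply Runs.cons
    refine (flat_runs (.var 4) 2 (.const 0) _ τ3 0 L (fun p => τ1.rarr 102 p + τ3.rarr 102 p) ?_ ?_).post ?_
    · intro τ hτ
      simp [hτ.ivar, i3, hσ.hL, ← hL]
    · intro p hp τ hτ h100
      simp [GExp.eval, h100, hτ.rarr 102, hτ.rarr 4, b3.rarr 4, r2, fillFun_zero hp]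
    rintro τ4 ⟨f4, r4⟩
    have i4 : ∀ x < 100, τ4.ivar x = σ.ivar x := fun x hx => (f4.ivar x (by omega)).trans (i3 x hx)
    apply Runs.cons
    refine (hc3 K R hR 0 b (α + j) (2 ^ (κ - (j + 1))) τ4 hGpos (by omega) fun τ hτ => ?_).post ?_
    · simp [hτ.ivar, i4, hσ.he, hσ.hL, hσ.hb, hG, ← hb, ← hL]
    rintro τ5 ⟨b5, p5⟩
    have i5 : ∀ x < 100, τ5.ivar x = σ.ivar x := fun x hx => (b5.ivar x hx).trans (i4 x hx)
    apply Runs.cons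
    refine (flat_runs (.var 4) 3 (.const 0) _ τ5 0 L (fun p => τ5.rarr 102 p) ?_ ?_).post ?_
    · intro τ hτ
      simp [hτ.ivar, i5, hσ.hL, ← hL]
    · intro p hp τ hτ h100
      simp [GExp.eval, h100, hτ.rarr 102]
    rintro τ6 ⟨f6, r6⟩
    have i6 : ∀ x < 100, τ6.ivar x = σ.ivar x := fun x hx => (f6.ivar x (by omega)).trans (i5 x hx)
    apply Runs.set (v := α + (j + 1)) (by simp [i6, hσ.he, add_assoc])
    apply Runs.set (v := 2 ^ (α + (j + 1))) (by simp [i6, hσ.hb, hb2, ← hb, two_mul])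
    refine Runs.nil ⟨?_, ?_, ?_⟩
    · refine Below.setI (Below.setI ?_ (by simp)) (by simp)
      exact ((((((b1.anti (by simp)).trans (f2.below (by simp) (by simp))).trans (b3.anti (by simp))).trans
        (f4.below (by simp) (by simp))).trans (b5.anti (by simp))).trans (f6.below (by simp) (by simp)))
    · constructor <;> simp [i6, hσ.hn, hσ.hl, hσ.hL, ← hL]
    · have q2 : τ2.rarr 2 = σ.rarr 2 := by rw [f2.rarr 2 (by simp), b1.rarr 2 (by simp)]
      have q3 : τ2.rarr 3 = σ.rarr 3 := by rw [f2.rarr 3 (by simp), b1.rarr 3 (by simp)]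
      have q4 : τ4.rarr 3 = σ.rarr 3 := by rw [f4.rarr 3 (by simp), b3.rarr 3 (by simp), q3]
      have q6 : τ6.rarr 2 = τ4.rarr 2 := by rw [f6.rarr 2 (by simp), b5.rarr 2 (by simp)]
      intro x hx v hv
      have hlt : ∀ i < 2 * b, v * (2 * b) + i < L := by
        intro i hi
        have := Nat.mul_le_mul_right (2 * b) (show v + 1 ≤ 2 ^ (κ - (j + 1)) from hv)
        rw [Nat.succ_mul, hG] at this
        omega
      have hA : part 2 (2 * b) τ6 v = part 2 b σ (2 * v) * part 3 b σ (2 * v + 1) +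
          part 2 b σ (2 * v + 1) * part 3 b σ (2 * v) := by
        have h1 := p1 v hv
        have h3 := p3 v hv
        rw [q2, q3] at h3
        calc part 2 (2 * b) τ6 v = poly (2 * b) (fun i => shift (τ1.rarr 102) (v * (2 * b)) i +
              shift (τ3.rarr 102) (v * (2 * b)) i) :=
              poly_congr fun i hi => by rw [shift, q6, r4, fillFun_zero (hlt i hi)]; rfl
          _ = _ := by
              rw [poly_add, h1, h3, part, part, part, part]
              congr 4 <;> ring
      have hD : part 3 (2 * b) τ6 v = part 3 b σ (2 * v) * part 3 b σ (2 * v + 1) := by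
        have h1 := p5 v hv
        rw [q4] at h1
        calc part 3 (2 * b) τ6 v = poly (2 * b) (shift (τ5.rarr 102) (v * (2 * b))) :=
              poly_congr fun i hi => by rw [shift, r6, fillFun_zero (hlt i hi)]; rfl
          _ = _ := by
              rw [h1, part, part]
              congr 3 <;> ring
      obtain ⟨s1, s2⟩ := hsum x hx (2 * v) (by omega)
      obtain ⟨s3, s4⟩ := hsum x hx (2 * v + 1) (by omega)
      rw [← hb] at s1 s2 s3 s4
      rw [hb2]
      have hA' : part 2 (2 * b) ((τ6.setI 5 (α + (j + 1))).setI 6 (2 * b)) v = part 2 (2 * b) τ6 v := rfl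
      have hD' : part 3 (2 * b) ((τ6.setI 5 (α + (j + 1))).setI 6 (2 * b)) v = part 3 (2 * b) τ6 v := rfl
      rw [hA', hD', hA, hD, eval_add, eval_mul, eval_mul, eval_mul, s2, s4]
      refine ⟨mul_ne_zero s1 s3, ?_⟩
      rw [show 2 ^ (j + 1) = 2 ^ j + 2 ^ j by rw [pow_succ, mul_two], Finset.sum_range_add,
        show v * (2 ^ j + 2 ^ j) = 2 * v * 2 ^ j by ring]
      have : ∀ i, signal α n s x (2 * v * 2 ^ j + (2 ^ j + i)) = signal α n s x ((2 * v + 1) * 2 ^ j + i) :=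
        fun i => by congr 1; ring
      simp only [this]
      ring
  case hT =>
    simp only [IExp.cost, ← hb, hG]
    have hLpos : 1 ≤ L := Nat.one_le_two_pow
    have hRV : L ≤ R * L := Nat.le_mul_of_pos_left _ hR.1
    generalize fillCost (flat (.var 4)) (.const 0) (.leaf (.get 102 (.var 100))) = d1
    generalize fillCost (flat (.var 4)) (.const 0) (.leaf (.add (.get 4 (.var 100)) (.get 102 (.var 100)))) = d2
    generalize R * L = V at *
    have h1 : d1 * (L + 1) ≤ d1 * (2 * V) := Nat.mul_le_mul_left _ (by omega)
    have h2 : d2 * (L + 1) ≤ d2 * (2 * V) := Nat.mul_le_mul_left _ (by omega)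
    nlinarith

theorem treeCmd_runs {ps : List Cmd} (α : ℕ) (hα : 0 < α) : ∃ c, ∀ (K R : ℕ), MulBound ps K R →
    ∀ (n l : ℕ) (σ : Mem), σ.ivar 0 = n → l = α + Nat.clog 2 n → l ≤ K →
    Runs ps (treeCmd α) σ (c * ((l + 1) * (R * 2 ^ l))) (fun τ => Below 2 σ τ ∧ τ.ivar 3 = l ∧ τ.ivar 4 = 2 ^ l ∧
      ∀ x, (∀ k < n, x ≠ σ.rarr 0 k) → (poly (2 ^ l) (τ.rarr 3)).eval x ≠ 0 ∧
        (poly (2 ^ l) (τ.rarr 2)).eval x / (poly (2 ^ l) (τ.rarr 3)).eval x =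
          ∑ k ∈ Finset.range n, 1 / (x - σ.rarr 0 k) ^ α) := by
  obtain ⟨c1, hc1⟩ := sizeCmd_runs (ps := ps) α
  obtain ⟨c2, hc2⟩ := leafCmd_runs (ps := ps) α hα
  obtain ⟨c3, hc3⟩ := mergeCmd_runs (ps := ps) α
  refine ⟨c1 + c2 + c3 + 10, fun K R hR n l σ hn hl hK => ?_⟩
  set κ := Nat.clog 2 n with hκ
  subst hl
  apply Runs.le
  case h =>
    unfold treeCmd
    apply Runs.cons
    refine (hc1 n σ hn).post ?_
    rintro τ1 ⟨b1, x1⟩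
    apply Runs.cons
    refine (hc2 κ n τ1 x1).post ?_
    rintro τ2 ⟨b2, x2, s2⟩
    rw [b1.rarr 0 (by simp)] at s2
    apply Runs.cons
    refine (Runs.loop (fun i τ => Below 2 σ τ ∧ TreeCtx α κ n i τ ∧ TreeSum α κ n i (σ.rarr 0) τ) κ
      (T := c3 * (R * 2 ^ (α + κ))) ?_ ?_ ?_).post ?_
    · rintro i hi τ ⟨h1, h2, h3⟩
      refine ⟨by simp [h2.he, h2.hl, hi], (hc3 K R hR κ n i _ τ h2 hK hi h3).post ?_⟩
      rintro υ ⟨h4, h5, h6⟩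
      exact ⟨h1.trans h4, h5, h6⟩
    · rintro τ ⟨h1, h2, h3⟩
      simp [h2.he, h2.hl]
    · exact ⟨b1.trans b2, x2, s2⟩
    rintro τ3 ⟨b3, x3, s3⟩
    refine Runs.nil ⟨b3, x3.hl, x3.hL, fun x hx => ?_⟩
    obtain ⟨h1, h2⟩ := s3 x hx 0 (by simp)
    simp only [part, zero_mul, shift_zero, zero_add] at h1 h2
    refine ⟨h1, ?_⟩
    rw [h2, mul_div_cancel_left₀ _ h1]
    have hle : n ≤ 2 ^ κ := Nat.le_pow_clog (by simp) n
    refine (Finset.sum_subset_zero_on_sdiff (Finset.range_mono hle) ?_ ?_).symm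
    · intro k hk
      simp only [Finset.mem_sdiff, Finset.mem_range] at hk
      rw [signal, if_neg hk.2]
    · intro k hk
      rw [signal, if_pos (Finset.mem_range.1 hk)]
  case hT =>
    simp only [IExp.cost, Test.cost]
    have hLpos : 1 ≤ 2 ^ (α + κ) := Nat.one_le_two_pow
    have hRV : 2 ^ (α + κ) ≤ R * 2 ^ (α + κ) := Nat.le_mul_of_pos_left _ hR.1
    generalize 2 ^ (α + κ) = L at *
    generalize R * L = V at *
    have h0 : κ ≤ κ * V := Nat.le_mul_of_pos_right _ (by omega)
    have h1 : c1 * (α + κ + 1) ≤ c1 * ((α + κ + 1) * V) := Nat.mul_le_mul_left _ (Nat.le_mul_of_pos_right _ (by omega))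
    have h2 : c2 * L ≤ c2 * ((α + κ + 1) * V) := Nat.mul_le_mul_left _ (hRV.trans (Nat.le_mul_of_pos_left _ (by omega)))
    have h3 : κ * (c3 * V) ≤ c3 * ((α + κ + 1) * V) := by
      have : κ * V ≤ (α + κ + 1) * V := Nat.mul_le_mul_right _ (by omega)
      have := Nat.mul_le_mul_left c3 this
      nlinarith
    have h4 : κ + 1 ≤ (α + κ + 1) * V := by
      have : α + κ + 1 ≤ (α + κ + 1) * V := Nat.le_mul_of_pos_right _ (by omega)
      omega
    nlinarith

/-! ### Evaluation of the two polynomials at all receivers -/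

/-- Evaluate the polynomial in the array `W` at the points of the batch. -/
def passCmd (W dst : ℕ) : Cmd := block [
  fill (flat (.var 4)) 6 (.const 0) (.leaf (.get W (.var 100))),
  .call 2,
  fill (flat (.var 4)) dst (.var 8) (.leaf (.get 57 (.var 100)))]

/-- Evaluate numerator and denominator at the points of the batch. -/
def batchBody : Cmd := block [
  .iset 50 (.const 0), .iset 51 (.const 2), .iset 52 (.const 0), .iset 53 (.add (.var 4) (.var 4)),
  fill ⟨.var 53, .const 2, .const 1, .const 0, .const 0, .const 1⟩ 55 (.const 0)
    (.ite (.ile (.var 101) (.const 0)) (.leaf (.const 1))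
      (.leaf (.sub (.const 0) (.get 1 (.add (.var 8) (.var 105)))))),
  passCmd 2 9, passCmd 3 10,
  .iset 8 (.add (.var 8) (.var 4))]

/-- Evaluate numerator and denominator at all receivers. -/
def batchCmd : Cmd := block [.iset 8 (.const 0), .loop (.ilt (.var 8) (.var 1)) batchBody]

theorem passCmd_runs {ps : List Cmd} (h2 : ps[2]? = some evalBody) (W dst : ℕ) (hW : W < 5) (hd : 9 ≤ dst)
    (hd' : dst < 50) : ∃ c, ∀ (K R : ℕ), MulBound ps K R → ∀ (l o : ℕ) (u : ℕ → ℝ) (σ : Mem), l + 1 ≤ K →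
    EvalCtx l 0 σ → σ.ivar 8 = o → (∀ v < 2 ^ l, node l 0 σ v = 1 - C (u v) * X) →
    Runs ps (passCmd W dst) σ (c * ((l + 1) * (R * 2 ^ l))) (fun τ => Below 5 σ τ ∧ EvalCtx l 0 τ ∧
      τ.ivar 8 = o ∧ (∀ v < 2 ^ l, node l 0 τ v = 1 - C (u v) * X) ∧
      (∀ a, a < 50 → a ≠ 6 → a ≠ dst → τ.rarr a = σ.rarr a) ∧
      τ.rarr dst = fillFun (σ.rarr dst) o (2 ^ l) fun p => (poly (2 ^ l) (σ.rarr W)).eval (u p)) := by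
  obtain ⟨c1, hc1⟩ := eval_runs h2
  refine ⟨2 * c1 + 2 * fillCost (flat (.var 4)) (.const 0) (.leaf (.get W (.var 100))) +
    2 * fillCost (flat (.var 4)) (.var 8) (.leaf (.get 57 (.var 100))) + 1,
    fun K R hR l o u σ hl hσ h8 hnode => ?_⟩
  have hLpos : 0 < 2 ^ l := by positivity
  set L := 2 ^ l with hL
  apply Runs.le
  case h =>
    unfold passCmd
    apply Runs.cons
    refine (flat_runs (.var 4) 6 (.const 0) _ σ 0 L (fun p => σ.rarr W p) ?_ ?_).post ?_
    · intro τ hτ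
      simp [hτ.ivar, hσ.hL, ← hL]
    · intro p hp τ hτ h100
      simp [GExp.eval, h100, hτ.rarr W (by omega)]
    rintro τ1 ⟨f1, r1⟩
    have x1 : EvalCtx l 0 τ1 := by
      constructor <;> simp [f1.ivar, hσ.hl, hσ.hL, hσ.ht, hσ.hb, hσ.ho, hσ.hS]
    have n1 : ∀ v, node l 0 τ1 v = node l 0 σ v := fun v => by rw [node, node, f1.rarr 55 (by simp)]
    apply Runs.cons
    refine (hc1 K R hR l hl l 0 τ1 (by simp) x1 fun v hv => ?_).post ?_
    · rw [n1, hnode v hv]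
      refine ⟨?_, by simp⟩
      rw [pow_zero]
      compute_degree
    rintro τ2 ⟨b2, x2, s2, p2⟩
    apply Runs.cons
    refine (flat_runs (.var 4) dst (.var 8) _ τ2 o L (fun p => τ2.rarr 57 p) ?_ ?_).post ?_
    · intro τ hτ
      simp [hτ.ivar, x2.hL, ← hL, b2.ivar, f1.ivar, h8]
    · intro p hp τ hτ h100
      simp [GExp.eval, h100, hτ.rarr 57 (by omega)]
    rintro τ3 ⟨f3, r3⟩
    have n3 : ∀ v < 2 ^ l, node l 0 τ3 v = node l 0 σ v := fun v hv => by
      refine (node_congr (Nat.zero_le l) hv fun x hx => ?_).trans (n1 v)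
      rw [f3.rarr 55 (by omega), s2 x hx]
    refine Runs.nil ⟨?_, ?_, ?_, fun v hv => by rw [n3 v hv, hnode v hv], fun a ha h6 had => ?_, ?_⟩
    · exact ((f1.below (by simp) (by simp)).trans (b2.anti (by simp))).trans (f3.below (by simp) (by omega))
    · constructor <;> simp [f3.ivar, x2.hl, x2.hL, x2.ht, x2.hb, x2.ho, x2.hS]
    · simp [f3.ivar, b2.ivar, f1.ivar, h8]
    · rw [f3.rarr a had, b2.rarr a ha, f1.rarr a h6]
    · rw [r3, b2.rarr dst hd', f1.rarr dst (by omega)]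
      funext x
      simp only [fillFun]
      by_cases hx : o ≤ x ∧ x < o + L
      · rw [if_pos hx, if_pos hx]
        -- At the leaves the window is the single coefficient of index `L - 1`, which is the value
        -- of the polynomial at the point.
        have h3 := p2 (x - o) (by simp only [tsub_zero]; omega) 0 (by simp)
        have hrev : revPoly l τ1 = poly (L - 1 + 1) fun i => σ.rarr W (L - 1 - i) := by
          rw [Nat.sub_add_cancel hLpos, revPoly]
          refine poly_congr fun i hi => ?_
          rw [r1, fillFun_zero (by omega)]
        simp only [pow_zero, mul_one, add_zero] at h3
        rw [h3, n1, hnode (x - o) (by omega), hrev, coeff_quot_linear, poly_eval, ← hL,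
          Nat.sub_add_cancel (show 1 ≤ L from hLpos)]
      · rw [if_neg hx, if_neg hx]
  case hT =>
    have hRV : L ≤ R * L := Nat.le_mul_of_pos_left _ hR.1
    generalize fillCost (flat (.var 4)) (.const 0) (.leaf (.get W (.var 100))) = d1
    generalize fillCost (flat (.var 4)) (.var 8) (.leaf (.get 57 (.var 100))) = d2
    generalize R * L = V at *
    have h0 : V ≤ (l + 1) * V := Nat.le_mul_of_pos_left _ (by omega)
    have h1 : d1 * (L + 1) ≤ d1 * (2 * ((l + 1) * V)) := Nat.mul_le_mul_left _ (by omega)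
    have h2 : d2 * (L + 1) ≤ d2 * (2 * ((l + 1) * V)) := Nat.mul_le_mul_left _ (by omega)
    have h3 : (l + 1 + l) * (c1 * V) ≤ 2 * c1 * ((l + 1) * V) := by
      have : (l + 1 + l) * (c1 * V) ≤ (2 * (l + 1)) * (c1 * V) := Nat.mul_le_mul_right _ (by omega)
      refine this.trans (le_of_eq (by ring))
    nlinarith

theorem batchBody_runs {ps : List Cmd} (h2 : ps[2]? = some evalBody) : ∃ c, ∀ (K R : ℕ), MulBound ps K R →
    ∀ (l o : ℕ) (σ : Mem), l + 1 ≤ K → σ.ivar 3 = l → σ.ivar 4 = 2 ^ l → σ.ivar 8 = o →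
    Runs ps batchBody σ (c * ((l + 1) * (R * 2 ^ l))) (fun τ => Below 5 σ τ ∧ τ.ivar 8 = o + 2 ^ l ∧
      τ.rarr 9 = fillFun (σ.rarr 9) o (2 ^ l) (fun p => (poly (2 ^ l) (σ.rarr 2)).eval (σ.rarr 1 (o + p))) ∧
      τ.rarr 10 = fillFun (σ.rarr 10) o (2 ^ l) fun p => (poly (2 ^ l) (σ.rarr 3)).eval (σ.rarr 1 (o + p))) := by
  obtain ⟨c1, hc1⟩ := passCmd_runs h2 2 9 (by simp) (by simp) (by simp)
  obtain ⟨c2, hc2⟩ := passCmd_runs h2 3 10 (by simp) (by simp) (by simp)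
  refine ⟨c1 + c2 + 3 * fillCost ⟨.var 53, .const 2, .const 1, .const 0, .const 0, .const 1⟩ (.const 0)
    (.ite (.ile (.var 101) (.const 0)) (.leaf (.const 1))
      (.leaf (.sub (.const 0) (.get 1 (.add (.var 8) (.var 105)))))) + 30, fun K R hR l o σ hK hl hL h8 => ?_⟩
  have hLpos : 0 < 2 ^ l := by positivity
  apply Runs.le
  case h =>
    unfold batchBody
    apply Runs.set (v := 0) rfl
    apply Runs.set (v := 2) rfl
    apply Runs.set (v := 0) rfl
    apply Runs.set (v := 2 * 2 ^ l) (by simp [hL, two_mul])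
    set τ0 := (((σ.setI 50 0).setI 51 2).setI 52 0).setI 53 (2 * 2 ^ l) with hτ0
    have b0 : Below 50 σ τ0 := ((((Below.refl 50 σ).setI (by simp)).setI (by simp)).setI (by simp)).setI (by simp)
    have x0 : EvalCtx l 0 τ0 := by constructor <;> simp [hτ0, hl, hL]
    apply Runs.cons
    refine (fill_runs _ 55 (.const 0) _ τ0 ⟨2 * 2 ^ l, 2, 1, 0, 0, 1⟩ 0
      (fun p => if p % 2 = 0 then 1 else 0 - σ.rarr 1 (o + p / 2)) (by simp) (by simp) ?_ ?_).post ?_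
    · intro τ hτ
      exact ⟨⟨(hτ.ivar 53 (by simp)).trans x0.hS, rfl, rfl, rfl, rfl, rfl⟩, rfl⟩
    · intro p hp τ hτ hd _
      simp [GExp.eval, hd.j, hd.sg, hτ.ivar, hτ.rarr 1, hτ0, h8]
    rintro τ1 ⟨f1, r1⟩
    have x1 : EvalCtx l 0 τ1 := by
      constructor <;> simp [f1.ivar, x0.hl, x0.hL, x0.ht, x0.hb, x0.ho, x0.hS]
    have n1 : ∀ v < 2 ^ l, node l 0 τ1 v = 1 - C (σ.rarr 1 (o + v)) * X := by
      intro v hv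
      ext i
      rw [node, poly_coeff, coeff_sub, coeff_C_mul, coeff_one, coeff_X]
      by_cases hi : i < 2 ^ (0 + 1)
      · have hi' : i < 2 := hi
        rw [if_pos hi, shift, r1, fillFun_zero (by norm_num; omega)]
        interval_cases i
        · simp
        · simp [show (v * 2 + 1) / 2 = v by omega]
      · rw [if_neg hi, if_neg (by omega), if_neg (by omega)]
        simp
    apply Runs.cons
    refine (hc1 K R hR l o _ τ1 hK x1 (by simp [f1.ivar, hτ0, h8]) n1).post ?_
    rintro τ2 ⟨b2, x2, o2, n2, s2, r2⟩
    apply Runs.cons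
    refine (hc2 K R hR l o _ τ2 hK x2 o2 n2).post ?_
    rintro τ3 ⟨b3, x3, o3, n3, s3, r3⟩
    apply Runs.set (v := o + 2 ^ l) (by simp [o3, x3.hL])
    refine Runs.nil ⟨?_, by simp, ?_, ?_⟩
    · exact ((((b0.anti (by simp)).trans (f1.below (by simp) (by simp))).trans b2).trans b3).setI (by simp)
    · rw [Mem.setI_rarr, s3 9 (by simp) (by simp) (by simp), r2, f1.rarr 9 (by simp), f1.rarr 2 (by simp),
        b0.rarr 9 (by simp), b0.rarr 2 (by simp)]
    · rw [Mem.setI_rarr, r3, s2 10 (by simp) (by simp) (by simp), s2 3 (by simp) (by simp) (by simp),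
        f1.rarr 10 (by simp), f1.rarr 3 (by simp), b0.rarr 10 (by simp), b0.rarr 3 (by simp)]
  case hT =>
    simp only [IExp.cost]
    have hRV : 2 ^ l ≤ R * 2 ^ l := Nat.le_mul_of_pos_left _ hR.1
    generalize fillCost ⟨.var 53, .const 2, .const 1, .const 0, .const 0, .const 1⟩ (.const 0)
      (.ite (.ile (.var 101) (.const 0)) (.leaf (.const 1))
        (.leaf (.sub (.const 0) (.get 1 (.add (.var 8) (.var 105)))))) = d1
    generalize 2 ^ l = L at *
    generalize R * L = V at *
    have h0 : V ≤ (l + 1) * V := Nat.le_mul_of_pos_left _ (by omega)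
    have h1 : d1 * (2 * L + 1) ≤ d1 * (3 * ((l + 1) * V)) := Nat.mul_le_mul_left _ (by omega)
    nlinarith

theorem batchCmd_runs {ps : List Cmd} (h2 : ps[2]? = some evalBody) : ∃ c, ∀ (K R : ℕ), MulBound ps K R →
    ∀ (l m : ℕ) (σ : Mem), l + 1 ≤ K → σ.ivar 1 = m → σ.ivar 3 = l → σ.ivar 4 = 2 ^ l →
    Runs ps batchCmd σ (c * ((l + 1) * (R * (m + 2 ^ l)))) (fun τ => Below 5 σ τ ∧ ∀ j < m,
      τ.rarr 9 j = (poly (2 ^ l) (σ.rarr 2)).eval (σ.rarr 1 j) ∧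
      τ.rarr 10 j = (poly (2 ^ l) (σ.rarr 3)).eval (σ.rarr 1 j)) := by
  obtain ⟨c1, hc1⟩ := batchBody_runs h2
  refine ⟨c1 + 10, fun K R hR l m σ hK h1 hl hL => ?_⟩
  have hLpos : 0 < 2 ^ l := by positivity
  set L := 2 ^ l with hL'
  -- The number of batches is `m / L` rounded up, so at most `m + L` points are evaluated. The
  -- results for cells past the last receiver are ignored.
  have hB : ∀ i, i < (m + L - 1) / L ↔ i * L < m := by
    intro i
    rw [Nat.lt_iff_add_one_le, Nat.le_div_iff_mul_le hLpos, Nat.succ_mul]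
    omega
  have hB' : (m + L - 1) / L * L ≤ m + L := (Nat.div_mul_le_self _ _).trans (by omega)
  set B := (m + L - 1) / L with hBdef
  apply Runs.le
  case h =>
    unfold batchCmd
    apply Runs.set (v := 0) rfl
    apply Runs.cons
    refine (Runs.loop (fun i τ => Below 5 σ τ ∧ τ.ivar 8 = i * L ∧ ∀ j < i * L,
      τ.rarr 9 j = (poly (2 ^ l) (σ.rarr 2)).eval (σ.rarr 1 j) ∧
      τ.rarr 10 j = (poly (2 ^ l) (σ.rarr 3)).eval (σ.rarr 1 j)) B
      (T := c1 * ((l + 1) * (R * 2 ^ l))) ?_ ?_ ?_).post ?_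
    · rintro i hi τ ⟨b, h8, hr⟩
      refine ⟨by simp [h8, b.ivar, h1, (hB i).1 hi], ?_⟩
      refine (hc1 K R hR l (i * L) τ hK (by simp [b.ivar, hl]) (by simp [b.ivar, hL, hL']) h8).post ?_
      rintro υ ⟨b', h8', r9, r10⟩
      refine ⟨b.trans b', by rw [h8', Nat.succ_mul], fun j hj => ?_⟩
      rw [Nat.succ_mul] at hj
      rw [b.rarr 1 (by simp), b.rarr 2 (by simp)] at r9
      rw [b.rarr 1 (by simp), b.rarr 3 (by simp)] at r10
      by_cases hj' : j < i * L
      · rw [r9, r10, fillFun_below hj', fillFun_below hj']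
        exact hr j hj'
      · obtain ⟨p, rfl⟩ := Nat.exists_eq_add_of_le (not_lt.1 hj')
        rw [r9, r10, fillFun_of_lt (by omega), fillFun_of_lt (by omega)]
        exact ⟨rfl, rfl⟩
    · rintro τ ⟨b, h8, hr⟩
      have := (hB B).not.1 (lt_irrefl B)
      simpa [h8, b.ivar, h1] using this
    · exact ⟨(Below.refl 5 σ).setI (by simp), by simp, by simp⟩
    rintro τ ⟨b, h8, hr⟩
    refine Runs.nil ⟨b, fun j hj => hr j ?_⟩
    have := (hB B).not.1 (lt_irrefl B)
    omega
  case hT =>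
    simp only [IExp.cost, Test.cost]
    have e1 : B * (1 + 1 + 1 + c1 * ((l + 1) * (R * L))) = 3 * B + c1 * ((l + 1) * (R * (B * L))) := by ring
    have h5 : c1 * ((l + 1) * (R * (B * L))) ≤ c1 * ((l + 1) * (R * (m + L))) :=
      Nat.mul_le_mul_left _ (Nat.mul_le_mul_left _ (Nat.mul_le_mul_left _ hB'))
    have h6 : m + L ≤ (l + 1) * (R * (m + L)) :=
      (Nat.le_mul_of_pos_left _ hR.1).trans (Nat.le_mul_of_pos_left _ (by omega))
    have h7 : B ≤ B * L := Nat.le_mul_of_pos_right _ hLpos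
    rw [e1]
    nlinarith

/-! ### Ranks -/

open Classical in
/-- The number of elements of `B` at which `s` is less than `x`. -/
noncomputable def countLT (B : Finset ℕ) (s : ℕ → ℝ) (x : ℝ) : ℕ := (B.filter fun e => s e < x).card

theorem countLT_le (B : Finset ℕ) (s : ℕ → ℝ) (x : ℝ) : countLT B s x ≤ B.card := Finset.card_filter_le _ _

theorem countLT_lt {B : Finset ℕ} {s : ℕ → ℝ} {e : ℕ} (he : e ∈ B) : countLT B s (s e) < B.card := by
  refine Finset.card_lt_card (Finset.filter_ssubset.2 ⟨e, he, lt_irrefl _⟩)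

/-- An element `e` below `x` is counted for `x` but not for itself. This turns comparisons of reals
into comparisons of ranks, for arbitrary `x`. -/
theorem lt_iff_countLT {B : Finset ℕ} {s : ℕ → ℝ} {e : ℕ} (he : e ∈ B) (x : ℝ) :
    s e < x ↔ countLT B s (s e) < countLT B s x := by
  constructor
  · intro h
    refine Finset.card_lt_card ⟨fun k hk => ?_, fun hsub => ?_⟩
    · rw [Finset.mem_filter] at hk ⊢
      exact ⟨hk.1, hk.2.trans h⟩
    · have := hsub (Finset.mem_filter.2 ⟨he, h⟩)
      exact lt_irrefl _ (Finset.mem_filter.1 this).2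
  · intro h
    by_contra hx
    refine absurd (Finset.card_le_card fun k hk => ?_) (not_le.2 h)
    rw [Finset.mem_filter] at hk ⊢
    exact ⟨hk.1, hk.2.trans_le (not_lt.1 hx)⟩

theorem countLT_inj {B : Finset ℕ} {s : ℕ → ℝ} (hs : Set.InjOn s B) {e e' : ℕ} (he : e ∈ B) (he' : e' ∈ B)
    (h : countLT B s (s e) = countLT B s (s e')) : e = e' := by
  refine hs he he' (le_antisymm ?_ ?_)
  · rw [← not_lt, lt_iff_countLT he', h]
    exact lt_irrefl _
  · rw [← not_lt, lt_iff_countLT he, h]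
    exact lt_irrefl _

/-- Distinct elements have distinct ranks below the cardinality, so by counting every rank occurs.
-/
theorem exists_countLT_eq {B : Finset ℕ} {s : ℕ → ℝ} (hs : Set.InjOn s B) {r : ℕ} (hr : r < B.card) :
    ∃ e ∈ B, countLT B s (s e) = r := by
  have h1 : B.image (fun e => countLT B s (s e)) = Finset.range B.card := by
    refine Finset.eq_of_subset_of_card_le (fun k hk => ?_) ?_
    · obtain ⟨e, he, rfl⟩ := Finset.mem_image.1 hk
      exact Finset.mem_range.2 (countLT_lt he)
    · rw [Finset.card_range, Finset.card_image_of_injOn fun e he e' he' h => countLT_inj hs he he' h]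
  have := Finset.mem_range.2 hr
  rw [← h1, Finset.mem_image] at this
  exact this

theorem countLT_disjUnion {A B D : Finset ℕ} (s : ℕ → ℝ) (x : ℝ) (hAB : Disjoint A B) (hD : A ∪ B = D) :
    countLT D s x = countLT A s x + countLT B s x := by
  rw [← hD, countLT, Finset.filter_union, Finset.card_union_of_disjoint]
  · rfl
  · exact Finset.disjoint_filter_filter hAB

/-! ### Binary search -/

/-- The two memories agree except for scalars between `a` and `b`. -/
structure ScalarEq (a b : ℕ) (σ τ : Mem) : Prop where
  ivar : ∀ x, x < a ∨ b ≤ x → τ.ivar x = σ.ivar x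
  iarr : τ.iarr = σ.iarr
  rvar : ∀ x, x < a ∨ b ≤ x → τ.rvar x = σ.rvar x
  rarr : τ.rarr = σ.rarr

theorem ScalarEq.refl (a b : ℕ) (σ : Mem) : ScalarEq a b σ σ := ⟨by simp, rfl, by simp, rfl⟩

theorem ScalarEq.trans {a b : ℕ} {σ τ υ : Mem} (h : ScalarEq a b σ τ) (h' : ScalarEq a b τ υ) : ScalarEq a b σ υ :=
  ⟨fun x hx => (h'.ivar x hx).trans (h.ivar x hx), h'.iarr.trans h.iarr,
    fun x hx => (h'.rvar x hx).trans (h.rvar x hx), h'.rarr.trans h.rarr⟩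

theorem ScalarEq.setI {a b x v : ℕ} {σ τ : Mem} (h : ScalarEq a b σ τ) (hx : a ≤ x ∧ x < b) :
    ScalarEq a b σ (τ.setI x v) :=
  ⟨fun y hy => by simp [h.ivar y hy, show y ≠ x by omega], h.iarr, h.rvar, h.rarr⟩

theorem ScalarEq.setR {a b x : ℕ} {v : ℝ} {σ τ : Mem} (h : ScalarEq a b σ τ) (hx : a ≤ x ∧ x < b) :
    ScalarEq a b σ (τ.setR x v) :=
  ⟨h.ivar, h.iarr, fun y hy => by simp [h.rvar y hy, show y ≠ x by omega], h.rarr⟩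

/-- Find the number `23` of cells among the `22` cells of the index array `20` from `21` on that point to a
number less than the real scalar `20`. -/
def searchCmd : Cmd := block [
  .iset 23 (.const 0),
  .iset 24 (.var 22),
  .loop (.ilt (.var 23) (.var 24)) (block [
    .iset 25 (.half (.add (.var 23) (.var 24))),
    .ite (.rlt (.get 0 (.get 20 (.add (.var 21) (.var 25)))) (.var 20))
      (.iset 23 (.add (.var 25) (.const 1))) (.iset 24 (.var 25))])]

/-- The answer `c` stays between the two ends of the interval, whose length is below `2 ^ j` when
`j` rounds are left; halving preserves this. -/
theorem searchCmd_runs {ps : List Cmd} (st len c d : ℕ) (x : ℝ) (σ : Mem) (h21 : σ.ivar 21 = st)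
    (h22 : σ.ivar 22 = len) (hx : σ.rvar 20 = x) (hc : c ≤ len) (hd : len < 2 ^ d)
    (hthr : ∀ r < len, σ.rarr 0 (σ.iarr 20 (st + r)) < x ↔ r < c) :
    Runs ps searchCmd σ (30 * (d + 1)) (fun τ => ScalarEq 20 26 σ τ ∧ τ.ivar 21 = st ∧ τ.ivar 22 = len ∧
      τ.rvar = σ.rvar ∧ τ.ivar 23 = c) := by
  apply Runs.le
  case h =>
    unfold searchCmd
    apply Runs.set (v := 0) rfl
    apply Runs.set (v := len) (by simp [h22])
    apply Runs.cons
    refine (Runs.loop_variant (T := 20) (fun j τ => (ScalarEq 20 26 σ τ ∧ τ.ivar 21 = st ∧ τ.ivar 22 = len ∧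
      τ.rvar = σ.rvar) ∧ τ.ivar 23 ≤ c ∧ c ≤ τ.ivar 24 ∧ τ.ivar 24 ≤ len ∧ τ.ivar 24 - τ.ivar 23 < 2 ^ j)
      ?_ d ?_).post ?_
    · rintro i τ ⟨⟨h1, h2, h3, h4⟩, h5, h6, h7, h8⟩ hb
      have hb' : τ.ivar 23 < τ.ivar 24 := by simpa using hb
      cases i with
      | zero => rw [pow_zero] at h8; omega
      | succ j =>
      refine ⟨j, rfl, ?_⟩
      rw [pow_succ] at h8
      set mid := (τ.ivar 23 + τ.ivar 24) / 2 with hmid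
      apply Runs.le
      case h =>
        apply Runs.set (v := mid) (by simp [hmid])
        apply Runs.cons
        have ht := hthr mid (by omega)
        apply Runs.ite (T := 4) (U := 2)
        · intro hlt
          simp only [Test.holds_rlt, RExp.eval, IExp.eval, Mem.setI_iarr, Mem.setI_rarr, Mem.setI_rvar,
            Mem.setI_ivar, h1.rarr, h1.iarr, h4, hx, if_true, show (21 : ℕ) ≠ 25 by simp, if_false, h2] at hlt
          have := ht.1 hlt
          refine Runs.iset (Runs.nil ⟨⟨(h1.setI (by simp)).setI (by simp), by simp [h2], by simp [h3], by simp [h4]⟩, ?_⟩)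
          simp
          omega
        · intro hlt
          simp only [Test.holds_rlt, RExp.eval, IExp.eval, Mem.setI_iarr, Mem.setI_rarr, Mem.setI_rvar,
            Mem.setI_ivar, h1.rarr, h1.iarr, h4, hx, if_true, show (21 : ℕ) ≠ 25 by simp, if_false, h2] at hlt
          have := ht.not.1 hlt
          refine Runs.iset (Runs.nil ⟨⟨(h1.setI (by simp)).setI (by simp), by simp [h2], by simp [h3], by simp [h4]⟩, ?_⟩)
          simp
          omega
      case hT => simp [IExp.cost, RExp.cost, Test.cost]
    · refine ⟨⟨((ScalarEq.refl 20 26 σ).setI (by simp)).setI (by simp), by simp [h21], by simp [h22], by simp⟩, ?_⟩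
      simp [hc, hd]
    rintro τ ⟨⟨j, h1, h5, h6, -, -⟩, hb⟩
    have hb' : ¬ τ.ivar 23 < τ.ivar 24 := by simpa using hb
    exact Runs.nil ⟨h1.1, h1.2.1, h1.2.2.1, h1.2.2.2, by omega⟩
  case hT =>
    simp only [IExp.cost, Test.cost]
    omega

/-! ### Sorting by ranks -/

/-- The indices below `n` in the block `b` of length `h`. -/
def blk (n h b : ℕ) : Finset ℕ := (Finset.range n).filter fun e => e / h = b

theorem mem_blk {n h b e : ℕ} : e ∈ blk n h b ↔ e < n ∧ e / h = b := by
  rw [blk, Finset.mem_filter, Finset.mem_range]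

theorem card_blk {n h b : ℕ} (hh : 0 < h) : (blk n h b).card = min h (n - b * h) := by
  have : blk n h b = Finset.Ico (b * h) (min n (b * h + h)) := by
    ext e
    rw [mem_blk, Finset.mem_Ico, Nat.div_eq_iff hh]
    omega
  rw [this, Nat.card_Ico]
  omega

/-- The rank of `e` in its block of length `h`. -/
noncomputable def rk (n h : ℕ) (s : ℕ → ℝ) (e : ℕ) : ℕ := countLT (blk n h (e / h)) s (s e)

/-- The index of the sibling of the block of length `h` that contains `e`. -/
def sib (h e : ℕ) : ℕ := 2 * (e / h / 2) + (1 - e / h % 2)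

theorem rk_lt {n h e : ℕ} {s : ℕ → ℝ} (hh : 0 < h) (he : e < n) : rk n h s e < h := by
  have h1 := countLT_lt (s := s) (mem_blk.2 ⟨he, rfl⟩ : e ∈ blk n h (e / h))
  rw [card_blk hh] at h1
  exact h1.trans_le (min_le_left _ _)

/-- The merging step: a block of double length is the disjoint union of a block and its sibling, so
a binary search in the sorted sibling gives the new rank. -/
theorem rk_double {n h e : ℕ} {s : ℕ → ℝ} :
    rk n (h + h) s e = rk n h s e + countLT (blk n h (sib h e)) s (s e) := by
  refine countLT_disjUnion s (s e) ?_ ?_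
  · rw [Finset.disjoint_left]
    intro k hk hk'
    rw [mem_blk] at hk hk'
    have h1 := hk.2.symm.trans hk'.2
    unfold sib at h1
    omega
  · ext k
    rw [Finset.mem_union, mem_blk, mem_blk, mem_blk, ← mul_two, ← Nat.div_div_eq_div_mul,
      ← Nat.div_div_eq_div_mul, sib]
    omega

/-- Distinct indices have distinct target cells, so rebuilding the sorted list never overwrites an
earlier entry. -/
theorem rk_pos_inj {n h e e' : ℕ} {s : ℕ → ℝ} (hs : Set.InjOn s {k | k < n}) (hh : 0 < h) (he : e < n)
    (he' : e' < n) (heq : e / h * h + rk n h s e = e' / h * h + rk n h s e') : e = e' := by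
  have h1 := rk_lt (s := s) hh he
  have h2 := rk_lt (s := s) hh he'
  have h3 : e / h = e' / h := by
    have := congrArg (· / h) heq
    simpa [mul_comm _ h, Nat.mul_add_div hh, Nat.div_eq_of_lt h1, Nat.div_eq_of_lt h2] using this
  rw [h3, Nat.add_left_cancel_iff, rk, rk, h3] at heq
  refine countLT_inj (fun a ha b hb hab => ?_) (mem_blk.2 ⟨he, h3⟩) (mem_blk.2 ⟨he', rfl⟩) heq
  exact hs (mem_blk.1 ha).1 (mem_blk.1 hb).1 hab

/-- The array `f` lists the indices of each block of length `h` in the order of `s`. -/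
def Indexed (n h : ℕ) (s : ℕ → ℝ) (f : ℕ → ℕ) : Prop := ∀ e < n, f (e / h * h + rk n h s e) = e

/-- The form of sortedness that the binary search requires. -/
theorem Indexed.threshold {n h b r : ℕ} {s : ℕ → ℝ} {f : ℕ → ℕ} (hf : Indexed n h s f)
    (hs : Set.InjOn s {k | k < n}) (hr : r < (blk n h b).card) (x : ℝ) :
    s (f (b * h + r)) < x ↔ r < countLT (blk n h b) s x := by
  obtain ⟨e, he, rfl⟩ := exists_countLT_eq (fun a ha b hb hab => hs (mem_blk.1 ha).1 (mem_blk.1 hb).1 hab) hr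
  obtain ⟨h1, rfl⟩ := mem_blk.1 he
  have := hf e h1
  rw [rk] at this
  rw [this]
  exact lt_iff_countLT he x

/-- Write the indices in the order given by the ranks in the array `21` to the array `20`. -/
def rebuildCmd : Cmd :=
  Sweep.cmd ⟨.var 0, .var 26, .const 1, .const 0, .const 0, .var 26⟩
    (.iput 20 (.add (.var 105) (.get 21 (.var 100))) (.var 100))

/-- Update the rank of one index. -/
def rankBody : Cmd := block [
  .iset 21 (.add (.var 105) (.sub (.var 26) (.var 104))),
  .iset 22 (.sub (.var 0) (.var 21)),
  .ite (.ilt (.var 26) (.var 22)) (.iset 22 (.var 26)) .skip,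
  .rset 20 (.get 0 (.var 100)),
  searchCmd,
  .iput 21 (.var 100) (.add (.get 21 (.var 100)) (.var 23))]

/-- Pass from the ranks in blocks of length `26` to those in blocks of twice that length. -/
def rankCmd : Cmd :=
  Sweep.cmd ⟨.var 0, .var 26, .const 2, .const 0, .var 26, .add (.var 26) (.var 26)⟩ rankBody

/-- Sort the first `0` cells of the real array `0`. -/
def sortCmd : Cmd := block [
  .iset 26 (.const 1),
  (flat (.var 0)).cmd (.iput 21 (.var 100) (.const 0)),
  rebuildCmd,
  .loop (.ilt (.var 26) (.var 0)) (block [rankCmd, .iset 26 (.add (.var 26) (.var 26)), rebuildCmd])]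

/-- The memory `τ` during sorting from the memory `σ`, with blocks of length `h`. -/
structure SortCtx (h : ℕ) (σ τ : Mem) : Prop where
  below : Below 20 σ τ
  size : τ.ivar 26 = h

theorem SortCtx.odoEq {h : ℕ} {σ τ υ : Mem} (hc : SortCtx h σ τ) (e : OdoEq τ υ) : SortCtx h σ υ :=
  ⟨hc.below.trans ⟨fun x hx => e.ivar x (by omega), fun x _ => by rw [e.iarr], fun x _ => by rw [e.rvar],
    fun x _ => by rw [e.rarr]⟩, (e.ivar 26 (by simp)).trans hc.size⟩

theorem SortCtx.scalarEq {h : ℕ} {σ τ υ : Mem} (hc : SortCtx h σ τ) (e : ScalarEq 20 26 τ υ) : SortCtx h σ υ :=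
  ⟨hc.below.trans ⟨fun x hx => e.ivar x (by omega), fun x _ => by rw [e.iarr], fun x hx => e.rvar x (by omega),
    fun x _ => by rw [e.rarr]⟩, (e.ivar 26 (by simp)).trans hc.size⟩

theorem rebuildCmd_runs {ps : List Cmd} : ∃ c, ∀ (n h : ℕ) (σ σ' : Mem), 0 < h → σ.ivar 0 = n →
    Set.InjOn (σ.rarr 0) {k | k < n} → SortCtx h σ σ' → (∀ e < n, σ'.iarr 21 e = rk n h (σ.rarr 0) e) →
    Runs ps rebuildCmd σ' (c * (n + 1)) (fun τ => SortCtx h σ τ ∧ τ.iarr 21 = σ'.iarr 21 ∧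
      Indexed n h (σ.rarr 0) (τ.iarr 20)) := by
  refine ⟨6 + Sweep.cost ⟨.var 0, .var 26, .const 1, .const 0, .const 0, .var 26⟩,
    fun n h σ σ' hh hn hs hσ' hrk => ?_⟩
  refine (Sweep.runs ⟨.var 0, .var 26, .const 1, .const 0, .const 0, .var 26⟩ ⟨n, h, 1, 0, 0, h⟩ hh one_pos 6 σ'
    (fun p τ => SortCtx h σ τ ∧ τ.iarr 21 = σ'.iarr 21 ∧
      ∀ e < p, τ.iarr 20 (e / h * h + rk n h (σ.rarr 0) e) = e) ?_ ?_ ?_ ?_).post ?_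
  · rintro p τ υ e ⟨h1, h2, h3⟩
    exact ⟨h1.odoEq e, by rw [e.iarr, h2], by rw [e.iarr]; exact h3⟩
  · rintro p τ ⟨h1, h2, h3⟩
    exact ⟨(h1.below.ivar 0 (by simp)).trans hn, h1.size, rfl, rfl, rfl, h1.size⟩
  · rintro p hp τ ⟨h1, h2, h3⟩ hd
    have hp' : p < n := hp
    refine Runs.iput ⟨⟨⟨h1.below.putI (by simp), h1.size⟩, by simpa using h2, ?_⟩, ?_⟩
    · intro e he
      have ha : (IExp.add (.var 105) (.get 21 (.var 100))).eval τ = p / h * h + rk n h (σ.rarr 0) p := by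
        simp [hd.sg, hd.pos, h2, hrk p hp']
      rw [ha]
      simp only [Mem.putI_iarr, if_true, IExp.eval, hd.pos, Function.update_apply]
      by_cases hep : e = p
      · rw [hep, if_pos rfl]
      · rw [if_neg fun h' => hep (rk_pos_inj hs hh (by omega) hp' h')]
        exact h3 e (by omega)
    · constructor <;> simp [hd.pos, hd.j, hd.i, hd.sj, hd.si, hd.sg]
  · exact ⟨hσ', rfl, by simp⟩
  · rintro τ ⟨h1, h2, h3⟩
    exact ⟨h1, h2, h3⟩

/-- Ranks can be updated in place: the update for an index reads only its own rank and the index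
list of the previous level, which stays fixed during the sweep. -/
theorem rankCmd_runs {ps : List Cmd} : ∃ c, ∀ (n h d : ℕ) (σ σ' : Mem), 0 < h → σ.ivar 0 = n → n < 2 ^ d →
    Set.InjOn (σ.rarr 0) {k | k < n} → SortCtx h σ σ' → (∀ e < n, σ'.iarr 21 e = rk n h (σ.rarr 0) e) →
    Indexed n h (σ.rarr 0) (σ'.iarr 20) →
    Runs ps rankCmd σ' (c * ((d + 1) * (n + 1))) (fun τ => SortCtx h σ τ ∧
      ∀ e < n, τ.iarr 21 e = rk n (h + h) (σ.rarr 0) e) := by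
  refine ⟨60 + Sweep.cost ⟨.var 0, .var 26, .const 2, .const 0, .var 26, .add (.var 26) (.var 26)⟩,
    fun n h d σ σ' hh hn hd hs hσ' hrk hid => ?_⟩
  refine ((Sweep.runs ⟨.var 0, .var 26, .const 2, .const 0, .var 26, .add (.var 26) (.var 26)⟩
    ⟨n, h, 2, 0, h, h + h⟩ hh (by simp) (30 * (d + 1) + 30) σ'
    (fun p τ => SortCtx h σ τ ∧ τ.iarr 20 = σ'.iarr 20 ∧ (∀ e < p, τ.iarr 21 e = rk n (h + h) (σ.rarr 0) e) ∧
      ∀ e < n, p ≤ e → τ.iarr 21 e = rk n h (σ.rarr 0) e) ?_ ?_ ?_ ?_).post ?_).le ?_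
  · rintro p τ υ e ⟨h1, h2, h3, h4⟩
    exact ⟨h1.odoEq e, by rw [e.iarr, h2], by rw [e.iarr]; exact h3, by rw [e.iarr]; exact h4⟩
  · rintro p τ ⟨h1, h2, h3, h4⟩
    exact ⟨(h1.below.ivar 0 (by simp)).trans hn, h1.size, rfl, rfl, h1.size, by simp [h1.size]⟩
  · rintro p hp τ ⟨h1, h2, h3, h4⟩ hdg
    have hp' : p < n := hp
    -- The counter `104` is `0` in a left block and `h` in a right one, so its complement to `h`
    -- leads to the sibling within the pair that starts at `105`.
    have hst : (IExp.add (.var 105) (.sub (.var 26) (.var 104))).eval τ = sib h p * h := by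
      have : p / h % 2 = 0 ∨ p / h % 2 = 1 := by omega
      simp only [IExp.eval, hdg.sg, hdg.si, h1.size, sib]
      rcases this with h0 | h0 <;> simp [h0, add_mul] <;> ring
    have hcard := card_blk (n := n) (b := sib h p) hh
    set st := sib h p * h with hstdef
    -- The last sibling may be incomplete, or lie beyond `n`, where truncated subtraction makes it
    -- empty.
    set len := min h (n - st) with hlen
    have h0n : ∀ υ, Below 20 σ υ → υ.ivar 0 = n := fun υ hυ => (hυ.ivar 0 (by simp)).trans hn
    have key : ∀ υ, ScalarEq 20 26 τ υ → υ.ivar 21 = st → υ.ivar 22 = len → Runs ps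
        (block [.rset 20 (.get 0 (.var 100)), searchCmd,
          .iput 21 (.var 100) (.add (.get 21 (.var 100)) (.var 23))]) υ (30 * (d + 1) + 12) (fun τ =>
          (SortCtx h σ τ ∧ τ.iarr 20 = σ'.iarr 20 ∧ (∀ e < p + 1, τ.iarr 21 e = rk n (h + h) (σ.rarr 0) e) ∧
          ∀ e < n, p + 1 ≤ e → τ.iarr 21 e = rk n h (σ.rarr 0) e) ∧ Shape.Digits ⟨n, h, 2, 0, h, h + h⟩ p τ) := by
      intro υ hυ h21 h22
      apply Runs.le
      case h =>
        apply Runs.cons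
        apply Runs.rset
        have e1 : ScalarEq 20 26 τ (υ.setR 20 ((RExp.get 0 (.var 100)).eval υ)) := hυ.setR (by simp)
        apply Runs.cons
        refine (searchCmd_runs st len (countLT (blk n h (sib h p)) (σ.rarr 0) (σ.rarr 0 p)) d (σ.rarr 0 p) _
          (by simp [h21]) (by simp [h22]) ?_ ?_ ?_ ?_).post ?_
        · simp [hυ.rarr, hυ.ivar 100, hdg.pos, h1.below.rarr 0]
        · rw [← hcard]
          exact countLT_le _ _ _
        · exact ((min_le_right _ _).trans (Nat.sub_le _ _)).trans_lt hd
        · intro r hr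
          rw [e1.rarr, e1.iarr, h2, h1.below.rarr 0 (by simp)]
          exact hid.threshold hs (by rw [hcard]; exact hr) _
        rintro ω ⟨e2, -, -, -, e3⟩
        have e4 := e1.trans e2
        apply Runs.cons
        apply Runs.iput
        refine Runs.nil ⟨⟨?_, ?_, ?_, ?_⟩, ?_⟩
        · have := h1.scalarEq e4
          exact ⟨this.below.putI (by simp), this.size⟩
        · simpa [e4.iarr] using h2
        · intro e he
          simp only [Mem.putI_iarr, if_true, IExp.eval, Function.update_apply, e4.ivar 100 (by simp), hdg.pos, e3]
          by_cases hep : e = p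
          · rw [if_pos hep, e4.iarr, h4 p hp' le_rfl, hep, rk_double]
          · rw [if_neg hep, e4.iarr]
            exact h3 e (by omega)
        · intro e he hpe
          simp only [Mem.putI_iarr, if_true, IExp.eval, Function.update_apply, e4.ivar 100 (by simp), hdg.pos, e3]
          rw [if_neg (by omega), e4.iarr]
          exact h4 e he (by omega)
        · constructor <;> simp [e4.ivar, hdg.pos, hdg.j, hdg.i, hdg.sj, hdg.si, hdg.sg]
      case hT =>
        simp only [IExp.cost, RExp.cost]
        omega
    apply Runs.le
    case h =>
      unfold rankBody
      apply Runs.set hst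
      have e1 : ScalarEq 20 26 τ (τ.setI 21 st) := (ScalarEq.refl 20 26 τ).setI (by simp)
      have e2 : ScalarEq 20 26 τ ((τ.setI 21 st).setI 22 (n - st)) := e1.setI (by simp)
      have x2 := h1.scalarEq e2
      apply Runs.set (v := n - st) (by simp [h0n τ h1.below])
      apply Runs.cons
      apply Runs.ite (T := 2) (U := 1)
      · intro hb
        have hb' : h < n - st := by simpa [h1.size] using hb
        refine Runs.iset (key _ (e2.setI (by simp)) (by simp) ?_)
        simp [h1.size]
        omega
      · intro hb
        have hb' : ¬ h < n - st := by simpa [h1.size] using hb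
        refine Runs.skip (key _ e2 (by simp) ?_)
        simp
        omega
    case hT =>
      simp only [IExp.cost, Test.cost]
      omega
  · exact ⟨hσ', rfl, by simp, fun e he _ => hrk e he⟩
  · rintro τ ⟨h1, h2, h3, -⟩
    exact ⟨h1, h3⟩
  · dsimp only
    generalize Sweep.cost ⟨.var 0, .var 26, .const 2, .const 0, .var 26, .add (.var 26) (.var 26)⟩ = w
    have h1 : 30 * (d + 1) + 30 + w ≤ (60 + w) * (d + 1) := by nlinarith
    rw [← mul_assoc]
    exact Nat.mul_le_mul_right _ h1

theorem sortCmd_runs {ps : List Cmd} : ∃ c, ∀ (n : ℕ) (σ : Mem), σ.ivar 0 = n →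
    Set.InjOn (σ.rarr 0) {k | k < n} →
    Runs ps sortCmd σ (c * ((Nat.clog 2 n + 2) ^ 2 * (n + 1))) (fun τ => Below 20 σ τ ∧
      ∀ e < n, τ.iarr 20 (countLT (Finset.range n) (σ.rarr 0) (σ.rarr 0 e)) = e) := by
  obtain ⟨c1, hc1⟩ := rebuildCmd_runs (ps := ps)
  obtain ⟨c2, hc2⟩ := rankCmd_runs (ps := ps)
  refine ⟨c1 + c2 + Sweep.cost (flat (.var 0)) + 20, fun n σ hn hs => ?_⟩
  set κ := Nat.clog 2 n with hκ
  have hle : n ≤ 2 ^ κ := Nat.le_pow_clog (by simp) n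
  have hd : n < 2 ^ (κ + 1) := by
    rw [pow_succ]
    have : 0 < 2 ^ κ := by positivity
    omega
  apply Runs.le
  case h =>
    unfold sortCmd
    apply Runs.set (v := 1) rfl
    have x0 : SortCtx 1 σ (σ.setI 26 1) := ⟨(Below.refl 20 σ).setI (by simp), by simp⟩
    apply Runs.cons
    refine (Sweep.runs (flat (.var 0)) ⟨n, 1, 1, 0, 0, 0⟩ one_pos one_pos 3 _
      (fun p τ => SortCtx 1 σ τ ∧ ∀ e < p, τ.iarr 21 e = 0) ?_ ?_ ?_ ?_).post ?_
    · rintro p τ υ e ⟨h1, h2⟩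
      exact ⟨h1.odoEq e, by rw [e.iarr]; exact h2⟩
    · rintro p τ ⟨h1, h2⟩
      exact ⟨(h1.below.ivar 0 (by simp)).trans hn, rfl, rfl, rfl, rfl, rfl⟩
    · rintro p hp τ ⟨h1, h2⟩ hd
      refine Runs.iput ⟨⟨⟨h1.below.putI (by simp), h1.size⟩, ?_⟩, ?_⟩
      · intro e he
        simp only [Mem.putI_iarr, if_true, IExp.eval, hd.pos, Function.update_apply]
        by_cases hep : e = p
        · rw [if_pos hep]
        · rw [if_neg hep]
          exact h2 e (by omega)
      · constructor <;> simp [hd.pos, hd.j, hd.i, hd.sj, hd.si, hd.sg]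
    · exact ⟨x0, by simp⟩
    rintro τ1 ⟨x1, r1⟩
    apply Runs.cons
    refine (hc1 n 1 σ τ1 one_pos hn hs x1 fun e he => ?_).post ?_
    · have := rk_lt (s := σ.rarr 0) one_pos he
      rw [r1 e he]
      omega
    rintro τ2 ⟨x2, r2, i2⟩
    apply Runs.cons
    refine (Runs.loop (fun i τ => SortCtx (2 ^ i) σ τ ∧ (∀ e < n, τ.iarr 21 e = rk n (2 ^ i) (σ.rarr 0) e) ∧
      Indexed n (2 ^ i) (σ.rarr 0) (τ.iarr 20)) κ
      (T := c2 * ((κ + 1 + 1) * (n + 1)) + (4 + (c1 * (n + 1) + 1))) ?_ ?_ ?_).post ?_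
    · rintro i hi τ ⟨h1, h2, h3⟩
      have h4 : 2 ^ i < n := (Nat.lt_clog_iff_pow_lt (by simp)).1 hi
      refine ⟨by simp [h1.size, h1.below.ivar 0, hn, h4], ?_⟩
      refine Runs.cons ((hc2 n (2 ^ i) (κ + 1) σ τ (by positivity) hn hd hs h1 h2 h3).post ?_)
      rintro υ ⟨h5, h6⟩
      rw [← mul_two, ← pow_succ] at h6
      have e4 : Runs ps (block [.iset 26 (.add (.var 26) (.var 26)), rebuildCmd]) υ
          ((IExp.add (.var 26) (.var 26)).cost + 1 + (c1 * (n + 1) + 1)) (fun τ => SortCtx (2 ^ (i + 1)) σ τ ∧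
            (∀ e < n, τ.iarr 21 e = rk n (2 ^ (i + 1)) (σ.rarr 0) e) ∧
            Indexed n (2 ^ (i + 1)) (σ.rarr 0) (τ.iarr 20)) := by
        apply Runs.set (v := 2 ^ (i + 1)) (by simp [h5.size, pow_succ, mul_two])
        apply Runs.cons
        refine (hc1 n (2 ^ (i + 1)) σ _ (by positivity) hn hs ⟨h5.below.setI (by simp), by simp⟩ h6).post ?_
        rintro ω ⟨h7, h8, h9⟩
        exact Runs.nil ⟨h7, fun e he => by rw [h8]; exact h6 e he, h9⟩
      exact e4
    · rintro τ ⟨h1, h2, h3⟩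
      simp [h1.size, h1.below.ivar 0, hn, hle]
    · refine ⟨x2, fun e he => ?_, i2⟩
      have := rk_lt (s := σ.rarr 0) one_pos he
      rw [r2, r1 e he, pow_zero]
      omega
    rintro τ3 ⟨x3, -, i3⟩
    refine Runs.nil ⟨x3.below, fun e he => ?_⟩
    have h1 := i3 e he
    have h2 : e / 2 ^ κ = 0 := Nat.div_eq_of_lt (by omega)
    -- As `n ≤ 2 ^ κ`, a single block is left and the ranks are global.
    have h3 : blk n (2 ^ κ) 0 = Finset.range n := by
      ext k
      rw [mem_blk, Finset.mem_range]
      exact ⟨fun h => h.1, fun h => ⟨h, Nat.div_eq_of_lt (by omega)⟩⟩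
    rw [rk, h2, h3, zero_mul, zero_add] at h1
    exact h1
  case hT =>
    simp only [IExp.cost, Test.cost]
    generalize Sweep.cost (flat (.var 0)) = w
    have e1 : (κ + 2) ^ 2 = κ * (κ + 2) + 2 * κ + 4 := by ring
    have e2 : κ * (c2 * ((κ + 1 + 1) * (n + 1))) = c2 * (κ * (κ + 2) * (n + 1)) := by ring
    rw [e1]
    nlinarith [Nat.zero_le (κ * (κ + 2) * (n + 1)), Nat.zero_le (w * (κ * (κ + 2) * (n + 1))), Nat.zero_le (κ * (n + 1)),
      Nat.zero_le (c1 * (κ * (κ + 2) * (n + 1))), Nat.zero_le (c2 * (κ * (n + 1))), Nat.zero_le (w * (κ * (n + 1))),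
      Nat.zero_le (c1 * (κ * (n + 1))), Nat.zero_le (w * (n + 1)), Nat.zero_le (c1 * (n + 1)), Nat.zero_le (c2 * (n + 1)),
      Nat.zero_le (κ * n)]

/-! ### The transmitter that a receiver can hear -/

/-- Reception of transmitter `k` at the point `q`. -/
def Heard (α n : ℕ) (β N : ℝ) (s : ℕ → ℝ) (q : ℝ) (k : ℕ) : Prop :=
  q = s k ∨ (∀ j < n, q ≠ s j) ∧
    β ≤ 1 / (q - s k) ^ α / (∑ j ∈ Finset.range n, 1 / (q - s j) ^ α - 1 / (q - s k) ^ α + N)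

section Heard

variable {α n : ℕ} {β N : ℝ} {s : ℕ → ℝ} {q : ℝ}

theorem one_div_pow_pos (hα : Even α) {x y : ℝ} (h : x ≠ y) : 0 < 1 / (x - y) ^ α :=
  one_div_pos.2 (hα.pow_pos (sub_ne_zero.2 h))

/-- The signal that is heard is at least `β > 1` times noise plus interference, and every other
signal is one summand of the interference. -/
theorem signal_lt (hα : Even α) (hβ : 1 < β) (hN : 0 < N) (hq : ∀ j < n, q ≠ s j) {k e : ℕ} (hk : k < n)
    (he : e < n) (hke : e ≠ k)
    (h : β ≤ 1 / (q - s k) ^ α / (∑ j ∈ Finset.range n, 1 / (q - s j) ^ α - 1 / (q - s k) ^ α + N)) :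
    1 / (q - s e) ^ α < 1 / (q - s k) ^ α := by
  have h1 : 1 / (q - s e) ^ α ≤ ∑ j ∈ Finset.range n, 1 / (q - s j) ^ α - 1 / (q - s k) ^ α := by
    rw [← Finset.sum_erase_eq_sub (Finset.mem_range.2 hk)]
    refine Finset.single_le_sum (f := fun j => 1 / (q - s j) ^ α) (fun j hj => ?_)
      (Finset.mem_erase.2 ⟨hke, Finset.mem_range.2 he⟩)
    exact (one_div_pow_pos hα (hq j (Finset.mem_range.1 (Finset.mem_of_mem_erase hj)))).le
  have h2 := one_div_pow_pos hα (hq e he)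
  rw [le_div_iff₀ (by linarith)] at h
  nlinarith

theorem Heard.unique (hα : Even α) (hβ : 1 < β) (hN : 0 < N) (hs : Set.InjOn s {k | k < n}) {k e : ℕ}
    (hk : k < n) (he : e < n) (h : Heard α n β N s q k) (h' : Heard α n β N s q e) : k = e := by
  by_contra hne
  rcases h with h | ⟨hq, h⟩
  · rcases h' with h' | ⟨hq, h'⟩
    · exact hne (hs hk he (h.symm.trans h'))
    · exact hq k hk h
  · rcases h' with h' | ⟨-, h'⟩
    · exact hq e he h'
    · exact lt_asymm (signal_lt hα hβ hN hq hk he (Ne.symm hne) h) (signal_lt hα hβ hN hq he hk hne h')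

/-- By `signal_lt` the transmitter that is heard is strictly nearest. If it lies to the right of
`q`, none lies strictly between, so it has the rank `c` of `q` itself; if it lies to the left, it
has rank `c - 1`. -/
theorem Heard.near (hα : Even α) (hβ : 1 < β) (hN : 0 < N) (hs : Set.InjOn s {k | k < n}) {f : ℕ → ℕ}
    (hf : ∀ e < n, f (countLT (Finset.range n) s (s e)) = e) (hq : ∀ j < n, q ≠ s j) {k : ℕ} (hk : k < n)
    (h : Heard α n β N s q k) : (countLT (Finset.range n) s q < n ∧ f (countLT (Finset.range n) s q) = k) ∨
      (0 < countLT (Finset.range n) s q ∧ f (countLT (Finset.range n) s q - 1) = k) := by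
  have hs' : Set.InjOn s (Finset.range n : Set ℕ) := fun a ha b hb hab =>
    hs (Finset.mem_range.1 ha) (Finset.mem_range.1 hb) hab
  have hβ' := (h.resolve_left (hq k hk)).2
  have hck := countLT_le (Finset.range n) s q
  rw [Finset.card_range] at hck
  have hfar : ∀ e < n, e ≠ k → |q - s k| < |q - s e| := by
    intro e he hek
    have h1 := signal_lt hα hβ hN hq hk he hek hβ'
    by_contra hle
    refine absurd h1 (not_lt.2 ?_)
    rw [← hα.pow_abs (q - s e), ← hα.pow_abs (q - s k)]
    exact one_div_le_one_div_of_le (pow_pos (abs_pos.2 (sub_ne_zero.2 (hq e he))) _)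
      (pow_le_pow_left₀ (abs_nonneg _) (not_lt.1 hle) _)
  rcases lt_or_gt_of_ne (hq k hk) with hlt | hgt
  · left
    have h1 := (lt_iff_countLT (Finset.mem_range.2 hk) q).not.1 (not_lt.2 hlt.le)
    have h2 := countLT_lt (s := s) (Finset.mem_range.2 hk)
    rw [Finset.card_range] at h2
    have hc : countLT (Finset.range n) s q < n := by omega
    refine ⟨hc, ?_⟩
    obtain ⟨e, he, hec⟩ := exists_countLT_eq hs' (r := countLT (Finset.range n) s q) (by simpa using hc)
    have he' := Finset.mem_range.1 he
    rw [← hec, hf e he']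
    by_contra hek
    have h3 : ¬ s e < q := (lt_iff_countLT he q).not.2 (by omega)
    have h4 := hfar e he' hek
    rw [abs_of_neg (by linarith), abs_of_nonpos (by linarith)] at h4
    have h5 := (lt_iff_countLT (Finset.mem_range.2 hk) (s e)).1 (by linarith)
    omega
  · right
    have h1 := (lt_iff_countLT (Finset.mem_range.2 hk) q).1 hgt
    refine ⟨by omega, ?_⟩
    obtain ⟨e, he, hec⟩ := exists_countLT_eq hs' (r := countLT (Finset.range n) s q - 1)
      (by rw [Finset.card_range]; omega)
    have he' := Finset.mem_range.1 he
    rw [← hec, hf e he']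
    by_contra hek
    have h3 : s e < q := (lt_iff_countLT he q).2 (by omega)
    have h4 := hfar e he' hek
    rw [abs_of_pos (by linarith), abs_of_pos (by linarith)] at h4
    have h5 := (lt_iff_countLT he (s k)).1 (by linarith)
    omega

end Heard

/-! ### The answer for each receiver -/

/-- Test whether transmitter `41` is received. -/
def testCmd (α : ℕ) : Cmd := block [
  .rset 22 (.div (.const 1) (.pow (.sub (.var 20) (.get 0 (.var 41))) α)),
  .ite (.rle (.var 0) (.div (.var 22) (.add (.sub (.var 21) (.var 22)) (.var 1))))
    (.iset 40 (.add (.var 41) (.const 1))) .skip]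

/-- Find the transmitter that is received. -/
def answerBody (α : ℕ) : Cmd := block [
  .rset 20 (.get 1 (.var 100)),
  .rset 21 (.div (.get 9 (.var 100)) (.get 10 (.var 100))),
  .iset 21 (.const 0), .iset 22 (.var 0), .iset 40 (.const 0), searchCmd,
  .ite (.ilt (.var 23) (.var 0)) (block [
    .iset 41 (.get 20 (.var 23)),
    .ite (.rle (.get 0 (.var 41)) (.var 20)) (.iset 40 (.add (.var 41) (.const 1))) (testCmd α)]) .skip,
  .ite (.ilt (.const 0) (.var 40)) .skip (.ite (.ilt (.const 0) (.var 23)) (block [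
    .iset 41 (.get 20 (.sub (.var 23) (.const 1))), testCmd α]) .skip),
  .iput 0 (.var 100) (.var 40)]

/-- Find the transmitter that is received, for each receiver. -/
def answerCmd (α : ℕ) : Cmd := (flat (.var 1)).cmd (answerBody α)

/-- Time for a test. -/
def testCost (α : ℕ) : ℕ :=
  (RExp.div (.const 1) (.pow (.sub (.var 20) (.get 0 (.var 41))) α)).cost + 20

theorem ScalarEq.mono {a b a' b' : ℕ} {σ τ : Mem} (h : ScalarEq a b σ τ) (ha : a' ≤ a) (hb : b ≤ b') :
    ScalarEq a' b' σ τ :=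
  ⟨fun x hx => h.ivar x (by omega), h.iarr, fun x hx => h.rvar x (by omega), h.rarr⟩

/-- The number `v` denotes the transmitter that is received. -/
def Answers (α n : ℕ) (β N : ℝ) (s : ℕ → ℝ) (q : ℝ) (v : ℕ) : Prop :=
  (v = 0 ∧ ∀ k < n, ¬ Heard α n β N s q k) ∨ ∃ k < n, v = k + 1 ∧ Heard α n β N s q k

theorem testCmd_runs {ps : List Cmd} (α n k : ℕ) (β N : ℝ) (s : ℕ → ℝ) (q : ℝ) (σ : Mem) (hk : σ.ivar 41 = k)
    (hq : ∀ j < n, q ≠ s j) (h0 : σ.rvar 0 = β) (h1 : σ.rvar 1 = N) (h20 : σ.rvar 20 = q)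
    (h21 : σ.rvar 21 = ∑ j ∈ Finset.range n, 1 / (q - s j) ^ α) (hs : σ.rarr 0 = s) (hkn : k < n) :
    Runs ps (testCmd α) σ (testCost α) (fun τ => ScalarEq 20 50 σ τ ∧ τ.ivar 23 = σ.ivar 23 ∧
      τ.rvar 20 = q ∧ τ.rvar 21 = σ.rvar 21 ∧
      ((Heard α n β N s q k ∧ τ.ivar 40 = k + 1) ∨ (¬ Heard α n β N s q k ∧ τ.ivar 40 = σ.ivar 40))) := by
  have hh : Heard α n β N s q k ↔
      β ≤ 1 / (q - s k) ^ α / (∑ j ∈ Finset.range n, 1 / (q - s j) ^ α - 1 / (q - s k) ^ α + N) :=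
    ⟨fun h => (h.resolve_left (hq k hkn)).2, fun h => Or.inr ⟨hq, h⟩⟩
  apply Runs.le
  case h =>
    unfold testCmd
    apply Runs.cons
    apply Runs.rset
    have e1 : ScalarEq 20 50 σ (σ.setR 22
        ((RExp.div (.const 1) (.pow (.sub (.var 20) (.get 0 (.var 41))) α)).eval σ)) :=
      (ScalarEq.refl 20 50 σ).setR (by simp)
    apply Runs.cons
    apply Runs.ite (T := 4) (U := 1)
    · intro hb
      refine Runs.iset (Runs.nil ⟨e1.setI (by simp), by simp, by simp [h20], by simp, Or.inl ⟨hh.2 ?_, by simp [hk]⟩⟩)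
      simpa [h0, h1, h20, h21, hs, hk] using hb
    · intro hb
      refine Runs.skip (Runs.nil ⟨e1, by simp, by simp [h20], by simp, Or.inr ⟨fun h => hb ?_, by simp⟩⟩)
      simpa [h0, h1, h20, h21, hs, hk] using hh.1 h
  case hT =>
    simp only [RExp.cost, Test.cost, testCost]
    omega

/-- Coincidence with a transmitter must be excluded before the SINR test, because the quotient of
the two evaluated polynomials equals the total signal only away from the transmitters. -/
theorem answerBody_runs {ps : List Cmd} (α n d : ℕ) (hα : Even α) (β N : ℝ) (hβ : 1 < β) (hN : 0 < N) (s : ℕ → ℝ)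
    (q : ℝ) (j : ℕ) (σ : Mem) (hn : σ.ivar 0 = n) (hd : n < 2 ^ d) (hs : Set.InjOn s {k | k < n})
    (hs0 : σ.rarr 0 = s) (h0 : σ.rvar 0 = β) (h1 : σ.rvar 1 = N) (hj : σ.ivar 100 = j) (hq : σ.rarr 1 j = q)
    (hsum : (∀ k < n, q ≠ s k) → σ.rarr 9 j / σ.rarr 10 j = ∑ k ∈ Finset.range n, 1 / (q - s k) ^ α)
    (hf : ∀ e < n, σ.iarr 20 (countLT (Finset.range n) s (s e)) = e) :
    Runs ps (answerBody α) σ (30 * (d + 1) + 2 * testCost α + 80) (fun τ => ∃ υ, ScalarEq 20 50 σ υ ∧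
      ∃ v, τ = υ.putI 0 j v ∧ Answers α n β N s q v) := by
  set c := countLT (Finset.range n) s q with hc
  have hcn : c ≤ n := (countLT_le _ _ _).trans (by simp)
  have hs' : Set.InjOn s (Finset.range n : Set ℕ) := fun a ha b hb hab =>
    hs (Finset.mem_range.1 ha) (Finset.mem_range.1 hb) hab
  have hfr : ∀ r < n, ∃ e < n, σ.iarr 20 r = e ∧ countLT (Finset.range n) s (s e) = r := by
    intro r hr
    obtain ⟨e, he, rfl⟩ := exists_countLT_eq hs' (r := r) (by simpa using hr)
    exact ⟨e, Finset.mem_range.1 he, hf e (Finset.mem_range.1 he), rfl⟩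
  -- If `q` were the position of some transmitter, that transmitter would have rank `c`. So the
  -- entry at index `c` alone decides about coincidence.
  have hne : (∀ e < n, σ.iarr 20 c = e → c < n → q < s e) → ∀ k < n, q ≠ s k := by
    intro h k hk hqk
    have h2 := hf k hk
    have h3 := countLT_lt (s := s) (Finset.mem_range.2 hk)
    rw [← hqk, ← hc] at h2 h3
    exact absurd (h k hk h2 (by simpa using h3)) (by rw [hqk]; exact lt_irrefl _)
  have last : ∀ υ, ScalarEq 20 50 σ υ → Answers α n β N s q (υ.ivar 40) →
      Runs ps (block [.iput 0 (.var 100) (.var 40)]) υ 4 (fun τ => ∃ υ, ScalarEq 20 50 σ υ ∧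
        ∃ v, τ = υ.putI 0 j v ∧ Answers α n β N s q v) := by
    intro υ e h
    apply Runs.le
    case h =>
      apply Runs.cons
      apply Runs.iput
      refine Runs.nil ⟨υ, e, υ.ivar 40, ?_, h⟩
      simp [e.ivar 100, hj]
    case hT => simp [IExp.cost]
  have rest : ∀ υ, ScalarEq 20 50 σ υ → υ.ivar 23 = c → υ.rvar 20 = q → υ.rvar 21 = σ.rarr 9 j / σ.rarr 10 j →
      ((υ.ivar 40 = 0 ∧ (∀ k < n, q ≠ s k) ∧ ∀ k < n, c < n → σ.iarr 20 c = k → ¬ Heard α n β N s q k) ∨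
        ∃ k < n, υ.ivar 40 = k + 1 ∧ Heard α n β N s q k) →
      Runs ps (block [.ite (.ilt (.const 0) (.var 40)) .skip (.ite (.ilt (.const 0) (.var 23)) (block [
        .iset 41 (.get 20 (.sub (.var 23) (.const 1))), testCmd α]) .skip),
        .iput 0 (.var 100) (.var 40)]) υ (testCost α + 30) (fun τ => ∃ υ, ScalarEq 20 50 σ υ ∧
        ∃ v, τ = υ.putI 0 j v ∧ Answers α n β N s q v) := by
    intro υ e h23 h20 h21 h40
    apply Runs.le
    case h =>
      apply Runs.cons
      apply Runs.ite (T := 1) (U := testCost α + 20)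
      · intro hb
        have hb' : 0 < υ.ivar 40 := by simpa using hb
        exact Runs.skip (last υ e (Or.inr (h40.resolve_left fun h => by omega)))
      · intro hb
        have hb' : ¬ 0 < υ.ivar 40 := by simpa using hb
        obtain ⟨h0', hqs, hc'⟩ := h40.resolve_right (by rintro ⟨k, -, h, -⟩; omega)
        apply Runs.le
        case h =>
          apply Runs.ite (T := testCost α + 10) (U := 1)
          · intro hb
            have hpos : 0 < c := by simpa [h23] using hb
            obtain ⟨k, hk, h2, h3⟩ := hfr (c - 1) (by omega)
            apply Runs.le
            case h =>
              apply Runs.set (v := k) (by simp [h23, e.iarr, h2])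
              have e1 : ScalarEq 20 50 σ (υ.setI 41 k) := e.setI (by simp)
              apply Runs.cons
              refine (testCmd_runs α n k β N s q _ (by simp) hqs (by simp [e.rvar, h0]) (by simp [e.rvar, h1])
                (by simp [h20]) (by simp [h21, hsum hqs]) (by simp [e.rarr, hs0]) hk).post ?_
              rintro τ ⟨e2, -, -, -, h4⟩
              refine Runs.nil (last τ (e1.trans e2) ?_)
              rcases h4 with ⟨h4, h5⟩ | ⟨h4, h5⟩
              · exact Or.inr ⟨k, hk, h5, h4⟩
              · refine Or.inl ⟨by simpa [h0'] using h5, fun i hi hheard => ?_⟩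
                rcases hheard.near hα hβ hN hs hf hqs hi with ⟨h6, h7⟩ | ⟨h6, h7⟩
                · exact hc' i hi h6 h7 hheard
                · rw [← hc, h2] at h7
                  exact h4 (h7 ▸ hheard)
            case hT =>
              simp only [IExp.cost]
              omega
          · intro hb
            have hpos : ¬ 0 < c := by simpa [h23] using hb
            refine Runs.skip (last υ e (Or.inl ⟨h0', fun i hi hheard => ?_⟩))
            rcases hheard.near hα hβ hN hs hf hqs hi with ⟨h6, h7⟩ | ⟨h6, h7⟩
            · exact hc' i hi h6 h7 hheard
            · exact hpos h6
        case hT =>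
          simp only [IExp.cost, Test.cost]
          omega
    case hT =>
      simp only [IExp.cost, Test.cost]
      omega
  have mid : ∀ υ, ScalarEq 20 50 σ υ → υ.ivar 23 = c → υ.rvar 20 = q → υ.rvar 21 = σ.rarr 9 j / σ.rarr 10 j →
      υ.ivar 40 = 0 →
      Runs ps (block [.ite (.ilt (.var 23) (.var 0)) (block [
        .iset 41 (.get 20 (.var 23)),
        .ite (.rle (.get 0 (.var 41)) (.var 20)) (.iset 40 (.add (.var 41) (.const 1))) (testCmd α)]) .skip,
        .ite (.ilt (.const 0) (.var 40)) .skip (.ite (.ilt (.const 0) (.var 23)) (block [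
        .iset 41 (.get 20 (.sub (.var 23) (.const 1))), testCmd α]) .skip),
        .iput 0 (.var 100) (.var 40)]) υ (2 * testCost α + 60) (fun τ => ∃ υ, ScalarEq 20 50 σ υ ∧
        ∃ v, τ = υ.putI 0 j v ∧ Answers α n β N s q v) := by
    intro υ e h23 h20 h21 h40
    apply Runs.le
    case h =>
      apply Runs.cons
      apply Runs.ite (T := testCost α + 20) (U := 1)
      · intro hb
        have hlt : c < n := by simpa [h23, e.ivar, hn] using hb
        obtain ⟨k, hk, h2, h3⟩ := hfr c hlt
        apply Runs.le
        case h =>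
          apply Runs.set (v := k) (by simp [h23, e.iarr, h2])
          have e1 : ScalarEq 20 50 σ (υ.setI 41 k) := e.setI (by simp)
          -- The entry at index `c` is not to the left of `q`, so the test `s k ≤ q` of the program
          -- is a test for equality.
          have hge : ¬ s k < q := (lt_iff_countLT (Finset.mem_range.2 hk) q).not.2 (by omega)
          apply Runs.cons
          apply Runs.ite (T := 4) (U := testCost α)
          · intro hb
            have hle : s k ≤ q := by simpa [e.rarr, hs0, h20] using hb
            have hqk : q = s k := le_antisymm (not_lt.1 hge) hle
            refine Runs.iset (Runs.nil (rest _ (e1.setI (by simp)) (by simp [h23]) (by simp [h20]) (by simp [h21]) ?_))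
            exact Or.inr ⟨k, hk, by simp, Or.inl hqk⟩
          · intro hb
            have hlt : q < s k := by simpa [e.rarr, hs0, h20] using hb
            have hqs := hne fun i _ h4 _ => by rw [← h4, h2]; exact hlt
            refine (testCmd_runs α n k β N s q _ (by simp) hqs (by simp [e.rvar, h0]) (by simp [e.rvar, h1])
              (by simp [h20]) (by simp [h21, hsum hqs]) (by simp [e.rarr, hs0]) hk).post ?_
            rintro τ ⟨e2, i2, q2, F2, h4⟩
            refine Runs.nil (rest τ (e1.trans e2) (by simp [i2, h23]) q2 (by simp [F2, h21]) ?_)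
            rcases h4 with ⟨h4, h5⟩ | ⟨h4, h5⟩
            · exact Or.inr ⟨k, hk, h5, h4⟩
            · refine Or.inl ⟨by simpa [h40] using h5, hqs, fun i _ _ h6 => ?_⟩
              rw [← h6, h2]
              exact h4
        case hT =>
          simp only [IExp.cost, RExp.cost, Test.cost]
          omega
      · intro hb
        have hlt : ¬ c < n := by simpa [h23, e.ivar, hn] using hb
        refine Runs.skip (rest υ e h23 h20 h21 (Or.inl ⟨h40, hne fun _ _ _ h => absurd h hlt, fun _ _ h => absurd h hlt⟩))
    case hT =>
      simp only [IExp.cost, Test.cost]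
      omega
  apply Runs.le
  case h =>
    unfold answerBody
    apply Runs.cons
    apply Runs.rset
    apply Runs.cons
    apply Runs.rset
    apply Runs.set (v := 0) rfl
    apply Runs.set (v := n) (by simp [hn])
    apply Runs.set (v := 0) rfl
    set τ0 := ((((σ.setR 20 _).setR 21 _).setI 21 0).setI 22 n).setI 40 0 with hτ0
    have e0 : ScalarEq 20 50 σ τ0 :=
      (((((ScalarEq.refl 20 50 σ).setR (by simp)).setR (by simp)).setI (by simp)).setI (by simp)).setI (by simp)
    have q0 : τ0.rvar 20 = q := by simp [hτ0, hj, hq]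
    have F0 : τ0.rvar 21 = σ.rarr 9 j / σ.rarr 10 j := by simp [hτ0, hj]
    have o0 : τ0.ivar 40 = 0 := by simp [hτ0]
    apply Runs.cons
    refine (searchCmd_runs 0 n c d q τ0 (by simp [hτ0]) (by simp [hτ0]) q0 hcn hd fun r hr => ?_).post ?_
    · obtain ⟨e, he, h2, h3⟩ := hfr r hr
      rw [e0.rarr, e0.iarr, zero_add, h2, hs0, ← h3]
      exact lt_iff_countLT (Finset.mem_range.2 he) q
    rintro τ1 ⟨e1, -, -, q1, c1⟩
    exact mid τ1 (e0.trans (e1.mono le_rfl (by simp))) c1 (by rw [q1, q0]) (by rw [q1, F0])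
      (by rw [e1.ivar 40 (by simp), o0])
  case hT =>
    simp only [IExp.cost, RExp.cost]
    omega

/-- The two memories agree on the data for the answers. -/
structure AnswerEq (σ τ : Mem) : Prop where
  ivar : ∀ x < 20, τ.ivar x = σ.ivar x
  rvar : ∀ x < 20, τ.rvar x = σ.rvar x
  rarr : τ.rarr = σ.rarr
  iarr : τ.iarr 20 = σ.iarr 20

theorem answerCmd_runs {ps : List Cmd} (α : ℕ) (hα : Even α) : ∃ c, ∀ (n m d : ℕ) (σ : Mem),
    1 < σ.rvar 0 → 0 < σ.rvar 1 → σ.ivar 0 = n → σ.ivar 1 = m → n < 2 ^ d → Set.InjOn (σ.rarr 0) {k | k < n} →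
    (∀ j < m, (∀ k < n, σ.rarr 1 j ≠ σ.rarr 0 k) →
      σ.rarr 9 j / σ.rarr 10 j = ∑ k ∈ Finset.range n, 1 / (σ.rarr 1 j - σ.rarr 0 k) ^ α) →
    (∀ e < n, σ.iarr 20 (countLT (Finset.range n) (σ.rarr 0) (σ.rarr 0 e)) = e) →
    Runs ps (answerCmd α) σ (c * ((d + 1) * (m + 1))) (fun τ => ∀ j < m,
      Answers α n (σ.rvar 0) (σ.rvar 1) (σ.rarr 0) (σ.rarr 1 j) (τ.iarr 0 j)) := by
  refine ⟨30 + 2 * testCost α + 80 + Sweep.cost (flat (.var 1)), fun n m d σ hβ hN hn hm hd hs hsum hf => ?_⟩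
  refine ((Sweep.runs (flat (.var 1)) ⟨m, 1, 1, 0, 0, 0⟩ one_pos one_pos (30 * (d + 1) + 2 * testCost α + 80) σ
    (fun p τ => AnswerEq σ τ ∧ ∀ j < p,
      Answers α n (σ.rvar 0) (σ.rvar 1) (σ.rarr 0) (σ.rarr 1 j) (τ.iarr 0 j)) ?_ ?_ ?_ ?_).post ?_).le ?_
  · rintro p τ υ e ⟨h1, h2⟩
    exact ⟨⟨fun x hx => (e.ivar x (by omega)).trans (h1.ivar x hx), fun x hx => by rw [e.rvar, h1.rvar x hx],
      by rw [e.rarr, h1.rarr], by rw [e.iarr, h1.iarr]⟩, by rw [e.iarr]; exact h2⟩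
  · rintro p τ ⟨h1, -⟩
    exact ⟨(h1.ivar 1 (by simp)).trans hm, rfl, rfl, rfl, rfl, rfl⟩
  · rintro p hp τ ⟨h1, h2⟩ hdg
    have hp' : p < m := hp
    refine (answerBody_runs α n d hα (σ.rvar 0) (σ.rvar 1) hβ hN (σ.rarr 0) (σ.rarr 1 p) p τ
      ((h1.ivar 0 (by simp)).trans hn) hd hs (by rw [h1.rarr]) (h1.rvar 0 (by simp)) (h1.rvar 1 (by simp))
      hdg.pos (by rw [h1.rarr]) ?_ ?_).post ?_
    · rw [h1.rarr]
      exact hsum p hp'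
    · rw [h1.iarr]
      exact hf
    rintro ω ⟨υ, e, v, rfl, hv⟩
    refine ⟨⟨⟨fun x hx => (e.ivar x (by omega)).trans (h1.ivar x hx),
      fun x hx => (e.rvar x (by omega)).trans (h1.rvar x hx), by rw [Mem.putI_rarr, e.rarr, h1.rarr],
      by simp [e.iarr, h1.iarr]⟩, ?_⟩, ?_⟩
    · intro j hj
      simp only [Mem.putI_iarr, if_true, Function.update_apply]
      by_cases hjp : j = p
      · rw [if_pos hjp, hjp]
        exact hv
      · rw [if_neg hjp, e.iarr]
        exact h2 j (by omega)
    · constructor <;> simp [e.ivar, hdg.pos, hdg.j, hdg.i, hdg.sj, hdg.si, hdg.sg]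
  · exact ⟨⟨fun _ _ => rfl, fun _ _ => rfl, rfl, rfl⟩, by simp⟩
  · rintro τ ⟨-, h⟩
    exact h
  · dsimp only
    generalize Sweep.cost (flat (.var 1)) = w
    generalize testCost α = t
    have h1 : 30 * (d + 1) + 2 * t + 80 + w ≤ (30 + 2 * t + 80 + w) * (d + 1) := by nlinarith
    rw [← mul_assoc]
    exact Nat.mul_le_mul_right _ h1

/-! ### The program -/

/-- An even power ignores the absolute value, and the interference is the total signal minus the own
signal. -/
theorem heard_iff {α n : ℕ} (hα : Even α) {β N : ℝ} {s : Fin n → ℝ} {S : ℕ → ℝ} (hS : ∀ i : Fin n, S i = s i)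
    (q : ℝ) (i : Fin n) : Heard α n β N S q i ↔ SINR.Receives α β N (fun _ => 1) s q i := by
  have h1 : (∀ j < n, q ≠ S j) ↔ ∀ j, q ≠ s j :=
    ⟨fun h j => by rw [← hS j]; exact h j j.2, fun h j hj => by rw [hS ⟨j, hj⟩]; exact h ⟨j, hj⟩⟩
  simp only [Heard, SINR.Receives, SINR.ratio, h1, hS, Finset.sum_range,
    Finset.sum_erase_eq_sub (Finset.mem_univ i), hα.pow_abs]

/-- The procedures of the program. -/
def procs : List Cmd := [mulBody, nodeBody, evalBody]

/-- The main command of the program. -/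
def mainCmd (α : ℕ) : Cmd := block [treeCmd α, batchCmd, sortCmd, answerCmd α]

theorem mainCmd_runs (α : ℕ) (hα : 0 < α) (hα' : Even α) : ∃ c, ∀ (n m : ℕ) (s : Fin n → ℝ) (q : Fin m → ℝ)
    (β N : ℝ), 3 ≤ n → Function.Injective s → 1 < β → 0 < N →
    Runs procs (mainCmd α) (SINR.input β N s q)
      (c * ((n + m) * ((α + Nat.clog 2 n + 1) ^ 2 * (Nat.log 2 (α + Nat.clog 2 n + 1) + 1))))
      (SINR.Reports α β N (fun _ => 1) s q) := by
  obtain ⟨cR, hcR⟩ := exists_mulBound (ps := procs) rfl rfl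
  obtain ⟨c1, hc1⟩ := treeCmd_runs (ps := procs) α hα
  obtain ⟨c2, hc2⟩ := batchCmd_runs (ps := procs) rfl
  obtain ⟨c3, hc3⟩ := sortCmd_runs (ps := procs)
  obtain ⟨c4, hc4⟩ := answerCmd_runs (ps := procs) α hα'
  refine ⟨c1 * cR * (2 * 2 ^ α) + c2 * cR * (2 * 2 ^ α + 1) + 2 * c3 + c4 + 1,
    fun n m s q β N hn hs hβ hN => ?_⟩
  set σ := SINR.input β N s q with hσ
  set κ := Nat.clog 2 n with hκ
  -- The longest products occur in the evaluation at `2 ^ (α + κ)` points, where padding doubles the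
  -- length.
  set K := α + κ + 1 with hK
  set R := cR * (K * (Nat.log 2 K + 1)) with hR
  have hMul : MulBound procs K R := hcR K (by omega)
  have i0 : σ.ivar 0 = n := by simp [hσ, SINR.input]
  have i1 : σ.ivar 1 = m := by simp [hσ, SINR.input]
  have r0 : σ.rvar 0 = β := by simp [hσ, SINR.input]
  have r1 : σ.rvar 1 = N := by simp [hσ, SINR.input]
  have hS : ∀ i : Fin n, σ.rarr 0 i = s i := fun i => by simp [hσ, SINR.input]
  have hq : ∀ j : Fin m, σ.rarr 1 j = q j := fun j => by simp [hσ, SINR.input]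
  have hinj : Set.InjOn (σ.rarr 0) {k | k < n} := by
    intro a ha b hb hab
    rw [hS ⟨a, ha⟩, hS ⟨b, hb⟩] at hab
    exact congrArg Fin.val (hs hab)
  have hd : n < 2 ^ (κ + 1) := by
    have : n ≤ 2 ^ κ := Nat.le_pow_clog (by simp) n
    rw [pow_succ]
    have : 0 < 2 ^ κ := by positivity
    omega
  apply Runs.le
  case h =>
    unfold mainCmd
    apply Runs.cons
    refine (hc1 K R hMul n (α + κ) σ i0 rfl (by omega)).post ?_
    rintro τ1 ⟨b1, l1, L1, s1⟩
    apply Runs.cons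
    refine (hc2 K R hMul (α + κ) m τ1 le_rfl (by rw [b1.ivar 1 (by simp), i1]) l1 L1).post ?_
    rintro τ2 ⟨b2, s2⟩
    have b2' := b1.trans (b2.anti (by simp))
    apply Runs.cons
    refine (hc3 n τ2 (by rw [b2'.ivar 0 (by simp), i0]) (by rw [b2'.rarr 0 (by simp)]; exact hinj)).post ?_
    rintro τ3 ⟨b3, s3⟩
    have b3' := b2'.trans (b3.anti (by simp))
    have hA : τ3.rarr 0 = σ.rarr 0 := b3'.rarr 0 (by simp)
    have hB : τ3.rarr 1 = σ.rarr 1 := b3'.rarr 1 (by simp)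
    have hV0 : τ3.rvar 0 = β := (b3'.rvar 0 (by simp)).trans r0
    have hV1 : τ3.rvar 1 = N := (b3'.rvar 1 (by simp)).trans r1
    apply Runs.cons
    refine (hc4 n m (κ + 1) τ3 (by rw [hV0]; exact hβ) (by rw [hV1]; exact hN)
      (by rw [b3'.ivar 0 (by simp), i0]) (by rw [b3'.ivar 1 (by simp), i1]) hd (by rw [hA]; exact hinj)
      (fun j hj hne => ?_) ?_).post ?_
    · rw [hA, hB] at hne ⊢
      obtain ⟨h1, h2⟩ := s1 (σ.rarr 1 j) hne
      obtain ⟨h3, h4⟩ := s2 j hj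
      rw [b3.rarr 9 (by simp), b3.rarr 10 (by simp), h3, h4, b1.rarr 1 (by simp), h2]
    · rw [b2'.rarr 0 (by simp)] at s3
      rw [hA]
      exact s3
    rintro τ4 s4
    refine Runs.nil fun j => ?_
    have h5 := s4 j j.2
    rw [hV0, hV1, hA, hB, hq] at h5
    rcases h5 with ⟨h5, h6⟩ | ⟨k, hk, h5, h6⟩
    · refine ⟨none, h5, fun i => ⟨by simp, fun h => absurd ((heard_iff hα' hS _ i).2 h) (h6 i i.2)⟩⟩
    · refine ⟨some ⟨k, hk⟩, h5, fun i => ?_⟩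
      rw [← heard_iff hα' hS]
      constructor
      · intro h
        obtain rfl := Option.some.inj h
        exact h6
      · intro h
        congr 1
        exact Fin.ext (h6.unique hα' hβ hN hinj hk i.2 h)
  case hT =>
    -- Rounding `n` up to a power of two at most doubles it, so the polynomials have O(n)
    -- coefficients, with a factor that depends on `α`.
    have hp : 2 ^ κ ≤ 2 * n := by
      have h1 := Nat.pow_pred_clog_lt_self (b := 2) (by simp) (show 1 < n by omega)
      have h2 : 0 < κ := Nat.clog_pos (by simp) (by omega)
      rw [← hκ] at h1
      have h3 : 2 ^ κ = 2 * 2 ^ (κ - 1) := by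
        rw [← pow_succ']
        congr 1
        omega
      rw [h3]
      exact Nat.mul_le_mul_left _ h1.le
    have hL : 2 ^ (α + κ) ≤ 2 * 2 ^ α * (n + m) := by
      rw [pow_add]
      calc 2 ^ α * 2 ^ κ ≤ 2 ^ α * (2 * n) := Nat.mul_le_mul_left _ hp
        _ ≤ 2 * 2 ^ α * (n + m) := by nlinarith [Nat.zero_le (2 ^ α * m)]
    set lam := Nat.log 2 K + 1 with hlam
    generalize 2 ^ (α + κ) = L at *
    generalize 2 ^ α = w at *
    have hK1 : 1 ≤ K := by omega
    have hlam1 : 1 ≤ lam := by omega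
    set U := K ^ 2 * lam with hU
    have hK2 : K ≤ K ^ 2 := Nat.le_self_pow (by simp) K
    have hKU : K ^ 2 ≤ U := Nat.le_mul_of_pos_right _ hlam1
    have e1 : (α + κ + 1) * (R * L) = cR * (U * L) := by rw [hR, hU]; ring
    have e2 : (α + κ + 1) * (R * (m + L)) = cR * (U * (m + L)) := by rw [hR, hU]; ring
    rw [e1, e2, ← hκ]
    have f1 : U * L ≤ 2 * w * ((n + m) * U) := by nlinarith [Nat.mul_le_mul_left U hL]
    have f2 : U * (m + L) ≤ (2 * w + 1) * ((n + m) * U) := by nlinarith [Nat.mul_le_mul_left U hL, Nat.zero_le (U * n)]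
    have f3 : (κ + 2) ^ 2 * (n + 1) ≤ 2 * ((n + m) * U) := by
      have : (κ + 2) ^ 2 ≤ U := (Nat.pow_le_pow_left (by omega) 2).trans hKU
      calc (κ + 2) ^ 2 * (n + 1) ≤ U * (2 * (n + m)) := Nat.mul_le_mul this (by omega)
        _ = _ := by ring
    have f4 : (κ + 1 + 1) * (m + 1) ≤ (n + m) * U := by
      calc (κ + 1 + 1) * (m + 1) ≤ U * (n + m) := Nat.mul_le_mul (by omega) (by omega)
        _ = _ := by ring
    have f5 : 1 ≤ (n + m) * U := Nat.mul_pos (by omega) (by omega)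
    generalize (n + m) * U = V at *
    have g1 := Nat.mul_le_mul_left (c1 * cR) f1
    have g2 := Nat.mul_le_mul_left (c2 * cR) f2
    have g3 := Nat.mul_le_mul_left c3 f3
    have g4 := Nat.mul_le_mul_left c4 f4
    have : (c1 * cR * (2 * w) + c2 * cR * (2 * w + 1) + 2 * c3 + c4 + 1) * V =
      c1 * cR * (2 * w * V) + c2 * cR * ((2 * w + 1) * V) + c3 * (2 * V) + c4 * V + V := by ring
    rw [this, ← mul_assoc c1, ← mul_assoc c2]
    omega

/-- Integer logarithms are compared with natural ones. Since `exp 1 < 3`, the double logarithm is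
bounded below by a positive number for `n ≥ 3` and can absorb additive constants. -/
theorem cost_le (α c : ℕ) : ∃ C : ℝ, ∀ n m : ℕ, 3 ≤ n →
    ((c * ((n + m) * ((α + Nat.clog 2 n + 1) ^ 2 * (Nat.log 2 (α + Nat.clog 2 n + 1) + 1))) : ℕ) : ℝ) ≤
      C * (((n : ℝ) + m) * Real.log n ^ 2 * Real.log (Real.log n)) := by
  set A : ℝ := α + 4 with hA
  set y0 : ℝ := Real.log (Real.log 3) with hy0
  have hlog3 : 1 < Real.log 3 := by
    rw [Real.lt_log_iff_exp_lt (by norm_num)]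
    linarith [Real.exp_one_lt_d9]
  have hy0pos : 0 < y0 := Real.log_pos hlog3
  have hA1 : 1 ≤ A := by
    have : (0 : ℝ) ≤ α := Nat.cast_nonneg α
    linarith
  -- With `K ≤ A * x` and `1 / log 2 ≤ 2`, the integer logarithm of `K` plus one is at most `2 log A
  -- + 1 + 2 log x`; the constant part is at most its quotient by `y0` times `log x`.
  set B : ℝ := (2 * Real.log A + 1) / y0 + 2 with hB
  refine ⟨c * (A ^ 2 * B), fun n m hn => ?_⟩
  have hn' : (3 : ℝ) ≤ n := by exact_mod_cast hn
  set x := Real.log n with hx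
  have hx3 : Real.log 3 ≤ x := Real.log_le_log (by norm_num) hn'
  have hy : y0 ≤ Real.log x := Real.log_le_log (by linarith) hx3
  have hlog2 := Real.log_two_gt_d9
  -- From `2 ^ (κ - 1) < n` one gets `κ - 1 ≤ x / log 2 ≤ 2 x`, and `1 ≤ x` accounts for the rest.
  have hκ : (Nat.clog 2 n : ℝ) ≤ 3 * x := by
    have h1 := Nat.pow_pred_clog_lt_self (b := 2) (by simp) (show 1 < n by omega)
    have h2 : 0 < Nat.clog 2 n := Nat.clog_pos (by simp) (by omega)
    obtain ⟨k, hk⟩ := Nat.exists_eq_succ_of_ne_zero h2.ne'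
    rw [hk] at h1 ⊢
    have h3 : (2 : ℝ) ^ k ≤ n := by exact_mod_cast h1.le
    have h4 := Real.log_le_log (by positivity) h3
    rw [Real.log_pow, ← hx] at h4
    push_cast
    nlinarith [(Nat.cast_nonneg k : (0 : ℝ) ≤ k)]
  set K := α + Nat.clog 2 n + 1 with hK
  have hKpos : (1 : ℝ) ≤ K := by exact_mod_cast (show 1 ≤ K by omega)
  have hKx : (K : ℝ) ≤ A * x := by
    have : (0 : ℝ) ≤ α := Nat.cast_nonneg α
    rw [hK, hA]
    push_cast
    nlinarith
  have hlogK : (Nat.log 2 K : ℝ) + 1 ≤ B * Real.log x := by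
    have h1 : (2 : ℝ) ^ Nat.log 2 K ≤ K := by exact_mod_cast Nat.pow_log_le_self 2 (by omega)
    have h2 := Real.log_le_log (by positivity) h1
    rw [Real.log_pow] at h2
    have h3 : Real.log K ≤ Real.log A + Real.log x := by
      rw [← Real.log_mul (by linarith) (by linarith)]
      exact Real.log_le_log (by linarith) hKx
    have h4 : 0 ≤ Real.log A := Real.log_nonneg hA1
    have h5 : 2 * Real.log A + 1 ≤ (2 * Real.log A + 1) / y0 * Real.log x := by
      rw [div_mul_eq_mul_div, le_div_iff₀ hy0pos]
      exact mul_le_mul_of_nonneg_left hy (by linarith)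
    have h6 : (Nat.log 2 K : ℝ) ≤ 2 * Real.log K := by
      nlinarith [(Nat.cast_nonneg _ : (0 : ℝ) ≤ Nat.log 2 K)]
    rw [hB, add_mul]
    linarith
  have hsq : (K : ℝ) ^ 2 * (Nat.log 2 K + 1) ≤ (A * x) ^ 2 * (B * Real.log x) :=
    mul_le_mul (pow_le_pow_left₀ (by linarith) hKx 2) hlogK (by positivity) (by positivity)
  push_cast
  calc (c : ℝ) * (((n : ℝ) + m) * ((K : ℝ) ^ 2 * (Nat.log 2 K + 1)))
      ≤ c * (((n : ℝ) + m) * ((A * x) ^ 2 * (B * Real.log x))) :=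
        mul_le_mul_of_nonneg_left (mul_le_mul_of_nonneg_left hsq (by positivity)) (by positivity)
    _ = _ := by ring

end RealRAM

theorem mainTheorem5 (α : ℕ) (hα : 0 < α) (hα_even : Even α) :
    ∃ (P : RealRAM.Program) (C : ℝ),
      ∀ (n m : ℕ) (s : Fin n → ℝ) (q : Fin m → ℝ) (β N : ℝ),
        3 ≤ n → Function.Injective s → 1 < β → 0 < N →
        ∃ (t : ℕ) (τ : RealRAM.Mem),
          P.Halts (SINR.input β N s q) t τ ∧
          (t : ℝ) ≤ C * (((n : ℝ) + m) * Real.log n ^ 2 * Real.log (Real.log n)) ∧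
          SINR.Reports α β N (fun _ => 1) s q τ := by
  obtain ⟨c, hc⟩ := RealRAM.mainCmd_runs α hα hα_even
  obtain ⟨C, hC⟩ := RealRAM.cost_le α c
  refine ⟨⟨RealRAM.procs, RealRAM.mainCmd α⟩, C, fun n m s q β N hn hs hβ hN => ?_⟩
  obtain ⟨t, τ, h1, h2, h3⟩ := hc n m s q β N hn hs hβ hN
  exact ⟨t, τ, h1, (Nat.cast_le.2 h2).trans (hC n m hn), h3⟩
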